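/- Let $k$ be an algebraically closed field, $Q$ a finite acyclic quiver, and $\mathcal{D}(Q)=\mathcal{D}^b(\mathrm{mod}\,kQ)$ the bounded derived category of finite dimensional $kQ$-modules (equivalently, of finite dimensional representations of $Q$), with its standard heart $\mathcal{H}_Q=\mathrm{mod}\,kQ$. *Definitions.* A heart means the heart $\mathcal{H}=\mathcal{P}\cap\mathcal{P}^{\perp}[1]$ of a bounded t-structure $\mathcal{P}$; put $\mathcal{H}_1\le\mathcal{H}_2$ if $\mathcal{P}_2\subseteq\mathcal{P}_1$. For a torsion pair $\langle\mathcal{F},\mathcal{T}\rangle$ in $\mathcal{H}$, the forward tilt $\mathcal{H}^\sharp$ (resp. backward tilt $\mathcal{H}^\flat$) is the heart of all $E$ that fit in a triangle $F[1]\to E\to T\to F[2]$ (resp. $F\to E\to T[-1]\to F[1]$) with $F\in\mathcal{F}$, $T\in\mathcal{T}$. For a simple object $S$ of $\mathcal{H}$ with $\mathrm{Ext}^1(S,S)=0$, write $\mathcal{H}^\sharp_S$ for the forward tilt with $\mathcal{F}=\langle S\rangle$ and $\mathcal{H}^\flat_S$ for the backward tilt with $\mathcal{T}=\langle S\rangle$,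 where $\langle S\rangle$ is the extension closure of $S$. The exchange graph $\mathrm{EG}(\mathcal{D}(Q))$ is the oriented graph whose vertices are the hearts and whose edges are the simple forward tiltings $\mathcal{H}\to\mathcal{H}^\sharp_S$, labelled by $S$; $\mathrm{EG}^\circ(Q)$ is its connected component containing $\mathcal{H}_Q$. For $N\ge 2$, $\mathrm{EG}^\circ_N(Q,\mathcal{H}_Q)$ is the connected component containing $\mathcal{H}_Q[1]$ of the full subgraph on the hearts $\mathcal{H}$ with $\mathcal{H}_Q[1]\le\mathcal{H}\le\mathcal{H}_Q[N-1]$. For a simple $S$ of $\mathcal{H}$ put $\mathcal{H}^{0\sharp}_S=\mathcal{H}$, $\mathcal{H}^{m\sharp}_S=(\mathcal{H}^{(m-1)\sharp}_S)^\sharp_{S[m-1]}$ and $\mathcal{H}^{m\flat}_S=(\mathcal{H}^{(m-1)\flat}_S)^\flat_{S[-(m-1)]}$ for $m\ge1$ (with $\mathcal{H}^{0\flat}_S=\mathcal{H}$), and $\mathcal{H}^{-m\sharp}_S=\mathcal{H}^{m\flat}_S$. The line $l(\mathcal{H},S)$ is the full subgraph on $\{\mathcal{H}^{m\sharp}_S\}_{m\in\mathbb{Z}}$;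 a line segment of length $m\ge1$ of it is a full subgraph on vertices $\{\mathcal{H}'^{\,i\flat}_{S'}\}_{i=0}^{m-1}$ with $l(\mathcal{H}',S')=l(\mathcal{H},S)$. A subgraph is convex if every line that meets it meets it in a single line segment. The cyclic completion of a convex subgraph $\mathrm{EG}_0$ is obtained by adding, for each line $l$ with $l\cap\mathrm{EG}_0=\{\mathcal{H}^{i\flat}_S\}_{i=0}^{m-1}$, one edge $e_l\colon\mathcal{H}\to\mathcal{H}^{(m-1)\flat}_S$; the segment $l\cap\mathrm{EG}_0$ together with $e_l$ is a basic cycle. **Proposition.** Let $N\ge2$. The line $l(\mathcal{H},S)$ is well defined for every $\mathcal{H}\in\mathrm{EG}^\circ(Q)$ and every simple $S$ of $\mathcal{H}$ (all the iterated tilts exist and are unique). $\mathrm{EG}^\circ_N(Q,\mathcal{H}_Q)$ is a convex subgraph of $\mathrm{EG}^\circ(Q)$. Every basic cycle in its cyclic completion is an oriented $(N-1)$-cycle (it has exactly $N-1$ vertices and $N-1$ edges). In $\mathrm{EG}^\circ_N(Q,\mathcal{H}_Q)$, the heart $\mathcal{H}_Q[1]$ is the unique source (vertex with no incoming edge) and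 $\mathcal{H}_Q[N-1]$ is the unique sink (vertex with no outgoing edge). -/

import Mathlib

open CategoryTheory CategoryTheory.Limits CategoryTheory.Pretriangulated
open CategoryTheory.Triangulated

universe w v v' u u'

/-! ### Oriented graphs (loops and multiple edges allowed) and their subgraphs -/

/-- An oriented graph: vertices, edges, and the source and target of each edge. -/
structure OrientedGraph where
  Vert : Type u
  Edge : Type v
  src : Edge → Vert
  tgt : Edge → Vert

namespace OrientedGraph

/-- A subgraph: a set of vertices and a set of edges between these vertices. -/
@[ext]
structure Subgraph (G : OrientedGraph.{v, u}) where
  verts : Set G.Vert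
  edges : Set G.Edge
  src_mem : ∀ e ∈ edges, G.src e ∈ verts
  tgt_mem : ∀ e ∈ edges, G.tgt e ∈ verts

variable {G : OrientedGraph.{v, u}}

/-- `H` is a subgraph of `K`. -/
def Subgraph.IsSubgraphOf (H K : Subgraph G) : Prop :=
  H.verts ⊆ K.verts ∧ H.edges ⊆ K.edges

/-- The intersection of two subgraphs. -/
def Subgraph.inter (H K : Subgraph G) : Subgraph G where
  verts := H.verts ∩ K.verts
  edges := H.edges ∩ K.edges
  src_mem e he := ⟨H.src_mem e he.1, K.src_mem e he.2⟩
  tgt_mem e he := ⟨H.tgt_mem e he.1, K.tgt_mem e he.2⟩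

/-- The full subgraph on a set of vertices. -/
def Subgraph.full (G : OrientedGraph.{v, u}) (V : Set G.Vert) : Subgraph G where
  verts := V
  edges := {e | G.src e ∈ V ∧ G.tgt e ∈ V}
  src_mem _ he := he.1
  tgt_mem _ he := he.2

/-- Two vertices are joined by an edge of `H`, in one direction or the other. -/
def Subgraph.Joined (H : Subgraph G) (a b : G.Vert) : Prop :=
  ∃ e ∈ H.edges, (G.src e = a ∧ G.tgt e = b) ∨ (G.src e = b ∧ G.tgt e = a)

/-- The connected component of the vertex `a` in the subgraph `H` (connectedness is that of the
underlying unoriented graph). -/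
def Subgraph.component (H : Subgraph G) (a : G.Vert) : Subgraph G where
  verts := {b | b ∈ H.verts ∧ Relation.ReflTransGen H.Joined a b}
  edges := {e | e ∈ H.edges ∧ Relation.ReflTransGen H.Joined a (G.src e)}
  src_mem e he := ⟨H.src_mem e he.1, he.2⟩
  tgt_mem e he := ⟨H.tgt_mem e he.1, he.2.tail ⟨e, he.1, Or.inl ⟨rfl, rfl⟩⟩⟩

/-- A source of `H`: a vertex of `H` at which no edge of `H` ends. -/
def Subgraph.IsSource (H : Subgraph G) (a : G.Vert) : Prop :=
  a ∈ H.verts ∧ ∀ e ∈ H.edges, G.tgt e ≠ a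

/-- A sink of `H`: a vertex of `H` at which no edge of `H` starts. -/
def Subgraph.IsSink (H : Subgraph G) (a : G.Vert) : Prop :=
  a ∈ H.verts ∧ ∀ e ∈ H.edges, G.src e ≠ a

/-- `H` is an oriented `n`-cycle, `n ≥ 1`: its vertices can be numbered `x₀, …, xₙ₋₁` without
repetition, and its edges `e₀, …, eₙ₋₁` without repetition, such that `eᵢ` goes from `xᵢ` to
`xᵢ₊₁` (indices modulo `n`). -/
def Subgraph.IsCycle (H : Subgraph G) (n : ℕ) : Prop :=
  1 ≤ n ∧ ∃ (x : ZMod n → G.Vert) (e : ZMod n → G.Edge),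
    Function.Injective x ∧ Set.range x = H.verts ∧
    Function.Injective e ∧ Set.range e = H.edges ∧
    ∀ i, G.src (e i) = x i ∧ G.tgt (e i) = x (i + 1)

end OrientedGraph

/-! ### Hearts of bounded t-structures and tilting -/

section Hearts

variable (D : Type u) [Category.{v} D] [Preadditive D] [HasZeroObject D] [HasShift D ℤ]
  [∀ n : ℤ, (shiftFunctor D n).Additive] [Pretriangulated D]

/-- A heart in `D`, encoded by the bounded t-structure that it determines. The t-structure `𝒫` is
`t.le 0`, its orthogonal `𝒫^⊥` is `t.ge 1`, and the heart `𝒫 ∩ 𝒫^⊥[1]` is `t.heart`. -/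
@[ext]
structure BddHeart where
  t : TStructure D
  bounded : ∀ X : D, t.bounded X

variable {D}

namespace BddHeart

/-- `H.mem X`: the object `X` lies in the heart `H`. -/
def mem (H : BddHeart D) : ObjectProperty D := H.t.heart

/-- The order on hearts: `H₁ ≤ H₂` if and only if `𝒫₂ ⊆ 𝒫₁`. -/
def LE (H₁ H₂ : BddHeart D) : Prop := ∀ X : D, H₂.t.le 0 X → H₁.t.le 0 X

/-- The shifted heart `H[k]`, with t-structure `𝒫[k]`. -/
def shift (H : BddHeart D) (k : ℤ) : BddHeart D where
  t :=
    { le := fun n => H.t.le (n - k)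
      ge := fun n => H.t.ge (n - k)
      le_shift := fun n a n' h X hX => H.t.le_shift (n - k) a (n' - k) (by omega) X hX
      ge_shift := fun n a n' h X hX => H.t.ge_shift (n - k) a (n' - k) (by omega) X hX
      zero' := fun X Y f hX hY =>
        H.t.zero_of_isLE_of_isGE f (0 - k) (1 - k) (by omega) ⟨hX⟩ ⟨hY⟩
      le_zero_le := H.t.le_monotone (by omega)
      ge_one_le := H.t.ge_antitone (by omega)
      exists_triangle_zero_one := fun A => H.t.exists_triangle A (0 - k) (1 - k) (by omega) }
  bounded X := by
    obtain ⟨⟨a, ha⟩, ⟨b, hb⟩⟩ := H.bounded X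
    refine ⟨⟨a + k, ⟨?_⟩⟩, ⟨b + k, ⟨?_⟩⟩⟩
    · simpa using ha.ge
    · simpa using hb.le

/-- `S` is a simple object of the (abelian) heart `H`. -/
def IsSimple (H : BddHeart D) (S : D) : Prop :=
  ∃ hS : H.t.heart S, Simple (⟨S, hS⟩ : H.t.heart.FullSubcategory)

/-- A torsion pair `⟨F, T⟩` in the heart `H`. The short exact sequences in `H` are the
distinguished triangles with all three objects in `H`. -/
structure IsTorsionPair (H : BddHeart D) (F T : ObjectProperty D) : Prop where
  isoF : F.IsClosedUnderIsomorphisms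
  isoT : T.IsClosedUnderIsomorphisms
  memF : ∀ X, F X → H.mem X
  memT : ∀ X, T X → H.mem X
  hom_eq_zero : ∀ (X Y : D) (f : X ⟶ Y), T X → F Y → f = 0
  exists_ses : ∀ E : D, H.mem E → ∃ (X Y : D) (f : X ⟶ E) (g : E ⟶ Y) (h : Y ⟶ X⟦(1 : ℤ)⟧),
    T X ∧ F Y ∧ Triangle.mk f g h ∈ distTriang D

end BddHeart

/-- `S` is rigid: `Ext¹(S, S) = Hom(S, S[1]) = 0`. -/
def IsRigid (S : D) : Prop := ∀ f : S ⟶ S⟦(1 : ℤ)⟧, f = 0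

/-- `⟨S⟩`: the objects obtained from `S` by finitely many extensions. -/
inductive ExtGenerated (S : D) : D → Prop
  | zero {X : D} (hX : IsZero X) : ExtGenerated S X
  | base {X : D} (e : X ≅ S) : ExtGenerated S X
  | ext {X E Y : D} (f : X ⟶ E) (g : E ⟶ Y) (h : Y ⟶ X⟦(1 : ℤ)⟧)
      (hT : Triangle.mk f g h ∈ distTriang D) (hX : ExtGenerated S X) (hY : ExtGenerated S Y) :
      ExtGenerated S E

namespace BddHeart

/-- `H'` is the forward tilt `H^♯` of `H` with respect to the torsion pair `⟨F, T⟩`: it consists of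
the `E` whose homology with respect to `H` is `H₁(E) ∈ F`, `H₀(E) ∈ T` and zero otherwise, that is,
whose canonical filtration is `X[1] → E → Y` with `X ∈ F` and `Y ∈ T`. -/
def IsForwardTilt (H : BddHeart D) (F T : ObjectProperty D) (H' : BddHeart D) : Prop :=
  H.IsTorsionPair F T ∧ ∀ E : D, H'.mem E ↔
    ∃ (X Y : D) (f : X⟦(1 : ℤ)⟧ ⟶ E) (g : E ⟶ Y) (h : Y ⟶ X⟦(1 : ℤ)⟧⟦(1 : ℤ)⟧),
      F X ∧ T Y ∧ Triangle.mk f g h ∈ distTriang D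

/-- `H'` is the backward tilt `H^♭` of `H` with respect to the torsion pair `⟨F, T⟩`: it consists
of the `E` whose homology with respect to `H` is `H₀(E) ∈ F`, `H₋₁(E) ∈ T` and zero otherwise, that
is, whose canonical filtration is `X → E → Y[-1]` with `X ∈ F` and `Y ∈ T`. -/
def IsBackwardTilt (H : BddHeart D) (F T : ObjectProperty D) (H' : BddHeart D) : Prop :=
  H.IsTorsionPair F T ∧ ∀ E : D, H'.mem E ↔
    ∃ (X Y : D) (f : X ⟶ E) (g : E ⟶ Y⟦(-1 : ℤ)⟧) (h : Y⟦(-1 : ℤ)⟧ ⟶ X⟦(1 : ℤ)⟧),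
      F X ∧ T Y ∧ Triangle.mk f g h ∈ distTriang D

/-- `H'` is the simple forward tilt of `H` at the rigid simple `S`: the torsion-free part is
generated by `S`. -/
def IsSimpleForwardTilt (H : BddHeart D) (S : D) (H' : BddHeart D) : Prop :=
  H.IsSimple S ∧ IsRigid S ∧ ∃ T : ObjectProperty D, H.IsForwardTilt (ExtGenerated S) T H'

/-- `H'` is the simple backward tilt of `H` at the rigid simple `S`: the torsion part is
generated by `S`. -/
def IsSimpleBackwardTilt (H : BddHeart D) (S : D) (H' : BddHeart D) : Prop :=
  H.IsSimple S ∧ IsRigid S ∧ ∃ F : ObjectProperty D, H.IsBackwardTilt F (ExtGenerated S) H'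

end BddHeart

/-! ### The exchange graph -/

variable (D) in
/-- An edge of the exchange graph: a simple forward tilting from `src` to `tgt`, labelled by the
(isomorphism class of the) simple at which one tilts. -/
@[ext]
structure ExchangeEdge where
  src : BddHeart D
  tgt : BddHeart D
  label : Quotient (isIsomorphicSetoid D)
  isTilt : ∃ S : D, Quotient.mk (isIsomorphicSetoid D) S = label ∧ src.IsSimpleForwardTilt S tgt

variable (D) in
/-- The exchange graph `EG(D)`. -/
def exchangeGraph : OrientedGraph.{u, u} where
  Vert := BddHeart D
  Edge := ExchangeEdge D
  src := ExchangeEdge.src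
  tgt := ExchangeEdge.tgt

open OrientedGraph

/-- The connected component of the heart `H₀` in the exchange graph `EG(D)`. -/
def EGcomponent (H₀ : BddHeart D) : Subgraph (exchangeGraph D) :=
  (Subgraph.full (exchangeGraph D) Set.univ).component H₀

/-- The exchange graph with base `H₀`: the full subgraph `EG_N(D, H₀)` of `EG(D)` on the hearts `H`
with `H₀[1] ≤ H ≤ H₀[N-1]`. -/
def EGbase (N : ℕ) (H₀ : BddHeart D) : Subgraph (exchangeGraph D) :=
  Subgraph.full (exchangeGraph D)
    {H : BddHeart D | (H₀.shift 1).LE H ∧ H.LE (H₀.shift ((N : ℤ) - 1))}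

/-- The principal component `EG°_N(D, H₀)` of `EG_N(D, H₀)`: the connected component that contains
`H₀[1]`. -/
def EGbasePrincipal (N : ℕ) (H₀ : BddHeart D) : Subgraph (exchangeGraph D) :=
  (EGbase N H₀).component (H₀.shift 1)

/-! ### Lines, convexity and cyclic completion -/

/-- `l` is the sequence of iterated simple tilts of `H` at `S`: `l m = H^{m♯}_S` and
`l (-m) = H^{m♭}_S` for `m ≥ 0`, so that `l (m + 1)` is the forward tilt of `l m` at `S[m]`, and
`l (-m - 1)` is the backward tilt of `l (-m)` at `S[-m]`. -/
structure IsIteratedTilt (H : BddHeart D) (S : D) (l : ℤ → BddHeart D) : Prop where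
  zero : l 0 = H
  forward : ∀ m : ℕ, (l m).IsSimpleForwardTilt (S⟦(m : ℤ)⟧) (l (m + 1))
  backward : ∀ m : ℕ, (l (-m)).IsSimpleBackwardTilt (S⟦-(m : ℤ)⟧) (l (-m - 1))

/-- A line `l(H, S)`: the full subgraph of `EG(D)` on the iterated tilts of a heart `H` at a
simple `S` of `H`. -/
def IsLine (L : Subgraph (exchangeGraph D)) : Prop :=
  ∃ (H : BddHeart D) (S : D) (l : ℤ → BddHeart D), H.IsSimple S ∧ IsIteratedTilt H S l ∧
    L = Subgraph.full (exchangeGraph D) (Set.range l)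

/-- `W` is a line segment of length `m ≥ 1` of the line `L`: the full subgraph on
`{H^{i♭}_S | 0 ≤ i ≤ m - 1}` where `L = l(H, S)`. Its end points are `top = H` and
`bot = H^{(m-1)♭}_S`. -/
def IsLineSegment (L W : Subgraph (exchangeGraph D)) (m : ℕ) (top bot : BddHeart D) : Prop :=
  1 ≤ m ∧ ∃ (S : D) (l : ℤ → BddHeart D), top.IsSimple S ∧ IsIteratedTilt top S l ∧
    L = Subgraph.full (exchangeGraph D) (Set.range l) ∧
    W = Subgraph.full (exchangeGraph D) {H : BddHeart D | ∃ i : ℕ, i < m ∧ H = l (-i)} ∧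
    bot = l (-((m : ℤ) - 1))

/-- A subgraph `EG₀` of the exchange graph is convex if any line that meets it meets it in a single
line segment. -/
def IsConvex (EG₀ : Subgraph (exchangeGraph D)) : Prop :=
  ∀ L : Subgraph (exchangeGraph D), IsLine L → (L.inter EG₀).verts.Nonempty →
    ∃ (m : ℕ) (top bot : BddHeart D), IsLineSegment L (L.inter EG₀) m top bot

/-- The edge `e_l` added to `EG₀` for each line `l` that meets `EG₀` in a line segment: it goes
from `top = H` to `bot = H^{(m-1)♭}_S` if `l ∩ EG₀` is the line segment
`{H^{i♭}_S | 0 ≤ i ≤ m - 1}`. The line determines `top` and `bot`. -/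
@[ext]
structure AddedEdge (EG₀ : Subgraph (exchangeGraph D)) where
  line : Subgraph (exchangeGraph D)
  top : BddHeart D
  bot : BddHeart D
  top_mem : top ∈ EG₀.verts
  bot_mem : bot ∈ EG₀.verts
  isSegment : ∃ m : ℕ, IsLineSegment line (line.inter EG₀) m top bot

/-- The cyclic completion of a convex subgraph `EG₀`: the edges `e_l` are added to it. -/
def cyclicCompletion (EG₀ : Subgraph (exchangeGraph D)) : OrientedGraph.{u, u} where
  Vert := {H : BddHeart D // H ∈ EG₀.verts}
  Edge := {e : ExchangeEdge D // e ∈ EG₀.edges} ⊕ AddedEdge EG₀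
  src := Sum.elim (fun e => ⟨e.1.src, EG₀.src_mem e.1 e.2⟩) (fun e => ⟨e.top, e.top_mem⟩)
  tgt := Sum.elim (fun e => ⟨e.1.tgt, EG₀.tgt_mem e.1 e.2⟩) (fun e => ⟨e.bot, e.bot_mem⟩)

/-- The basic cycle induced by a line `l`: the line segment `l ∩ EG₀` together with `e_l`. -/
def basicCycle {EG₀ : Subgraph (exchangeGraph D)} (a : AddedEdge EG₀) :
    Subgraph (cyclicCompletion EG₀) where
  verts := {H : {H : BddHeart D // H ∈ EG₀.verts} | H.1 ∈ a.line.verts}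
  edges := {e : {e : ExchangeEdge D // e ∈ EG₀.edges} ⊕ AddedEdge EG₀ |
    Sum.elim (fun e' => e'.1 ∈ a.line.edges) (fun a' => a' = a) e}
  src_mem := by
    obtain ⟨m, hm, S, l, -, hl, hL, -, -⟩ := a.isSegment
    rintro (e | a') h
    · exact a.line.src_mem _ h
    · obtain rfl : a' = a := h
      change a'.top ∈ a'.line.verts
      rw [hL]
      exact ⟨0, hl.zero⟩
  tgt_mem := by
    obtain ⟨m, hm, S, l, -, hl, hL, -, hb⟩ := a.isSegment
    rintro (e | a') h
    · exact a.line.tgt_mem _ h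
    · obtain rfl : a' = a := h
      change a'.bot ∈ a'.line.verts
      rw [hL, hb]
      exact ⟨_, rfl⟩

end Hearts

/-! ### The bounded derived category of a quiver -/

/-- The quiver has no oriented cycles. -/
def QuiverIsAcyclic (Q : Type u) [Quiver.{v} Q] : Prop :=
  ∀ (a : Q) (p : Quiver.Path a a), p = Quiver.Path.nil

/-- The category of finite dimensional representations of `Q` over `k`, that is, the category
`mod kQ` of finite dimensional modules over the path algebra `kQ` (for `Q` a finite quiver). -/
abbrev QuiverRep (k : Type u') [Field k] (Q : Type u) [Quiver.{v} Q] :=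
  Paths Q ⥤ FGModuleCat.{u'} k

section DerivedCategoryOfQuiver

variable (k : Type u') [Field k] (Q : Type u) [Quiver.{v} Q]
  [HasDerivedCategory.{w} (QuiverRep k Q)]

/-- The bounded derived category `D(Q) = D^b(mod kQ)`. -/
abbrev DQ := DerivedCategory.Bounded (QuiverRep k Q)

/-- The canonical heart `H_Q = mod kQ` of `D(Q)`, the heart of the standard t-structure. -/
noncomputable def standardHeart : BddHeart (DQ k Q) where
  t := (DerivedCategory.TStructure.t (C := QuiverRep k Q)).onBounded
  bounded X := by
    obtain ⟨⟨a, ha⟩, ⟨b, hb⟩⟩ := X.property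
    exact ⟨⟨a, ⟨ha.ge⟩⟩, ⟨b, ⟨hb.le⟩⟩⟩

/-- `EG°(Q)`: the connected component of `H_Q` in `EG(D(Q))`. -/
noncomputable def EGQ : OrientedGraph.Subgraph (exchangeGraph (DQ k Q)) :=
  EGcomponent (standardHeart k Q)

/-- `EG°_N(Q, H_Q)`. -/
noncomputable def EGNQ (N : ℕ) : OrientedGraph.Subgraph (exchangeGraph (DQ k Q)) :=
  EGbasePrincipal N (standardHeart k Q)

end DerivedCategoryOfQuiver

/-! Write `Hom^m(X, Y)` for `Hom(X, Y[m])`. The invariant is `IsExceptionalHeart`: the simples `S i`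
of the heart are rigid bricks, and for `i ≠ j` a nonzero `Hom^m(S i, S j)` increases some integer
rank. In a triangulated category with finite dimensional Homs and a hereditary heart `H₀`, this
property survives every simple tilt, in both directions (`exists_forward`, `exists_backward`). As
`H_Q` has it, all hearts of `EG°(Q)` have it, so the iterated tilts exist; uniqueness is formal,
since the simple determines the torsion pair.

Stability rests on heredity. A brick is a shift of an object of `H₀` (`exists_degree`), so `S i` has
a degree `d i`, and `Hom^m(S i, S j) ≠ 0` forces `m = d i - d j` or `m = d i - d j + 1`. A lemma of
Happel–Ringel type (`mono_or_epi`) excludes both at once (`concentrated`). Hence the universal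
extension of `S i` by `S p`, formed when `Hom^1(S i, S p) ≠ 0`, kills `Hom^m` to `S p` for every
`m`, and the mutated family again consists of the simples of a heart, which is the tilt. A new rank
exists because no path of nonzero graded Homs leads from an `a` with `Hom^1(S a, S p) ≠ 0` to a `b`
with `Hom^m(S b, S p) ≠ 0`, `m ≥ 2` (`no_path_forward`); backward tilts are dual.

On a line the `i`-th heart is tilted at `S[i]`, of degree `d + i`. Simples of a heart between
`H₀[1]` and `H₀[N-1]` have degree in `1, …, N-1`, and a tilt stays in this interval as long as the
degree does. So a line that meets the principal component meets it in the `N - 1` hearts with `1 ≤ d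
+ i ≤ N - 1`, which gives convexity. The only edges on a line join consecutive hearts (`eq_succ`,
`label_unique`), which gives the cycles. A heart all of whose simples have degree `c` is `H₀[c]`;
any other heart of the component has a simple at which it can be tilted further without leaving.
Tilting at the simples in order of rank leads from `H` to `H[1]`, so the shifts of `H₀` are reached.

For the quiver, the vertex simples have injective resolutions of length one made of functions on
paths. They yield heredity, the rank and finiteness (`HereditarySimples`). -/

set_option linter.unusedSectionVars false

/-! ### Vanishing of Homs, extensions and filtrations in a triangulated category. -/

section TriangulatedGeneralities

open ZeroObject

variable {D : Type u} [Category.{v} D] [Preadditive D] [HasZeroObject D] [HasShift D ℤ]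
  [∀ n : ℤ, (shiftFunctor D n).Additive] [Pretriangulated D]

/-- `Hom(X, Y[m]) = 0`. -/
def HomVanish (X Y : D) (m : ℤ) : Prop := ∀ f : X ⟶ Y⟦m⟧, f = 0

/-- There is a distinguished triangle `X → E → Y → X[1]`. -/
def IsExt (X E Y : D) : Prop :=
  ∃ (f : X ⟶ E) (g : E ⟶ Y) (h : Y ⟶ X⟦(1 : ℤ)⟧), Triangle.mk f g h ∈ distTriang D

section

variable {A B C : D} {f : A ⟶ B} {g : B ⟶ C} {h : C ⟶ A⟦(1 : ℤ)⟧}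
  (hT : Triangle.mk f g h ∈ distTriang D)
include hT

lemma dist_comp₁₂ : f ≫ g = 0 := comp_distTriang_mor_zero₁₂ _ hT

lemma dist_comp₂₃ : g ≫ h = 0 := comp_distTriang_mor_zero₂₃ _ hT

lemma dist_desc₂ {X : D} (x : B ⟶ X) (hx : f ≫ x = 0) : ∃ y : C ⟶ X, x = g ≫ y :=
  Triangle.yoneda_exact₂ _ hT x hx

lemma dist_desc₃ {X : D} (x : C ⟶ X) (hx : g ≫ x = 0) : ∃ y : A⟦(1 : ℤ)⟧ ⟶ X, x = h ≫ y :=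
  Triangle.yoneda_exact₃ _ hT x hx

lemma dist_lift₂ {X : D} (x : X ⟶ B) (hx : x ≫ g = 0) : ∃ y : X ⟶ A, x = y ≫ f :=
  Triangle.coyoneda_exact₂ _ hT x hx

lemma dist_lift₃ {X : D} (x : X ⟶ C) (hx : x ≫ h = 0) : ∃ y : X ⟶ B, x = y ≫ g :=
  Triangle.coyoneda_exact₃ _ hT x hx

end

lemma nonempty_iso_of_fibers {K K' B C : D} {i : K ⟶ B} {i' : K' ⟶ B} {f : B ⟶ C}
    {q : C ⟶ K⟦(1 : ℤ)⟧} {q' : C ⟶ K'⟦(1 : ℤ)⟧} (h : Triangle.mk i f q ∈ distTriang D)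
    (h' : Triangle.mk i' f q' ∈ distTriang D) : Nonempty (K ≅ K') :=
  ⟨(shiftFunctor D (1 : ℤ)).preimageIso (Triangle.π₃.mapIso
    (isoTriangleOfIso₁₂ _ _ (rot_of_distTriang _ h) (rot_of_distTriang _ h') (Iso.refl _)
      (Iso.refl _) (show f ≫ 𝟙 C = 𝟙 B ≫ f by simp)))⟩

namespace HomVanish

lemma of_iso_left {X X' Y : D} {m : ℤ} (e : X ≅ X') (h : HomVanish X Y m) : HomVanish X' Y m := by
  intro f
  have := h (e.hom ≫ f)
  rwa [Preadditive.IsIso.comp_left_eq_zero] at this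

lemma of_iso_right {X Y Y' : D} {m : ℤ} (e : Y ≅ Y') (h : HomVanish X Y m) :
    HomVanish X Y' m := by
  intro f
  have := h (f ≫ (e.inv)⟦m⟧')
  rwa [Preadditive.IsIso.comp_right_eq_zero] at this

lemma zero_iff {X Y : D} : HomVanish X Y 0 ↔ ∀ f : X ⟶ Y, f = 0 := by
  constructor
  · intro h f
    have := h (f ≫ (shiftFunctorZero D ℤ).inv.app Y)
    rwa [Preadditive.IsIso.comp_right_eq_zero] at this
  · intro h f
    have := h (f ≫ (shiftFunctorZero D ℤ).hom.app Y)
    rwa [Preadditive.IsIso.comp_right_eq_zero] at this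

lemma shift_right {X Y : D} {a m n : ℤ} (hn : n = a + m) :
    HomVanish X (Y⟦a⟧) m ↔ HomVanish X Y n := by
  subst hn
  constructor
  · intro h f
    have := h (f ≫ (shiftFunctorAdd D a m).hom.app Y)
    rwa [Preadditive.IsIso.comp_right_eq_zero] at this
  · intro h f
    have := h (f ≫ (shiftFunctorAdd D a m).inv.app Y)
    rwa [Preadditive.IsIso.comp_right_eq_zero] at this

lemma shift_left {X Y : D} {a m n : ℤ} (hn : m = n + a) :
    HomVanish (X⟦a⟧) Y m ↔ HomVanish X Y n := by
  subst hn
  constructor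
  · intro h f
    apply (shiftFunctor D a).map_injective
    rw [Functor.map_zero]
    have := h (f⟦a⟧' ≫ (shiftFunctorAdd D n a).inv.app Y)
    rwa [Preadditive.IsIso.comp_right_eq_zero] at this
  · intro h f
    obtain ⟨g, hg⟩ := (shiftFunctor D a).map_surjective (f ≫ (shiftFunctorAdd D n a).hom.app Y)
    rw [h g, Functor.map_zero] at hg
    have := hg.symm
    rwa [Preadditive.IsIso.comp_right_eq_zero] at this

lemma of_isZero_left {X Y : D} {m : ℤ} (h : IsZero X) : HomVanish X Y m :=
  fun _ => h.eq_of_src _ _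

lemma of_isZero_right {X Y : D} {m : ℤ} (h : IsZero Y) : HomVanish X Y m :=
  fun _ => (Functor.map_isZero (shiftFunctor D m) h).eq_of_tgt _ _

lemma isZero_of_self {X : D} (h : HomVanish X X 0) : IsZero X := by
  rw [IsZero.iff_id_eq_zero]
  exact zero_iff.1 h _

lemma isZero_of_shift {X : D} {a : ℤ} (h : IsZero (X⟦a⟧)) : IsZero X :=
  isZero_of_self ((shift_left (m := a) (by omega)).1 (of_isZero_left h))

end HomVanish

section

variable {A B C X : D} {f : A ⟶ B} {g : B ⟶ C} {h : C ⟶ A⟦(1 : ℤ)⟧}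
  (hT : Triangle.mk f g h ∈ distTriang D)
include hT

/-- The kernel of composition with `f` comes from `Hom(X, C[-1])`. For a triangle in a heart this
makes `f` a monomorphism there, without recourse to the abelian structure. -/
lemma dist_eq_zero_of_comp₁ (hX : HomVanish X C (-1)) {x : X ⟶ A} (hx : x ≫ f = 0) : x = 0 := by
  have hT' := inv_rot_of_distTriang _ hT
  obtain ⟨y, rfl⟩ := Triangle.coyoneda_exact₂ _ hT' x hx
  have : y = 0 := hX y
  subst this
  exact zero_comp

lemma dist_eq_zero_of_comp₂ (hX : HomVanish A X (-1)) {x : C ⟶ X} (hx : g ≫ x = 0) : x = 0 := by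
  obtain ⟨y, rfl⟩ := dist_desc₃ hT x hx
  have : HomVanish (A⟦(1 : ℤ)⟧) X 0 := (HomVanish.shift_left (by omega)).2 hX
  rw [HomVanish.zero_iff.1 this y, comp_zero]

lemma dist_eq_zero_of_comp₃ (hX : HomVanish B X (-1)) {x : A⟦(1 : ℤ)⟧ ⟶ X} (hx : h ≫ x = 0) :
    x = 0 := by
  have : HomVanish (B⟦(1 : ℤ)⟧) X 0 := (HomVanish.shift_left (by omega)).2 hX
  obtain ⟨y, hy⟩ := dist_desc₂ (rot_of_distTriang _ (rot_of_distTriang _ hT)) x hx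
  have hy0 : y = 0 := HomVanish.zero_iff.1 this y
  subst hy0
  exact hy.trans comp_zero

end

namespace IsExt

variable {A B C A' B' C' X Y : D} {m n : ℤ}

lemma rotate (h : IsExt A B C) : IsExt B C (A⟦(1 : ℤ)⟧) := by
  obtain ⟨f, g, k, hT⟩ := h
  exact ⟨_, _, _, rot_of_distTriang _ hT⟩

lemma invRotate (h : IsExt A B C) : IsExt (C⟦(-1 : ℤ)⟧) A B := by
  obtain ⟨f, g, k, hT⟩ := h
  exact ⟨_, _, _, inv_rot_of_distTriang _ hT⟩

lemma shift (h : IsExt A B C) (a : ℤ) : IsExt (A⟦a⟧) (B⟦a⟧) (C⟦a⟧) := by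
  obtain ⟨f, g, k, hT⟩ := h
  exact ⟨_, _, _, Triangle.shift_distinguished _ hT a⟩

lemma of_dist {f : A ⟶ B} {g : B ⟶ C} {h : C ⟶ A⟦(1 : ℤ)⟧}
    (hT : Triangle.mk f g h ∈ distTriang D) : IsExt A B C := ⟨f, g, h, hT⟩

lemma of_iso (h : IsExt A B C) (a : A ≅ A') (b : B ≅ B') (c : C ≅ C') : IsExt A' B' C' := by
  obtain ⟨f, g, k, hT⟩ := h
  refine ⟨a.inv ≫ f ≫ b.hom, b.inv ≫ g ≫ c.hom, c.inv ≫ k ≫ a.hom⟦1⟧', ?_⟩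
  exact isomorphic_distinguished _ hT _ (Triangle.isoMk _ _ a.symm b.symm c.symm
    (show (a.inv ≫ f ≫ b.hom) ≫ b.inv = a.inv ≫ f by simp)
    (show (b.inv ≫ g ≫ c.hom) ≫ c.inv = b.inv ≫ g by simp)
    (show (c.inv ≫ k ≫ a.hom⟦1⟧') ≫ a.inv⟦1⟧' = c.inv ≫ k by simp [← Functor.map_comp]))

lemma id_zero (A : D) (hC : IsZero C) : IsExt A A C := by
  have : IsExt A A (0 : D) := ⟨_, _, _, contractible_distinguished A⟩
  exact this.of_iso (Iso.refl _) (Iso.refl _) ((isZero_zero D).iso hC)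

lemma zero_id (A : D) (hC : IsZero C) : IsExt C A A := by
  have : IsExt (0 : D) A A := ⟨_, _, _, contractible_distinguished₁ A⟩
  exact this.of_iso ((isZero_zero D).iso hC) (Iso.refl _) (Iso.refl _)

lemma isoOfIsZeroRight (h : IsExt A B C) (hC : IsZero C) : Nonempty (A ≅ B) := by
  obtain ⟨f, g, k, hT⟩ := h
  have : IsIso f := (Triangle.isZero₃_iff_isIso₁ _ hT).1 hC
  exact ⟨asIso f⟩

lemma isoOfIsZeroLeft (h : IsExt A B C) (hA : IsZero A) : Nonempty (B ≅ C) := by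
  obtain ⟨f, g, k, hT⟩ := h
  have : IsIso g := (Triangle.isZero₁_iff_isIso₂ _ hT).1 hA
  exact ⟨asIso g⟩

lemma isoOfIsZeroMiddle (h : IsExt A B C) (hB : IsZero B) : Nonempty (C ≅ A⟦(1 : ℤ)⟧) := by
  obtain ⟨f, g, k, hT⟩ := h
  have : IsIso k := (Triangle.isZero₂_iff_isIso₃ _ hT).1 hB
  exact ⟨asIso k⟩

/-- `Hom(-, Y[m])` is exact in the middle. -/
lemma vanish₂ (h : IsExt A B C) (hA : HomVanish A Y m) (hC : HomVanish C Y m) :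
    HomVanish B Y m := by
  obtain ⟨f, g, k, hT⟩ := h
  intro x
  obtain ⟨y, rfl⟩ := dist_desc₂ hT x (hA _)
  rw [hC y, comp_zero]

lemma vanish₃ (h : IsExt A B C) (hA : HomVanish A Y n) (hB : HomVanish B Y m)
    (hn : m = n + 1 := by omega) : HomVanish C Y m :=
  h.rotate.vanish₂ hB ((HomVanish.shift_left hn).2 hA)

lemma vanish₁ (h : IsExt A B C) (hC : HomVanish C Y n) (hB : HomVanish B Y m)
    (hn : n = m + 1 := by omega) : HomVanish A Y m :=
  h.invRotate.vanish₂ ((HomVanish.shift_left (by omega)).2 hC) hB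

lemma coyoneda_vanish₂ (h : IsExt A B C) (hA : HomVanish X A m) (hC : HomVanish X C m) :
    HomVanish X B m := by
  obtain ⟨f, g, k, hT⟩ := h.shift m
  intro x
  obtain ⟨y, rfl⟩ := dist_lift₂ hT x (hC _)
  rw [hA y, zero_comp]

lemma coyoneda_vanish₃ (h : IsExt A B C) (hA : HomVanish X A n) (hB : HomVanish X B m)
    (hn : n = m + 1 := by omega) : HomVanish X C m :=
  h.rotate.coyoneda_vanish₂ hB ((HomVanish.shift_right (by omega)).2 hA)

lemma coyoneda_vanish₁ (h : IsExt A B C) (hC : HomVanish X C n) (hB : HomVanish X B m)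
    (hn : m = n + 1 := by omega) : HomVanish X A m :=
  h.invRotate.coyoneda_vanish₂ ((HomVanish.shift_right (by omega)).2 hC) hB

/-- The triangle splits, and a direct sum is an extension in either order. -/
lemma swap_of_eq_zero {f : A ⟶ B} {g : B ⟶ C} (hT : Triangle.mk f g 0 ∈ distTriang D) :
    IsExt C B A := by
  obtain ⟨e, -⟩ := exists_iso_binaryBiproduct_of_distTriang _ hT rfl
  exact IsExt.of_iso ⟨_, _, _, binaryBiproductTriangle_distinguished C A⟩ (Iso.refl _)
    (biprod.braiding C A ≪≫ e.symm) (Iso.refl _)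

section

variable [IsTriangulated D]

/-- Pull back an extension of `Y` along `Y' → Y`. -/
lemma pullback {A E Y Y' Y'' : D} {f : A ⟶ E} {g : E ⟶ Y} {h : Y ⟶ A⟦(1 : ℤ)⟧}
    (hT : Triangle.mk f g h ∈ distTriang D) {i : Y' ⟶ Y} {p : Y ⟶ Y''} {q : Y'' ⟶ Y'⟦(1 : ℤ)⟧}
    (hT' : Triangle.mk i p q ∈ distTriang D) :
    ∃ (E' : D) (a : A ⟶ E') (b : E' ⟶ Y') (b' : Y' ⟶ A⟦(1 : ℤ)⟧) (c : E' ⟶ E)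
      (c' : Y'' ⟶ E'⟦(1 : ℤ)⟧), Triangle.mk a b b' ∈ distTriang D ∧
      Triangle.mk c (g ≫ p) c' ∈ distTriang D ∧ a ≫ c = f ∧ b ≫ i = c ≫ g := by
  obtain ⟨E', c, c', hc⟩ := distinguished_cocone_triangle₁ (g ≫ p)
  let o := Triangulated.someOctahedron' (h₁₂ := hT) (h₂₃ := hT') (h₁₃ := hc) rfl
  exact ⟨E', o.m₁, o.m₃, _, c, c', o.mem, hc, o.comm₁, o.comm₄⟩

/-- Push out an extension by `X` along `X → X''`. -/
lemma pushout {X' X X'' E Y : D} {f : X ⟶ E} {g : E ⟶ Y} {h : Y ⟶ X⟦(1 : ℤ)⟧}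
    (hT : Triangle.mk f g h ∈ distTriang D) {i : X' ⟶ X} {p : X ⟶ X''} {q : X'' ⟶ X'⟦(1 : ℤ)⟧}
    (hT' : Triangle.mk i p q ∈ distTriang D) :
    ∃ (E' : D) (a : X'' ⟶ E') (b : E' ⟶ Y) (b' : Y ⟶ X''⟦(1 : ℤ)⟧) (c : E ⟶ E')
      (c' : E' ⟶ X'⟦(1 : ℤ)⟧), Triangle.mk a b b' ∈ distTriang D ∧
      Triangle.mk (i ≫ f) c c' ∈ distTriang D ∧ p ≫ a = f ≫ c ∧ c ≫ b = g := by
  obtain ⟨E', c, c', hc⟩ := distinguished_cocone_triangle (i ≫ f)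
  let o := Triangulated.someOctahedron (h₁₂ := hT') (h₂₃ := hT) (h₁₃ := hc) rfl
  exact ⟨E', o.m₁, o.m₃, _, c, c', o.mem, hc, o.comm₁, o.comm₃⟩

lemma exists_pullback {A E Y Y' Y'' : D} (h : IsExt A E Y) (h' : IsExt Y' Y Y'') :
    ∃ E', IsExt A E' Y' ∧ IsExt E' E Y'' := by
  obtain ⟨f, g, k, hT⟩ := h
  obtain ⟨f', g', k', hT'⟩ := h'
  obtain ⟨E', a, b, b', c, c', h1, h2, -, -⟩ := pullback hT hT'
  exact ⟨E', .of_dist h1, .of_dist h2⟩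

lemma exists_pushout {X' X X'' E Y : D} (h : IsExt X E Y) (h' : IsExt X' X X'') :
    ∃ E', IsExt X'' E' Y ∧ IsExt X' E E' := by
  obtain ⟨f, g, k, hT⟩ := h
  obtain ⟨f', g', k', hT'⟩ := h'
  obtain ⟨E', a, b, b', c, c', h1, h2, -, -⟩ := pushout hT hT'
  exact ⟨E', .of_dist h1, .of_dist h2⟩

end

end IsExt

section

variable [IsTriangulated D]

/-- In the octahedron on `a ≫ f` the cone of the composite is zero, which identifies the cone of `a`
with the fiber of `f`. It serves to cancel a piece of a filtration. -/
lemma nonempty_iso_of_isIso_comp {X E Y S K : D} {a : X ⟶ E} {b : E ⟶ Y} {c : Y ⟶ X⟦(1 : ℤ)⟧}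
    (hT : Triangle.mk a b c ∈ distTriang D) {i : K ⟶ E} {f : E ⟶ S} {q : S ⟶ K⟦(1 : ℤ)⟧}
    (hT' : Triangle.mk i f q ∈ distTriang D) (h : IsIso (a ≫ f)) : Nonempty (K ≅ Y) := by
  obtain ⟨Z, r, s, hZ⟩ := distinguished_cocone_triangle (a ≫ f)
  have hZ0 : IsZero Z := (Triangle.isZero₃_iff_isIso₁ _ hZ).2 h
  let o := Triangulated.someOctahedron (h₁₂ := hT) (h₂₃ := rot_of_distTriang _ hT')
    (h₁₃ := hZ) rfl
  obtain ⟨e⟩ := (IsExt.of_dist o.mem).isoOfIsZeroMiddle hZ0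
  exact ⟨(shiftFunctor D (1 : ℤ)).preimageIso e⟩

end

/-! ### Filtered objects -/

/-- The objects with a finite filtration whose subquotients satisfy `P`. -/
inductive Filt (P : ObjectProperty D) : D → Prop
  | zero {X : D} (hX : IsZero X) : Filt P X
  | cons {X E Y : D} (h : IsExt X E Y) (hX : P X) (hY : Filt P Y) : Filt P E

namespace Filt

variable {P P' : ObjectProperty D} {X Y E : D}

lemma of_iso (h : Filt P X) (e : X ≅ Y) : Filt P Y := by
  cases h with
  | zero hX => exact .zero (hX.of_iso e.symm)
  | cons h hX hY => exact .cons (h.of_iso (Iso.refl _) e (Iso.refl _)) hX hY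

lemma base (h : P X) : Filt P X := .cons (IsExt.id_zero X (isZero_zero D)) h (.zero (isZero_zero D))

lemma mono (hP : ∀ X, P X → P' X) (h : Filt P X) : Filt P' X := by
  induction h with
  | zero hX => exact .zero hX
  | cons h hX _ ih => exact .cons h (hP _ hX) ih

lemma ext [IsTriangulated D] (h : IsExt X E Y) (hX : Filt P X) (hY : Filt P Y) : Filt P E := by
  induction hX generalizing E with
  | zero hX =>
    obtain ⟨e⟩ := h.isoOfIsZeroLeft hX
    exact hY.of_iso e.symm
  | cons h' hX' _ ih =>
    obtain ⟨E', h1, h2⟩ := h.exists_pushout h'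
    exact .cons h2 hX' (ih h1)

lemma bind [IsTriangulated D] (hP : ∀ X, P X → Filt P' X) (h : Filt P X) : Filt P' X := by
  induction h with
  | zero hX => exact .zero hX
  | cons h hX _ ih => exact .ext h (hP _ hX) ih

lemma shift {a : ℤ} (hP : ∀ X, P X → P' (X⟦a⟧)) (h : Filt P X) : Filt P' (X⟦a⟧) := by
  induction h with
  | zero hX => exact .zero (Functor.map_isZero _ hX)
  | cons h hX _ ih => exact .cons (h.shift a) (hP _ hX) ih

lemma vanish_left {m : ℤ} (hP : ∀ X, P X → HomVanish X Y m) (h : Filt P X) : HomVanish X Y m := by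
  induction h with
  | zero hX => exact .of_isZero_left hX
  | cons h hX _ ih => exact h.vanish₂ (hP _ hX) ih

lemma vanish_right {m : ℤ} (hP : ∀ X, P X → HomVanish Y X m) (h : Filt P X) : HomVanish Y X m := by
  induction h with
  | zero hX => exact .of_isZero_right hX
  | cons h hX _ ih => exact h.coyoneda_vanish₂ (hP _ hX) ih

/-- Induction on a filtration, starting from the sub. -/
lemma snoc_induction [IsTriangulated D] {motive : D → Prop} (h : Filt P E)
    (iso : ∀ X Y, (X ≅ Y) → motive X → motive Y) (zero : ∀ X, IsZero X → motive X)
    (snoc : ∀ X E Y, IsExt X E Y → Filt P X → motive X → P Y → motive E) : motive E := by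
  -- `X` is the part already treated; the pieces of `Y` are moved into it one at a time.
  suffices ∀ Y, Filt P Y → ∀ X E, Filt P X → motive X → IsExt X E Y → motive E from
    this E h 0 E (.zero (isZero_zero D)) (zero _ (isZero_zero D)) (IsExt.zero_id E (isZero_zero D))
  intro Y hY
  induction hY with
  | zero hY =>
    intro X E hX hm h
    obtain ⟨e⟩ := h.isoOfIsZeroRight hY
    exact iso _ _ e hm
  | cons h' hX' _ ih =>
    intro X E hX hm h
    obtain ⟨E', h1, h2⟩ := h.exists_pullback h'
    exact ih E' E (.ext h1 hX (.base hX')) (snoc _ _ _ h1 hX hm hX') h2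

/-- If the morphisms from the pieces to `S` are zero or isomorphisms, then the fiber of a nonzero
morphism to `S` is filtered by the pieces. -/
lemma exists_fiber [IsTriangulated D] {S : D} (hS : ∀ X, P X → ∀ f : X ⟶ S, f = 0 ∨ IsIso f)
    (h : Filt P E) {f : E ⟶ S} (hf : f ≠ 0) :
    ∃ (K : D) (i : K ⟶ E) (q : S ⟶ K⟦(1 : ℤ)⟧), Filt P K ∧ Triangle.mk i f q ∈ distTriang D := by
  induction h with
  | zero hX => exact (hf (hX.eq_of_src _ _)).elim
  | @cons X E Y h hX hY ih =>
    obtain ⟨a, b, c, hT⟩ := h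
    -- If `f` kills the first piece `X`, it descends to `Y`, and the fiber found there is pulled
    -- back. If it is invertible on `X`, the fiber is `Y`.
    obtain h0 | h0 := hS _ hX (a ≫ f)
    · obtain ⟨g, rfl⟩ := dist_desc₂ hT f h0
      obtain ⟨K, i, q, hK, hT'⟩ := ih (f := g) (by rintro rfl; simp at hf)
      obtain ⟨E', a', b', _, c', c'', h1, h2, -, -⟩ := IsExt.pullback hT hT'
      exact ⟨E', c', c'', .cons (.of_dist h1) hX hK, h2⟩
    · obtain ⟨K, i, q, hT'⟩ := distinguished_cocone_triangle₁ f
      obtain ⟨e⟩ := nonempty_iso_of_isIso_comp hT hT' h0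
      exact ⟨K, i, q, hY.of_iso e.symm, hT'⟩

lemma fiber [IsTriangulated D] {S K : D} (hS : ∀ X, P X → ∀ f : X ⟶ S, f = 0 ∨ IsIso f)
    (h : Filt P E) {f : E ⟶ S} (hf : f ≠ 0) {i : K ⟶ E} {q : S ⟶ K⟦(1 : ℤ)⟧}
    (hT : Triangle.mk i f q ∈ distTriang D) : Filt P K := by
  obtain ⟨K', i', q', hK, hT'⟩ := h.exists_fiber hS hf
  obtain ⟨e⟩ := nonempty_iso_of_fibers hT' hT
  exact hK.of_iso e

end Filt

end TriangulatedGeneralities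

/-! ### The bounded t-structure generated by a simple-minded family. -/

section SimpleMindedFamilies

open ZeroObject

variable {D : Type u} [Category.{v} D] [Preadditive D] [HasZeroObject D] [HasShift D ℤ]
  [∀ n : ℤ, (shiftFunctor D n).Additive] [Pretriangulated D] {ι : Type v'}

/-- The objects `S i[m]` with `m ∈ I`. -/
def shiftsOf (S : ι → D) (I : Set ℤ) : ObjectProperty D :=
  fun Z => ∃ (i : ι) (m : ℤ), m ∈ I ∧ Nonempty (Z ≅ (S i)⟦m⟧)

/-- A family of objects that is the family of simple objects of the heart of a bounded
t-structure. -/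
structure SimpleMinded (S : ι → D) : Prop where
  not_isZero : ∀ i, ¬ IsZero (S i)
  hom_neg : ∀ i j m, m < 0 → HomVanish (S i) (S j) m
  hom_ne : ∀ i j, i ≠ j → HomVanish (S i) (S j) 0
  brick : ∀ i (f : S i ⟶ S i), f = 0 ∨ IsIso f
  gen : ∀ A, Filt (shiftsOf S Set.univ) A

variable {S : ι → D}

lemma Filt.shiftsOf_mono {I J : Set ℤ} (h : I ⊆ J) {X : D} (hX : Filt (shiftsOf S I) X) :
    Filt (shiftsOf S J) X :=
  hX.mono fun _ ⟨i, m, hm, e⟩ => ⟨i, m, h hm, e⟩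

lemma Filt.shiftsOf_shift {I J : Set ℤ} {a : ℤ} (h : ∀ m ∈ I, m + a ∈ J) {X : D}
    (hX : Filt (shiftsOf S I) X) : Filt (shiftsOf S J) (X⟦a⟧) :=
  hX.shift fun _ ⟨i, m, hm, ⟨e⟩⟩ => ⟨i, m + a, h m hm,
    ⟨(shiftFunctor D a).mapIso e ≪≫ ((shiftFunctorAdd D m a).app (S i)).symm⟩⟩

lemma Filt.shiftsOf_vanish_left {I : Set ℤ} {X Y : D} {n : ℤ} (hX : Filt (shiftsOf S I) X)
    (h : ∀ i, ∀ m ∈ I, HomVanish (S i) Y (n - m)) : HomVanish X Y n :=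
  hX.vanish_left fun _ ⟨i, m, hm, ⟨e⟩⟩ => .of_iso_left e.symm
    ((HomVanish.shift_left (by omega)).2 (h i m hm))

lemma Filt.shiftsOf_vanish_right {I : Set ℤ} {X Y : D} {n : ℤ} (hX : Filt (shiftsOf S I) X)
    (h : ∀ i, ∀ m ∈ I, HomVanish Y (S i) (n + m)) : HomVanish Y X n :=
  hX.vanish_right fun _ ⟨i, m, hm, ⟨e⟩⟩ => .of_iso_right e.symm
    ((HomVanish.shift_right (by omega)).2 (h i m hm))

namespace SimpleMinded

variable (hS : SimpleMinded S)
include hS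

/-- For `b < m` negative Homs vanish; for `b = m` this is the Schur property of the family. It is
the hypothesis that `Filt.fiber` needs. -/
lemma eq_zero_or_isIso {i j : ι} {m b : ℤ} (hm : b ≤ m) (f : (S j)⟦m⟧ ⟶ (S i)⟦b⟧) :
    f = 0 ∨ IsIso f := by
  obtain rfl | hm := hm.eq_or_lt
  · obtain ⟨g, rfl⟩ := (shiftFunctor D b).map_surjective f
    by_cases hij : j = i
    · subst hij
      obtain rfl | h := hS.brick _ g
      · left; simp
      · right; infer_instance
    · left
      rw [HomVanish.zero_iff.1 (hS.hom_ne _ _ hij) g, Functor.map_zero]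
  · left
    refine HomVanish.zero_iff.1 ?_ f
    rw [HomVanish.shift_left (n := -m) (by omega), HomVanish.shift_right rfl]
    exact hS.hom_neg _ _ _ (by omega)

lemma vanish_of_filt {I J : Set ℤ} {X Y : D} {n : ℤ} (hX : Filt (shiftsOf S I) X)
    (hY : Filt (shiftsOf S J) Y) (h : ∀ m ∈ I, ∀ m' ∈ J, n + m' < m) : HomVanish X Y n :=
  hX.shiftsOf_vanish_left fun _ m hm => hY.shiftsOf_vanish_right fun _ m' hm' =>
    hS.hom_neg _ _ _ (by linarith [h m hm m' hm'])

variable [IsTriangulated D]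

/-- Truncation. -/
lemma exists_cut {I : Set ℤ} {A : D} (hA : Filt (shiftsOf S I) A) (b : ℤ) :
    ∃ L G, IsExt L A G ∧ Filt (shiftsOf S (I ∩ Set.Ici b)) L ∧
      Filt (shiftsOf S (I ∩ Set.Iio b)) G := by
  induction hA with
  | @zero A hA => exact ⟨A, 0, IsExt.id_zero A (isZero_zero D), .zero hA, .zero (isZero_zero D)⟩
  | @cons X A A' h hX _ ih =>
    obtain ⟨L', G', h', hL', hG'⟩ := ih
    obtain ⟨E, h1, h2⟩ := h.exists_pullback h'
    suffices ∃ L G, IsExt L E G ∧ Filt (shiftsOf S (I ∩ Set.Ici b)) L ∧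
        Filt (shiftsOf S (I ∩ Set.Iio b)) G by
      obtain ⟨L, G, h3, hL, hG⟩ := this
      obtain ⟨E', h4, h5⟩ := h2.exists_pushout h3
      exact ⟨L, E', h5, hL, .ext h4 hG hG'⟩
    obtain ⟨i, m, hm, ⟨e⟩⟩ := hX
    obtain hmb | hmb := le_or_gt b m
    · exact ⟨E, 0, IsExt.id_zero E (isZero_zero D), .cons h1 ⟨i, m, ⟨hm, hmb⟩, ⟨e⟩⟩ hL',
        .zero (isZero_zero D)⟩
    · obtain ⟨x, y, z, hT⟩ := h1
      -- The low piece `X` sits below the high part `L'`, the wrong order. If `z : L' ⟶ X[1]` is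
      -- zero, the two are exchanged. Otherwise `z` cancels `X` against a piece of `L'`, and the
      -- fiber `E` of `z` is filtered by what remains.
      by_cases hz : z = 0
      · subst hz
        exact ⟨L', X, IsExt.swap_of_eq_zero hT, hL', .base ⟨i, m, ⟨hm, hmb⟩, ⟨e⟩⟩⟩
      · refine ⟨E, 0, IsExt.id_zero E (isZero_zero D), ?_, .zero (isZero_zero D)⟩
        refine hL'.fiber ?_ hz (rot_of_distTriang _ hT)
        rintro W ⟨j, m', ⟨-, hm'⟩, ⟨e'⟩⟩ f
        let e2 := (shiftFunctor D (1 : ℤ)).mapIso e ≪≫ ((shiftFunctorAdd D m 1).app (S i)).symm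
        obtain h0 | h0 := hS.eq_zero_or_isIso (show m + 1 ≤ m' from hmb.trans_le hm')
          (e'.inv ≫ f ≫ e2.hom)
        · left
          rwa [Preadditive.IsIso.comp_left_eq_zero, Preadditive.IsIso.comp_right_eq_zero] at h0
        · right
          have : f = e'.hom ≫ (e'.inv ≫ f ≫ e2.hom) ≫ e2.inv := by simp
          rw [this]
          infer_instance

/-- The low truncation `G` of `A` receives no nonzero map from `A` or from `L[1]`, so its identity
is zero. -/
lemma filt_of_vanish_right {A : D} {n : ℤ} (h : ∀ i m, m < n → HomVanish A (S i) m) :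
    Filt (shiftsOf S (Set.Ici n)) A := by
  obtain ⟨L, G, hE, hL, hG⟩ := hS.exists_cut (hS.gen A) n
  have hG0 : IsZero G := HomVanish.isZero_of_self <|
    hE.vanish₃ (n := -1) (hS.vanish_of_filt hL hG fun m hm m' hm' => by
      have := hm.2; have := hm'.2; simp only [Set.mem_Ici, Set.mem_Iio] at *; omega)
      (hG.shiftsOf_vanish_right fun i m hm => h i _ (by
        have := hm.2; simp only [Set.mem_Iio] at *; omega))
  obtain ⟨e⟩ := hE.isoOfIsZeroRight hG0
  exact (hL.shiftsOf_mono Set.inter_subset_right).of_iso e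

lemma filt_of_vanish_left {A : D} {n : ℤ} (h : ∀ i m, m < -n → HomVanish (S i) A m) :
    Filt (shiftsOf S (Set.Iic n)) A := by
  obtain ⟨L, G, hE, hL, hG⟩ := hS.exists_cut (hS.gen A) (n + 1)
  have hL0 : IsZero L := HomVanish.isZero_of_self <|
    hE.coyoneda_vanish₁ (n := -1) (hS.vanish_of_filt hL hG fun m hm m' hm' => by
      have := hm.2; have := hm'.2; simp only [Set.mem_Ici, Set.mem_Iio] at *; omega)
      (hL.shiftsOf_vanish_left fun i m hm => h i _ (by
        have := hm.2; simp only [Set.mem_Ici] at *; omega))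
  obtain ⟨e⟩ := hE.isoOfIsZeroLeft hL0
  exact (hG.shiftsOf_mono (by rintro m ⟨-, hm⟩; simp only [Set.mem_Iio, Set.mem_Iic] at *; omega)
    ).of_iso e.symm

omit hS in
lemma filt_isClosed (I : Set ℤ) :
    ObjectProperty.IsClosedUnderIsomorphisms (Filt (shiftsOf S I)) :=
  ⟨fun e h => h.of_iso e⟩

/-- The heart whose simple objects are the `S i`. -/
def heart : BddHeart D where
  t :=
    { le := fun n => Filt (shiftsOf S (Set.Ici (-n)))
      ge := fun n => Filt (shiftsOf S (Set.Iic (-n)))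
      le_isClosedUnderIsomorphisms := fun _ => filt_isClosed _
      ge_isClosedUnderIsomorphisms := fun _ => filt_isClosed _
      le_shift := fun n a n' h X hX => hX.shiftsOf_shift (by intro m; simp; omega)
      ge_shift := fun n a n' h X hX => hX.shiftsOf_shift (by intro m; simp; omega)
      zero' := fun X Y f hX hY => HomVanish.zero_iff.1 (hS.vanish_of_filt hX hY
        (by intro m hm m' hm'; simp at *; omega)) f
      le_zero_le := fun X hX => hX.shiftsOf_mono (by intro m; simp; omega)
      ge_one_le := fun X hX => hX.shiftsOf_mono (by intro m; simp; omega)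
      exists_triangle_zero_one := fun A => by
        obtain ⟨L, G, ⟨f, g, h, hT⟩, hL, hG⟩ := hS.exists_cut (hS.gen A) 0
        exact ⟨L, G, hL.shiftsOf_mono (by intro m; simp),
          hG.shiftsOf_mono (by intro m; simp; omega), f, g, h, hT⟩ }
  bounded A := by
    suffices ∃ a b : ℤ, Filt (shiftsOf S (Set.Icc a b)) A by
      obtain ⟨a, b, h⟩ := this
      exact ⟨⟨-b, ⟨h.shiftsOf_mono (by intro m; simp)⟩⟩, ⟨-a, ⟨h.shiftsOf_mono
        (by intro m; simp; omega)⟩⟩⟩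
    induction hS.gen A with
    | zero hX => exact ⟨0, 0, .zero hX⟩
    | cons h hX _ ih =>
      obtain ⟨i, m, -, e⟩ := hX
      obtain ⟨a, b, hab⟩ := ih
      exact ⟨min a m, max b m, .cons h ⟨i, m, by simp, e⟩
        (hab.shiftsOf_mono (Set.Icc_subset_Icc (by simp) (by simp)))⟩

/-- Membership becomes a condition on graded Homs with the simples, which can be tested when the
simples are changed. -/
lemma heart_mem_iff_vanish {A : D} : hS.heart.mem A ↔
    (∀ i m, m < 0 → HomVanish A (S i) m) ∧ (∀ i m, m < 0 → HomVanish (S i) A m) := by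
  constructor
  · rintro ⟨h1, h2⟩
    refine ⟨fun i m hm => ?_, fun i m hm => ?_⟩
    · refine Filt.shiftsOf_vanish_left h1 fun j m' hm' => hS.hom_neg _ _ _ ?_
      simp at hm'; omega
    · refine Filt.shiftsOf_vanish_right h2 fun j m' hm' => hS.hom_neg _ _ _ ?_
      simp at hm'; omega
  · rintro ⟨h1, h2⟩
    exact ⟨hS.filt_of_vanish_right (by simpa using h1), hS.filt_of_vanish_left (by simpa using h2)⟩

lemma heart_mem_iff {A : D} : hS.heart.mem A ↔ Filt (fun X => ∃ i, Nonempty (X ≅ S i)) A := by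
  have key : ∀ A, Filt (shiftsOf S {0}) A ↔ Filt (fun X => ∃ i, Nonempty (X ≅ S i)) A := by
    intro A
    constructor
    · refine Filt.mono ?_
      rintro X ⟨i, m, rfl, ⟨e⟩⟩
      exact ⟨i, ⟨e ≪≫ (shiftFunctorZero D ℤ).app _⟩⟩
    · refine Filt.mono ?_
      rintro X ⟨i, ⟨e⟩⟩
      exact ⟨i, 0, rfl, ⟨e ≪≫ ((shiftFunctorZero D ℤ).app _).symm⟩⟩
  rw [← key]
  constructor
  · rintro ⟨h1, h2⟩
    obtain ⟨L, G, hE, hL, hG⟩ := hS.exists_cut h1 1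
    have hL0 : IsZero L := HomVanish.isZero_of_self <|
      hE.coyoneda_vanish₁ (n := -1) (hS.vanish_of_filt hL hG fun m hm m' hm' => by
        simp at *; omega) (hS.vanish_of_filt hL h2 fun m hm m' hm' => by simp at *; omega)
    obtain ⟨e⟩ := hE.isoOfIsZeroLeft hL0
    exact (hG.shiftsOf_mono (by intro m hm; simp at *; omega)).of_iso e.symm
  · intro h
    exact ⟨h.shiftsOf_mono (by simp), h.shiftsOf_mono (by simp)⟩

end SimpleMinded

end SimpleMindedFamilies

/-! ### Aisles, the order on hearts, and simple objects. -/

section HeartGeneralities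

open ZeroObject

variable {D : Type u} [Category.{v} D] [Preadditive D] [HasZeroObject D] [HasShift D ℤ]
  [∀ n : ℤ, (shiftFunctor D n).Additive] [Pretriangulated D]

namespace BddHeart

variable {H H' : BddHeart D} {X Y A B C S : D}

lemma vanish_of_le_of_ge {a b m : ℤ} (hX : H.t.le a X) (hY : H.t.ge b Y) (h : a + m < b) :
    HomVanish X Y m := fun f =>
  H.t.zero_of_isLE_of_isGE f a (b - m) (by omega) ⟨hX⟩ ⟨H.t.ge_shift b m (b - m) (by omega) _ hY⟩

lemma le_iso {n : ℤ} (h : H.t.le n X) (e : X ≅ Y) : H.t.le n Y := (H.t.le n).prop_of_iso e h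

lemma ge_iso {n : ℤ} (h : H.t.ge n X) (e : X ≅ Y) : H.t.ge n Y := (H.t.ge n).prop_of_iso e h

lemma le_mono {a b : ℤ} (h : H.t.le a X) (hab : a ≤ b) : H.t.le b X := H.t.le_monotone hab _ h

lemma ge_anti {a b : ℤ} (h : H.t.ge b X) (hab : a ≤ b) : H.t.ge a X := H.t.ge_antitone hab _ h

lemma le_shift_iff {n a n' : ℤ} (h : n = n' + a) : H.t.le n' (X⟦a⟧) ↔ H.t.le n X := by
  rw [TStructure.le_iff_isLE, TStructure.le_iff_isLE, H.t.isLE_shift_iff X n a n' (by omega)]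

lemma ge_shift_iff {n a n' : ℤ} (h : n = n' + a) : H.t.ge n' (X⟦a⟧) ↔ H.t.ge n X := by
  rw [TStructure.ge_iff_isGE, TStructure.ge_iff_isGE, H.t.isGE_shift_iff X n a n' (by omega)]

lemma exists_trunc (H : BddHeart D) (n : ℤ) (X : D) :
    ∃ L G, IsExt L X G ∧ H.t.le n L ∧ H.t.ge (n + 1) G := by
  obtain ⟨L, G, hL, hG, f, g, h, hT⟩ := H.t.exists_triangle X n (n + 1) rfl
  exact ⟨L, G, ⟨f, g, h, hT⟩, hL, hG⟩

/-- The truncation `G` of `X` has zero identity. Closure under extensions and the determination of a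
t-structure by its aisle follow from this orthogonality. -/
lemma le_of_vanish {n : ℤ} (h : ∀ Y, H.t.ge (n + 1) Y → HomVanish X Y 0) : H.t.le n X := by
  obtain ⟨L, G, hE, hL, hG⟩ := H.exists_trunc n X
  have : IsZero G := HomVanish.isZero_of_self <|
    hE.vanish₃ (n := -1) (vanish_of_le_of_ge hL hG (by omega)) (h _ hG)
  obtain ⟨e⟩ := hE.isoOfIsZeroRight this
  exact le_iso hL e

lemma ge_of_vanish {n : ℤ} (h : ∀ Y, H.t.le (n - 1) Y → HomVanish Y X 0) : H.t.ge n X := by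
  obtain ⟨L, G, hE, hL, hG⟩ := H.exists_trunc (n - 1) X
  have : IsZero L := HomVanish.isZero_of_self <|
    hE.coyoneda_vanish₁ (n := -1) (vanish_of_le_of_ge hL hG (by omega)) (h _ hL)
  obtain ⟨e⟩ := hE.isoOfIsZeroLeft this
  exact ge_iso (ge_anti hG (by omega)) e.symm

lemma le_ext {n : ℤ} (h : IsExt A B C) (hA : H.t.le n A) (hC : H.t.le n C) : H.t.le n B :=
  le_of_vanish fun _ hY => h.vanish₂ (vanish_of_le_of_ge hA hY (by omega))
    (vanish_of_le_of_ge hC hY (by omega))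

lemma ge_ext {n : ℤ} (h : IsExt A B C) (hA : H.t.ge n A) (hC : H.t.ge n C) : H.t.ge n B :=
  ge_of_vanish fun _ hY => h.coyoneda_vanish₂ (vanish_of_le_of_ge hY hA (by omega))
    (vanish_of_le_of_ge hY hC (by omega))

lemma le_ext₃ {n : ℤ} (h : IsExt A B C) (hA : H.t.le (n + 1) A) (hB : H.t.le n B) : H.t.le n C :=
  le_ext h.rotate hB ((le_shift_iff (by omega)).2 hA)

lemma le_ext₁ {n : ℤ} (h : IsExt A B C) (hC : H.t.le (n - 1) C) (hB : H.t.le n B) : H.t.le n A :=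
  le_ext h.invRotate ((le_shift_iff (by omega)).2 hC) hB

lemma ge_ext₃ {n : ℤ} (h : IsExt A B C) (hA : H.t.ge (n + 1) A) (hB : H.t.ge n B) : H.t.ge n C :=
  ge_ext h.rotate hB ((ge_shift_iff (by omega)).2 hA)

lemma ge_ext₁ {n : ℤ} (h : IsExt A B C) (hC : H.t.ge (n - 1) C) (hB : H.t.ge n B) : H.t.ge n A :=
  ge_ext h.invRotate ((ge_shift_iff (by omega)).2 hC) hB

lemma le_of_isZero {n : ℤ} (h : IsZero X) : H.t.le n X :=
  le_of_vanish fun _ _ => .of_isZero_left h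

lemma ge_of_isZero {n : ℤ} (h : IsZero X) : H.t.ge n X :=
  ge_of_vanish fun _ _ => .of_isZero_right h

lemma mem_of_isZero (h : IsZero X) : H.mem X := ⟨le_of_isZero h, ge_of_isZero h⟩

lemma mem_iso (h : H.mem X) (e : X ≅ Y) : H.mem Y := ⟨le_iso h.1 e, ge_iso h.2 e⟩

lemma mem_ext (h : IsExt A B C) (hA : H.mem A) (hC : H.mem C) : H.mem B :=
  ⟨le_ext h hA.1 hC.1, ge_ext h hA.2 hC.2⟩

lemma mem_vanish {m : ℤ} (hX : H.mem X) (hY : H.mem Y) (hm : m < 0) : HomVanish X Y m :=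
  vanish_of_le_of_ge hX.1 hY.2 (by omega)

/-- The objects `E[m]` with `E ∈ H` and `m ∈ I`. -/
def shifts (H : BddHeart D) (I : Set ℤ) : ObjectProperty D :=
  fun Z => ∃ (E : D) (m : ℤ), H.mem E ∧ m ∈ I ∧ Nonempty (Z ≅ E⟦m⟧)

/-- Induction on the width of the interval `[a, b]`; the top cohomology object is split off as a
quotient. -/
lemma filt_of_le_of_ge [IsTriangulated D] {a b : ℤ} (hle : H.t.le b X) (hge : H.t.ge a X) :
    Filt (H.shifts (Set.Icc (-b) (-a))) X := by
  obtain ⟨k, hk⟩ : ∃ k : ℕ, b + 1 ≤ a + k := ⟨(b + 1 - a).toNat, by omega⟩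
  induction k generalizing X b with
  | zero =>
    exact .zero (HomVanish.isZero_of_self (vanish_of_le_of_ge hle hge (by omega)))
  | succ k ih =>
    obtain hab | hab := lt_or_ge b a
    · exact .zero (HomVanish.isZero_of_self (vanish_of_le_of_ge hle hge (by omega)))
    obtain ⟨L, G, hE, hL, hG⟩ := H.exists_trunc (b - 1) X
    have hG' : H.t.le b G := le_ext₃ hE (le_mono hL (by omega)) hle
    have hL' : H.t.ge a L := ge_ext₁ hE (ge_anti hG (by omega)) hge
    refine .ext hE ((ih (b := b - 1) hL hL' (by omega)).mono ?_) (.base ?_)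
    · rintro Z ⟨E, m, hE, hm, e⟩
      exact ⟨E, m, hE, ⟨by have := hm.1; omega, hm.2⟩, e⟩
    · exact ⟨G⟦b⟧, -b, ⟨(le_shift_iff (n := b) (by omega)).2 hG',
        (ge_shift_iff (n := b) (by omega)).2 (ge_anti hG (by omega))⟩, ⟨le_rfl, by omega⟩,
        ⟨((shiftEquiv D b).unitIso.app G)⟩⟩

lemma filt_of_le [IsTriangulated D] {n : ℤ} (hle : H.t.le n X) :
    Filt (H.shifts (Set.Ici (-n))) X := by
  obtain ⟨a, ha⟩ := (H.bounded X).1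
  refine (filt_of_le_of_ge hle ha.ge).mono ?_
  rintro Z ⟨E, m, hE, hm, e⟩
  exact ⟨E, m, hE, hm.1, e⟩

lemma filt_of_ge [IsTriangulated D] {n : ℤ} (hge : H.t.ge n X) :
    Filt (H.shifts (Set.Iic (-n))) X := by
  obtain ⟨a, ha⟩ := (H.bounded X).2
  refine (filt_of_le_of_ge ha.le hge).mono ?_
  rintro Z ⟨E, m, hE, hm, e⟩
  exact ⟨E, m, hE, hm.2, e⟩

lemma le_of_filt {n : ℤ} {P : ObjectProperty D} (hP : ∀ Z, P Z → H.t.le n Z) (h : Filt P X) :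
    H.t.le n X := by
  induction h with
  | zero hX => exact le_of_isZero hX
  | cons h hX _ ih => exact le_ext h (hP _ hX) ih

lemma ge_of_filt {n : ℤ} {P : ObjectProperty D} (hP : ∀ Z, P Z → H.t.ge n Z) (h : Filt P X) :
    H.t.ge n X := by
  induction h with
  | zero hX => exact ge_of_isZero hX
  | cons h hX _ ih => exact ge_ext h (hP _ hX) ih

lemma mem_of_filt {P : ObjectProperty D} (hP : ∀ Z, P Z → H.mem Z) (h : Filt P X) : H.mem X :=
  ⟨le_of_filt (fun _ hZ => (hP _ hZ).1) h, ge_of_filt (fun _ hZ => (hP _ hZ).2) h⟩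

lemma le_of_mem_le [IsTriangulated D] {n k : ℤ} (h : ∀ E, H.mem E → H'.t.le k E)
    (hX : H.t.le n X) : H'.t.le (n + k) X := by
  refine le_of_filt ?_ (filt_of_le hX)
  rintro Z ⟨E, m, hE, hm, ⟨e⟩⟩
  exact le_iso (le_mono ((le_shift_iff (n := k) (n' := k - m) (by omega)).2 (h E hE))
    (by simp at hm; omega)) e.symm

lemma ge_of_mem_ge [IsTriangulated D] {n k : ℤ} (h : ∀ E, H.mem E → H'.t.ge k E)
    (hX : H.t.ge n X) : H'.t.ge (n + k) X := by
  refine ge_of_filt ?_ (filt_of_ge hX)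
  rintro Z ⟨E, m, hE, hm, ⟨e⟩⟩
  exact ge_iso (ge_anti ((ge_shift_iff (n := k) (n' := k - m) (by omega)).2 (h E hE))
    (by simp at hm; omega)) e.symm

lemma ext_of_le (h : ∀ X, H.t.le 0 X ↔ H'.t.le 0 X) : H = H' := by
  have hle : ∀ n X, H.t.le n X ↔ H'.t.le n X := fun n X => by
    rw [← le_shift_iff (n := n) (a := n) (n' := 0) (by omega), h, le_shift_iff (n := n) (by omega)]
  have hge : ∀ n X, H.t.ge n X ↔ H'.t.ge n X := fun n X =>
    ⟨fun hX => ge_of_vanish fun Y hY => vanish_of_le_of_ge ((hle _ _).2 hY) hX (by omega),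
      fun hX => ge_of_vanish fun Y hY => vanish_of_le_of_ge ((hle _ _).1 hY) hX (by omega)⟩
  obtain ⟨t, _⟩ := H
  obtain ⟨t', _⟩ := H'
  congr
  cases t
  cases t'
  congr
  · funext n; ext X; exact hle n X
  · funext n; ext X; exact hge n X

lemma LE.antisymm (h : H.LE H') (h' : H'.LE H) : H = H' :=
  ext_of_le fun X => ⟨h' X, h X⟩

lemma LE.refl (H : BddHeart D) : H.LE H := fun _ h => h

lemma LE.trans {H'' : BddHeart D} (h : H.LE H') (h' : H'.LE H'') : H.LE H'' :=
  fun X hX => h X (h' X hX)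

lemma LE.le {n : ℤ} (h : H.LE H') (hX : H'.t.le n X) : H.t.le n X := by
  rw [← le_shift_iff (a := n) (n' := 0) (by omega)] at hX ⊢
  exact h _ hX

lemma LE.ge {n : ℤ} (h : H.LE H') (hX : H.t.ge n X) : H'.t.ge n X :=
  ge_of_vanish fun _ hY => vanish_of_le_of_ge (h.le hY) hX (by omega)

lemma LE.of_ge {n : ℤ} (h : ∀ X, H.t.ge n X → H'.t.ge n X) : H.LE H' := by
  have : ∀ X, H.t.ge 1 X → H'.t.ge 1 X := fun X hX => by
    rw [← ge_shift_iff (a := 1 - n) (n' := n) (by omega)] at hX ⊢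
    exact h _ hX
  exact fun X hX => le_of_vanish fun Y hY => vanish_of_le_of_ge hX (this _ hY) (by omega)

lemma LE.of_mem_le [IsTriangulated D] (h : ∀ E, H'.mem E → H.t.le 0 E) : H.LE H' := fun _ hX => by
  simpa using le_of_mem_le h hX

lemma LE.of_mem_ge [IsTriangulated D] (h : ∀ E, H.mem E → H'.t.ge 0 E) : H.LE H' :=
  LE.of_ge (n := 0) fun _ hX => by simpa using ge_of_mem_ge h hX

/-- Two hearts of which one contains the other are equal. -/
lemma eq_of_mem_imp [IsTriangulated D] (h : ∀ E, H.mem E → H'.mem E) : H = H' :=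
  LE.antisymm (LE.of_mem_ge fun _ hE => (h _ hE).2) (LE.of_mem_le fun _ hE => (h _ hE).1)

lemma shift_le_iff {k n : ℤ} : (H.shift k).t.le n X ↔ H.t.le (n - k) X := Iff.rfl

lemma shift_ge_iff {k n : ℤ} : (H.shift k).t.ge n X ↔ H.t.ge (n - k) X := Iff.rfl

lemma shift_mem_iff {k : ℤ} : (H.shift k).mem X ↔ H.t.le (-k) X ∧ H.t.ge (-k) X := by
  rw [show -k = 0 - k by omega]; exact Iff.rfl

lemma shift_mem_shift {k : ℤ} (h : H.mem X) : (H.shift k).mem (X⟦k⟧) :=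
  shift_mem_iff.2 ⟨(le_shift_iff (by omega)).2 h.1, (ge_shift_iff (by omega)).2 h.2⟩

lemma shift_LE_shift {a b : ℤ} (h : a ≤ b) : (H.shift a).LE (H.shift b) :=
  fun _ hX => le_mono (H := H) hX (by omega)

/-! ### Simple objects -/

lemma IsSimple.mem (h : H.IsSimple S) : H.mem S := h.1

lemma IsSimple.not_isZero (h : H.IsSimple S) : ¬ IsZero S := by
  obtain ⟨hS, hs⟩ := h
  intro h0
  have := (Simple.mono_isIso_iff_nonzero (𝟙 (⟨S, hS⟩ : H.t.heart.FullSubcategory))).1 inferInstance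
  apply this
  ext
  exact h0.eq_of_src _ _

/-- Simplicity is rephrased inside `D`: a monomorphism of the heart is a morphism that can be
cancelled against objects of the heart. `IsSimple.of_isIso` is the converse. -/
lemma IsSimple.isIso (h : H.IsSimple S) (hY : H.mem Y) {f : Y ⟶ S} (hf : f ≠ 0)
    (hm : ∀ (Z : D) (g : Z ⟶ Y), H.mem Z → g ≫ f = 0 → g = 0) : IsIso f := by
  obtain ⟨hS, hs⟩ := h
  let f' : (⟨Y, hY⟩ : H.t.heart.FullSubcategory) ⟶ ⟨S, hS⟩ := ObjectProperty.homMk f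
  have : Mono f' := Preadditive.mono_of_cancel_zero _ fun {Z} g hg => by
    ext
    exact hm Z.obj g.hom Z.property (congr_arg InducedCategory.Hom.hom hg)
  have : IsIso f' := isIso_of_mono_of_nonzero fun h0 => hf (congr_arg InducedCategory.Hom.hom h0)
  exact inferInstanceAs (IsIso f'.hom)

lemma IsSimple.of_isIso (hS : H.mem S) (h0 : ¬ IsZero S)
    (h : ∀ (Y : D) (f : Y ⟶ S), H.mem Y → f ≠ 0 →
      (∀ (Z : D) (g : Z ⟶ Y), H.mem Z → g ≫ f = 0 → g = 0) → IsIso f) : H.IsSimple S := by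
  refine ⟨hS, ⟨fun {Y} f hf => ⟨fun hi h00 => ?_, fun hne => ?_⟩⟩⟩
  · have h1 : IsIso f.hom := inferInstance
    rw [h00] at h1
    apply h0
    rw [IsZero.iff_id_eq_zero, ← IsIso.inv_hom_id (f := (0 : Y ⟶ ⟨S, hS⟩).hom)]
    exact comp_zero
  · rw [← ObjectProperty.isIso_hom_iff]
    refine h _ f.hom Y.property (fun h0 => hne (by ext; exact h0)) fun Z g hZ hg => ?_
    have : ObjectProperty.homMk g ≫ f = (0 : (⟨Z, hZ⟩ : H.t.heart.FullSubcategory) ⟶ _) := by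
      ext; exact hg
    exact congr_arg InducedCategory.Hom.hom ((cancel_mono f).1 (this.trans zero_comp.symm))

lemma IsSimple.of_iso (h : H.IsSimple S) {S' : D} (e : S ≅ S') : H.IsSimple S' := by
  refine IsSimple.of_isIso (mem_iso h.mem e) (fun h0 => h.not_isZero (h0.of_iso e)) ?_
  intro Y f hY hf hm
  have : IsIso (f ≫ e.inv) := by
    refine h.isIso hY (by rwa [Ne, Preadditive.IsIso.comp_right_eq_zero]) fun Z g hZ hg => ?_
    refine hm Z g hZ ?_
    rwa [← Category.assoc, Preadditive.IsIso.comp_right_eq_zero] at hg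
  exact IsIso.of_isIso_comp_right f e.inv

/-- The kernel in the heart. -/
lemma exists_kernel (hX : H.mem X) (hY : H.mem Y) (f : X ⟶ Y) :
    ∃ (K : D) (k : K ⟶ X), H.mem K ∧ k ≫ f = 0 ∧
      (∀ (Z : D) (g : Z ⟶ K), H.mem Z → g ≫ k = 0 → g = 0) ∧
      (∀ (Z : D) (g : Z ⟶ X), H.mem Z → g ≫ f = 0 → ∃ g', g = g' ≫ k) := by
  obtain ⟨F, i, q, hT⟩ := distinguished_cocone_triangle₁ f
  have hF1 : H.t.ge 0 F := ge_ext₁ (.of_dist hT) (ge_anti hY.2 (by omega)) hX.2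
  have hF2 : H.t.le 1 F := le_ext₁ (.of_dist hT) hY.1 (le_mono hX.1 (by omega))
  obtain ⟨K, G, hE, hK, hG⟩ := H.exists_trunc 0 F
  obtain ⟨a, b, c, hT'⟩ := hE
  have hE : IsExt K F G := .of_dist hT'
  have hK' : H.t.ge 0 K := ge_ext₁ hE (ge_anti hG (by omega)) hF1
  have key : ∀ (Z : D) (g : Z ⟶ F), H.mem Z → g ≫ i = 0 → g = 0 := by
    intro Z g hZ hg
    exact dist_eq_zero_of_comp₁ hT (mem_vanish hZ hY (by omega)) hg
  refine ⟨K, a ≫ i, ⟨hK, hK'⟩, ?_, ?_, ?_⟩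
  · rw [Category.assoc, dist_comp₁₂ hT, comp_zero]
  · intro Z g hZ hg
    have h1 := key Z (g ≫ a) hZ (by rw [Category.assoc, hg])
    exact dist_eq_zero_of_comp₁ hT' (vanish_of_le_of_ge hZ.1 hG (by omega)) h1
  · intro Z g hZ hg
    obtain ⟨g1, rfl⟩ := dist_lift₂ hT g hg
    have : HomVanish Z G 0 := vanish_of_le_of_ge hZ.1 hG (by omega)
    obtain ⟨g2, rfl⟩ := dist_lift₂ hT' g1 (HomVanish.zero_iff.1 this _)
    exact ⟨g2, by simp⟩

/-- Schur's lemma: a nonzero kernel inclusion into the simple `S` would be invertible, and then `f =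
0`. -/
lemma IsSimple.eq_zero_or_isIso (h : H.IsSimple S) {S' : D} (h' : H.IsSimple S') (f : S ⟶ S') :
    f = 0 ∨ IsIso f := by
  by_cases hf : f = 0
  · exact .inl hf
  · right
    obtain ⟨K, k, hK, hk, hm, hl⟩ := exists_kernel h.mem h'.mem f
    refine h'.isIso h.mem hf fun Z g hZ hg => ?_
    obtain ⟨g', rfl⟩ := hl Z g hZ hg
    suffices k = 0 by rw [this, comp_zero]
    by_contra hk0
    have : IsIso k := h.isIso hK hk0 hm
    exact hf (by rwa [Preadditive.IsIso.comp_left_eq_zero] at hk)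

end BddHeart

end HeartGeneralities

/-! ### Simple tilts: uniqueness, aisles, new simples, and inversion. -/

section Tilting

open ZeroObject

variable {D : Type u} [Category.{v} D] [Preadditive D] [HasZeroObject D] [HasShift D ℤ]
  [∀ n : ℤ, (shiftFunctor D n).Additive] [Pretriangulated D]

variable {H H' H'' : BddHeart D} {X Y A B C E S S' : D} {F T : ObjectProperty D}

/-! ### Extension closures of one object -/

lemma ExtGenerated.of_filt (h : Filt (fun X => Nonempty (X ≅ S)) X) : ExtGenerated S X := by
  induction h with
  | zero hX => exact .zero hX
  | cons h hX _ ih =>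
    obtain ⟨f, g, k, hT⟩ := h
    obtain ⟨e⟩ := hX
    exact .ext f g k hT (.base e) ih

lemma extGenerated_iff [IsTriangulated D] :
    ExtGenerated S X ↔ Filt (fun X => Nonempty (X ≅ S)) X := by
  refine ⟨fun h => ?_, .of_filt⟩
  induction h with
  | zero hX => exact .zero hX
  | base e => exact .base ⟨e⟩
  | ext f g h hT _ _ ih1 ih2 => exact .ext (.of_dist hT) ih1 ih2

namespace ExtGenerated

variable [IsTriangulated D]

lemma of_iso (h : ExtGenerated S X) (e : X ≅ Y) : ExtGenerated S Y :=
  .of_filt ((extGenerated_iff.1 h).of_iso e)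

lemma isClosed (S : D) : ObjectProperty.IsClosedUnderIsomorphisms (ExtGenerated S) :=
  ⟨fun e h => h.of_iso e⟩

lemma of_ext (h : IsExt A B C) (hA : ExtGenerated S A) (hC : ExtGenerated S C) :
    ExtGenerated S B := by
  obtain ⟨f, g, k, hT⟩ := h
  exact .ext f g k hT hA hC

lemma shift (h : ExtGenerated S X) {a : ℤ} (e : S⟦a⟧ ≅ S') : ExtGenerated S' (X⟦a⟧) :=
  .of_filt ((extGenerated_iff.1 h).shift fun _ ⟨e'⟩ => ⟨(shiftFunctor D a).mapIso e' ≪≫ e⟩)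

lemma congr (e : S ≅ S') (h : ExtGenerated S X) : ExtGenerated S' X :=
  .of_filt ((extGenerated_iff.1 h).mono fun _ ⟨e'⟩ => ⟨e' ≪≫ e⟩)

lemma vanish_left {m : ℤ} (h : ExtGenerated S X) (hS : HomVanish S Y m) : HomVanish X Y m :=
  (extGenerated_iff.1 h).vanish_left fun _ ⟨e⟩ => hS.of_iso_left e.symm

lemma vanish_right {m : ℤ} (h : ExtGenerated S X) (hS : HomVanish Y S m) : HomVanish Y X m :=
  (extGenerated_iff.1 h).vanish_right fun _ ⟨e⟩ => hS.of_iso_right e.symm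

lemma mem (h : ExtGenerated S X) (hS : H.mem S) : H.mem X :=
  BddHeart.mem_of_filt (fun _ ⟨e⟩ => BddHeart.mem_iso hS e.symm) (extGenerated_iff.1 h)

end ExtGenerated

lemma HomVanish.shift_shift {m a : ℤ} (h : HomVanish X Y m) : HomVanish (X⟦a⟧) (Y⟦a⟧) m :=
  (shift_left (n := m - a) (by omega)).2 ((shift_right (n := m) (by omega)).2 h)

namespace BddHeart

/-! ### Torsion pairs -/

lemma IsTorsionPair.torsion_iff (h : H.IsTorsionPair F T) :
    T E ↔ H.mem E ∧ ∀ Y, F Y → HomVanish E Y 0 := by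
  refine ⟨fun hE => ⟨h.memT _ hE, fun Y hY => HomVanish.zero_iff.2 fun f =>
    h.hom_eq_zero _ _ f hE hY⟩, fun ⟨hE, hv⟩ => ?_⟩
  obtain ⟨X, Y, f, g, k, hX, hY, hT⟩ := h.exists_ses E hE
  have h0 : IsZero Y := HomVanish.isZero_of_self <|
    (IsExt.of_dist hT).vanish₃ (n := -1) (mem_vanish (h.memT _ hX) (h.memF _ hY) (by omega))
      (hv _ hY)
  obtain ⟨e⟩ := (IsExt.of_dist hT).isoOfIsZeroRight h0
  exact h.isoT.of_iso e hX

lemma IsTorsionPair.free_iff (h : H.IsTorsionPair F T) :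
    F E ↔ H.mem E ∧ ∀ X, T X → HomVanish X E 0 := by
  refine ⟨fun hE => ⟨h.memF _ hE, fun Y hY => HomVanish.zero_iff.2 fun f =>
    h.hom_eq_zero _ _ f hY hE⟩, fun ⟨hE, hv⟩ => ?_⟩
  obtain ⟨X, Y, f, g, k, hX, hY, hT⟩ := h.exists_ses E hE
  have h0 : IsZero X := HomVanish.isZero_of_self <|
    (IsExt.of_dist hT).coyoneda_vanish₁ (n := -1)
      (mem_vanish (h.memT _ hX) (h.memF _ hY) (by omega)) (hv _ hX)
  obtain ⟨e⟩ := (IsExt.of_dist hT).isoOfIsZeroLeft h0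
  exact h.isoF.of_iso e.symm hY

variable [IsTriangulated D]

/-- The torsion class `{E ∈ H | Hom(E, S) = 0}`. -/
def leftPerp (H : BddHeart D) (S : D) : ObjectProperty D := fun E => H.mem E ∧ HomVanish E S 0

/-- The torsion-free class `{E ∈ H | Hom(S, E) = 0}`. -/
def rightPerp (H : BddHeart D) (S : D) : ObjectProperty D := fun E => H.mem E ∧ HomVanish S E 0

lemma leftPerp_isClosed : ObjectProperty.IsClosedUnderIsomorphisms (H.leftPerp S) :=
  ⟨fun e h => ⟨mem_iso h.1 e, h.2.of_iso_left e⟩⟩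

lemma rightPerp_isClosed : ObjectProperty.IsClosedUnderIsomorphisms (H.rightPerp S) :=
  ⟨fun e h => ⟨mem_iso h.1 e, h.2.of_iso_right e⟩⟩

/-- The torsion class is the left orthogonal of the torsion-free class, and orthogonality to `⟨S⟩`
is orthogonality to `S`. Hence a simple tilt depends on `H` and `S` alone. -/
lemma IsTorsionPair.eq_leftPerp (h : H.IsTorsionPair (ExtGenerated S) T) : T = H.leftPerp S := by
  ext E
  rw [h.torsion_iff]
  exact ⟨fun ⟨h1, h2⟩ => ⟨h1, h2 _ (.base (Iso.refl _))⟩, fun ⟨h1, h2⟩ =>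
    ⟨h1, fun Y hY => hY.vanish_right h2⟩⟩

lemma IsTorsionPair.eq_rightPerp (h : H.IsTorsionPair F (ExtGenerated S)) :
    F = H.rightPerp S := by
  ext E
  rw [h.free_iff]
  exact ⟨fun ⟨h1, h2⟩ => ⟨h1, h2 _ (.base (Iso.refl _))⟩, fun ⟨h1, h2⟩ =>
    ⟨h1, fun Y hY => hY.vanish_left h2⟩⟩

lemma isSimpleForwardTilt_iff : H.IsSimpleForwardTilt S H' ↔
    H.IsSimple S ∧ IsRigid S ∧
      (∀ E, H.mem E → ∃ X Y, IsExt X E Y ∧ H.leftPerp S X ∧ ExtGenerated S Y) ∧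
      ∀ E, H'.mem E ↔ ∃ X Y, IsExt (X⟦(1 : ℤ)⟧) E Y ∧ ExtGenerated S X ∧ H.leftPerp S Y := by
  constructor
  · rintro ⟨h1, h2, T, hT, hm⟩
    obtain rfl := hT.eq_leftPerp
    refine ⟨h1, h2, fun E hE => ?_, fun E => ?_⟩
    · obtain ⟨X, Y, f, g, h, hX, hY, h⟩ := hT.exists_ses E hE
      exact ⟨X, Y, .of_dist h, hX, hY⟩
    · rw [hm]
      exact ⟨fun ⟨X, Y, f, g, h, hX, hY, hT⟩ => ⟨X, Y, .of_dist hT, hX, hY⟩,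
        fun ⟨X, Y, ⟨f, g, h, hT⟩, hX, hY⟩ => ⟨X, Y, f, g, h, hX, hY, hT⟩⟩
  · rintro ⟨h1, h2, h3, h4⟩
    refine ⟨h1, h2, H.leftPerp S, ⟨ExtGenerated.isClosed S, leftPerp_isClosed, fun X hX => hX.mem h1.mem,
      fun X hX => hX.1, fun X Y f hX hY => HomVanish.zero_iff.1 (hY.vanish_right hX.2) f,
      fun E hE => ?_⟩, fun E => ?_⟩
    · obtain ⟨X, Y, ⟨f, g, h, hT⟩, hX, hY⟩ := h3 E hE
      exact ⟨X, Y, f, g, h, hX, hY, hT⟩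
    · rw [h4]
      exact ⟨fun ⟨X, Y, ⟨f, g, h, hT⟩, hX, hY⟩ => ⟨X, Y, f, g, h, hX, hY, hT⟩,
        fun ⟨X, Y, f, g, h, hX, hY, hT⟩ => ⟨X, Y, .of_dist hT, hX, hY⟩⟩

lemma isSimpleBackwardTilt_iff : H.IsSimpleBackwardTilt S H' ↔
    H.IsSimple S ∧ IsRigid S ∧
      (∀ E, H.mem E → ∃ X Y, IsExt X E Y ∧ ExtGenerated S X ∧ H.rightPerp S Y) ∧
      ∀ E, H'.mem E ↔ ∃ X Y, IsExt X E (Y⟦(-1 : ℤ)⟧) ∧ H.rightPerp S X ∧ ExtGenerated S Y := by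
  constructor
  · rintro ⟨h1, h2, T, hT, hm⟩
    obtain rfl := hT.eq_rightPerp
    refine ⟨h1, h2, fun E hE => ?_, fun E => ?_⟩
    · obtain ⟨X, Y, f, g, h, hX, hY, h⟩ := hT.exists_ses E hE
      exact ⟨X, Y, .of_dist h, hX, hY⟩
    · rw [hm]
      exact ⟨fun ⟨X, Y, f, g, h, hX, hY, hT⟩ => ⟨X, Y, .of_dist hT, hX, hY⟩,
        fun ⟨X, Y, ⟨f, g, h, hT⟩, hX, hY⟩ => ⟨X, Y, f, g, h, hX, hY, hT⟩⟩
  · rintro ⟨h1, h2, h3, h4⟩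
    refine ⟨h1, h2, H.rightPerp S, ⟨rightPerp_isClosed, ExtGenerated.isClosed S, fun X hX => hX.1,
      fun X hX => hX.mem h1.mem, fun X Y f hX hY => HomVanish.zero_iff.1 (hX.vanish_left hY.2) f,
      fun E hE => ?_⟩, fun E => ?_⟩
    · obtain ⟨X, Y, ⟨f, g, h, hT⟩, hX, hY⟩ := h3 E hE
      exact ⟨X, Y, f, g, h, hX, hY, hT⟩
    · rw [h4]
      exact ⟨fun ⟨X, Y, ⟨f, g, h, hT⟩, hX, hY⟩ => ⟨X, Y, f, g, h, hX, hY, hT⟩,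
        fun ⟨X, Y, f, g, h, hX, hY, hT⟩ => ⟨X, Y, .of_dist hT, hX, hY⟩⟩

namespace IsSimpleForwardTilt

variable (h : H.IsSimpleForwardTilt S H')
include h

lemma isSimple : H.IsSimple S := h.1

lemma isRigid : HomVanish S S 1 := h.2.1

lemma exists_torsion (hE : H.mem E) :
    ∃ X Y, IsExt X E Y ∧ H.leftPerp S X ∧ ExtGenerated S Y :=
  (isSimpleForwardTilt_iff.1 h).2.2.1 E hE

lemma mem_iff : H'.mem E ↔
    ∃ X Y, IsExt (X⟦(1 : ℤ)⟧) E Y ∧ ExtGenerated S X ∧ H.leftPerp S Y :=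
  (isSimpleForwardTilt_iff.1 h).2.2.2 E

lemma mem_of_leftPerp (hE : H.leftPerp S E) : H'.mem E :=
  h.mem_iff.2 ⟨0, E, IsExt.zero_id E (Functor.map_isZero _ (isZero_zero D)),
    .zero (isZero_zero D), hE⟩

lemma mem_shift_of_extGenerated (hX : ExtGenerated S X) : H'.mem (X⟦(1 : ℤ)⟧) :=
  h.mem_iff.2 ⟨X, 0, IsExt.id_zero _ (isZero_zero D), hX, mem_of_isZero (isZero_zero D),
    .of_isZero_left (isZero_zero D)⟩

lemma mem_shift : H'.mem (S⟦(1 : ℤ)⟧) := h.mem_shift_of_extGenerated (.base (Iso.refl _))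

lemma le_of_mem (hE : H'.mem E) : H.t.le 0 E := by
  obtain ⟨X, Y, hE, hX, hY⟩ := h.mem_iff.1 hE
  exact le_ext hE (le_mono ((le_shift_iff (n := 0) (n' := -1) (by omega)).2
    (hX.mem h.isSimple.mem).1) (by omega)) hY.1.1

lemma le : H.LE H' := LE.of_mem_le fun _ hE => h.le_of_mem hE

lemma le_shift_one : H'.LE (H.shift 1) := by
  refine LE.of_mem_ge fun E hE => ?_
  obtain ⟨X, Y, hE, hX, hY⟩ := h.mem_iff.1 hE
  refine ge_ext hE ?_ ?_
  · exact (ge_shift_iff (H := H) (n := 0) (n' := 0 - 1) (by omega)).2 (hX.mem h.isSimple.mem).2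
  · exact ge_anti (H := H) hY.1.2 (by omega)

/-- As `S[1]` lies in the new heart, `S` lies in its `ge 1` part; nothing else new does, up to
extensions and lower shifts. Comparing a tilt with another heart thus reduces to the vanishing of
Homs to `S`. -/
lemma le_zero_iff : H'.t.le 0 X ↔ H.t.le 0 X ∧ HomVanish X S 0 := by
  constructor
  · intro hX
    refine ⟨h.le _ hX, ?_⟩
    exact vanish_of_le_of_ge (H := H') hX ((ge_shift_iff (a := 1) (n := 1) (n' := 0)
      (by omega)).1 h.mem_shift.2) (by omega)
  · rintro ⟨h1, h2⟩
    refine le_of_vanish fun Y hY => (filt_of_ge hY).vanish_right ?_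
    rintro Z ⟨E, m, hE, hm, ⟨e⟩⟩
    refine .of_iso_right e.symm ((HomVanish.shift_right (n := m) (by omega)).2 ?_)
    obtain ⟨A, B, hE, hA, hB⟩ := h.mem_iff.1 hE
    simp only [Set.mem_Iic] at hm
    refine hE.coyoneda_vanish₂ ((HomVanish.shift_right (n := 1 + m) (by omega)).2 ?_)
      (vanish_of_le_of_ge h1 hB.1.2 (by omega))
    obtain rfl | hm' := (show m ≤ -1 by omega).eq_or_lt
    · exact hA.vanish_right h2
    · exact vanish_of_le_of_ge h1 (hA.mem h.isSimple.mem).2 (by omega)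

/-- The dual description recovers `H` from its tilt: by the torsion sequence, objects of `H` are
tested on `leftPerp`, which lies in `H'`, and on `⟨S⟩`, whose shift by one lies in `H'`. -/
lemma ge_zero_iff : H.t.ge 0 X ↔ H'.t.ge 0 X ∧ HomVanish S X (-1) := by
  constructor
  · intro hX
    exact ⟨h.le.ge hX, vanish_of_le_of_ge h.isSimple.mem.1 hX (by omega)⟩
  · rintro ⟨h1, h2⟩
    refine ge_of_vanish fun Y hY => (filt_of_le hY).vanish_left ?_
    rintro Z ⟨E, m, hE, hm, ⟨e⟩⟩
    refine .of_iso_left e.symm ((HomVanish.shift_left (n := -m) (by omega)).2 ?_)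
    obtain ⟨A, B, hE, hA, hB⟩ := h.exists_torsion hE
    simp only [Set.mem_Ici] at hm
    refine hE.vanish₂ (vanish_of_le_of_ge (h.mem_of_leftPerp hA).1 h1 (by omega)) ?_
    obtain rfl | hm' := (show 1 ≤ m by omega).eq_or_lt
    · exact hB.vanish_left h2
    · exact (HomVanish.shift_left (a := 1) (m := -m + 1) (by omega)).1
        (vanish_of_le_of_ge (h.mem_shift_of_extGenerated hB).1 h1 (by omega))

lemma unique (h' : H.IsSimpleForwardTilt S H'') : H' = H'' :=
  eq_of_mem_imp fun _ hE => h'.mem_iff.2 (h.mem_iff.1 hE)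

lemma congr (e : S ≅ S') : H.IsSimpleForwardTilt S' H' := by
  refine isSimpleForwardTilt_iff.2 ⟨h.isSimple.of_iso e, (h.isRigid.of_iso_left e).of_iso_right e,
    fun E hE => ?_, fun E => ?_⟩
  · obtain ⟨X, Y, h1, h2, h3⟩ := h.exists_torsion hE
    exact ⟨X, Y, h1, ⟨h2.1, h2.2.of_iso_right e⟩, h3.congr e⟩
  · rw [h.mem_iff]
    exact ⟨fun ⟨X, Y, h1, h2, h3⟩ => ⟨X, Y, h1, h2.congr e, h3.1, h3.2.of_iso_right e⟩,
      fun ⟨X, Y, h1, h2, h3⟩ => ⟨X, Y, h1, h2.congr e.symm, h3.1, h3.2.of_iso_right e.symm⟩⟩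

/-- `S'[1]` lies in the tilt at `S`. Since `S'` is in `H`, the part of `S'[1]` in `leftPerp`
vanishes, so `S'` lies in `⟨S⟩`; being simple it is `S`. There is therefore at most one edge between
two given hearts in a given direction. -/
lemma label_unique (h' : H.IsSimpleForwardTilt S' H') : Nonempty (S ≅ S') := by
  obtain ⟨X, Y, hE, hX, hY⟩ := h.mem_iff.1 h'.mem_shift
  have h0 : IsZero Y := HomVanish.isZero_of_self <|
    hE.vanish₃ (n := -1) ((HomVanish.shift_left (n := -2) (by omega)).2
      (mem_vanish (hX.mem h.isSimple.mem) hY.1 (by omega)))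
      ((HomVanish.shift_left (n := -1) (by omega)).2 (mem_vanish h'.isSimple.mem hY.1 (by omega)))
  obtain ⟨e⟩ := hE.isoOfIsZeroRight h0
  have hS' := extGenerated_iff.1 (hX.of_iso ((shiftFunctor D (1 : ℤ)).preimageIso e))
  cases hS' with
  | zero h0 => exact (h'.isSimple.not_isZero h0).elim
  | @cons X' _ Y' hE' hX' hY' =>
    obtain ⟨f, g, k, hT⟩ := hE'
    obtain ⟨e'⟩ := hX'
    have hY'' : H.mem Y' := (ExtGenerated.of_filt hY').mem h.isSimple.mem
    have hf : f ≠ 0 := by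
      rintro rfl
      have := dist_eq_zero_of_comp₁ hT (X := X') (x := 𝟙 X')
        (mem_vanish (mem_iso h.isSimple.mem e'.symm) hY'' (by omega)) (by simp)
      exact h.isSimple.not_isZero (((IsZero.iff_id_eq_zero _).2 this).of_iso e'.symm)
    obtain h1 | h1 := h.isSimple.eq_zero_or_isIso h'.isSimple (e'.inv ≫ f)
    · rw [Preadditive.IsIso.comp_left_eq_zero] at h1
      exact (hf h1).elim
    · exact ⟨asIso (e'.inv ≫ f)⟩

/-- `S[1]` is simple in the forward tilt. -/
lemma isSimple_shift : H'.IsSimple (S⟦(1 : ℤ)⟧) := by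
  refine IsSimple.of_isIso h.mem_shift (fun h0 => h.isSimple.not_isZero (HomVanish.isZero_of_shift h0)) ?_
  intro Y f hY hf hm
  obtain ⟨A, B, ⟨a, b, c, hT⟩, hA, hB⟩ := h.mem_iff.1 hY
  have ha : ∀ (Z : D) (z : Z ⟶ A⟦(1 : ℤ)⟧), H'.mem Z → z ≫ a = 0 → z = 0 := fun Z z hZ hz =>
    dist_eq_zero_of_comp₁ hT (mem_vanish hZ (h.mem_of_leftPerp hB) (by omega)) hz
  have hA' := h.mem_shift_of_extGenerated hA
  -- A monomorphism `f : Y ⟶ S[1]` is studied on the part `A[1]` of `Y`, with `A ∈ ⟨S⟩`. If `f`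
  -- vanishes there, `A = 0`, so `Y` is torsion and the fiber of `f` is shown to be torsion too.
  -- Otherwise `a ≫ f` turns out to be invertible.
  by_cases haf : a ≫ f = 0
  · have hA0 : IsZero (A⟦(1 : ℤ)⟧) := (IsZero.iff_id_eq_zero _).2 <|
      ha _ (𝟙 _) hA' (by rw [Category.id_comp]; exact hm _ _ hA' haf)
    obtain ⟨e⟩ := (IsExt.of_dist hT).isoOfIsZeroLeft hA0
    have hYS : HomVanish Y S 0 := hB.2.of_iso_left e.symm
    obtain ⟨E, i, q, hT'⟩ := distinguished_cocone_triangle₁ f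
    have hE : H.leftPerp S E := by
      refine ⟨mem_ext (IsExt.of_dist hT').invRotate
        (mem_iso h.isSimple.mem ((shiftEquiv D (1 : ℤ)).unitIso.app S)) (mem_iso hB.1 e.symm), ?_⟩
      refine HomVanish.zero_iff.2 fun x => ?_
      apply (shiftFunctor D (1 : ℤ)).map_injective
      rw [Functor.map_zero]
      obtain ⟨g, hg⟩ := (shiftFunctor D (1 : ℤ)).map_surjective (q ≫ x⟦(1 : ℤ)⟧')
      -- `E` is an extension of `Y` by `S`, and `g` is the restriction of `x : E ⟶ S` to `S`. If `g
      -- = 0`, then `x` factors through `Y` and vanishes; if `g` is invertible, the extension splits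
      -- and `f = 0`.
      obtain rfl | hg' := h.isSimple.eq_zero_or_isIso h.isSimple g
      · rw [Functor.map_zero] at hg
        exact dist_eq_zero_of_comp₃ hT' ((HomVanish.shift_right (a := 1) (n := 0) (by omega)).2 hYS)
          hg.symm
      · have : f ≫ q ≫ x⟦(1 : ℤ)⟧' = 0 := by rw [← Category.assoc, dist_comp₂₃ hT', zero_comp]
        rw [← hg, Preadditive.IsIso.comp_right_eq_zero] at this
        exact (hf this).elim
    have hE' := h.mem_of_leftPerp hE
    have hi : i = 0 := hm _ _ hE' (dist_comp₁₂ hT')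
    have : 𝟙 E = 0 := dist_eq_zero_of_comp₁ hT' (mem_vanish hE' h.mem_shift (by omega))
      (by rw [hi, comp_zero])
    exact (Triangle.isZero₁_iff_isIso₂ _ hT').1 ((IsZero.iff_id_eq_zero _).2 this)
  · obtain ⟨K, k, q, hT'⟩ := distinguished_cocone_triangle₁ (a ≫ f)
    have hK : H'.mem K := by
      have h1 := (extGenerated_iff.1 (hA.shift (Iso.refl (S⟦(1 : ℤ)⟧)))).fiber ?_ haf hT'
      · exact (ExtGenerated.of_filt h1).mem h.mem_shift
      · rintro X ⟨e⟩ g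
        obtain ⟨g', hg'⟩ := (shiftFunctor D (1 : ℤ)).map_surjective (e.inv ≫ g)
        obtain rfl | h0 := h.isSimple.eq_zero_or_isIso h.isSimple g'
        · left
          rw [Functor.map_zero] at hg'
          have := hg'.symm
          rwa [Preadditive.IsIso.comp_left_eq_zero] at this
        · right
          have : IsIso (e.inv ≫ g) := by rw [← hg']; infer_instance
          exact IsIso.of_isIso_comp_left e.inv g
    have hk : k = 0 := ha _ _ hK (hm _ _ hK (by rw [Category.assoc]; exact dist_comp₁₂ hT'))
    have : 𝟙 K = 0 := dist_eq_zero_of_comp₁ hT' (mem_vanish hK h.mem_shift (by omega))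
      (by rw [hk, comp_zero])
    have : IsIso (a ≫ f) :=
      (Triangle.isZero₁_iff_isIso₂ _ hT').1 ((IsZero.iff_id_eq_zero _).2 this)
    -- This is a section of `f`; it is a two-sided inverse because `f` is a monomorphism in `H'`.
    refine ⟨inv (a ≫ f) ≫ a, ?_, by simp⟩
    rw [← sub_eq_zero]
    refine hm _ _ hY ?_
    rw [Preadditive.sub_comp]
    simp

/-- The forward tilt is undone by the backward tilt at `S[1]`. -/
lemma reverse : H'.IsSimpleBackwardTilt (S⟦(1 : ℤ)⟧) H := by
  refine isSimpleBackwardTilt_iff.2 ⟨h.isSimple_shift, h.isRigid.shift_shift, fun E hE => ?_,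
    fun E => ?_⟩
  · obtain ⟨X, Y, h1, h2, h3⟩ := h.mem_iff.1 hE
    exact ⟨_, _, h1, h2.shift (Iso.refl _), h.mem_of_leftPerp h3,
      (HomVanish.shift_left (n := -1) (by omega)).2 (mem_vanish h.isSimple.mem h3.1 (by omega))⟩
  · constructor
    · intro hE
      obtain ⟨X, Y, h1, h2, h3⟩ := h.exists_torsion hE
      exact ⟨X, Y⟦(1 : ℤ)⟧, h1.of_iso (Iso.refl _) (Iso.refl _)
        ((shiftEquiv D (1 : ℤ)).unitIso.app Y), ⟨h.mem_of_leftPerp h2,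
        (HomVanish.shift_left (n := -1) (by omega)).2 (mem_vanish h.isSimple.mem h2.1 (by omega))⟩,
        h3.shift (Iso.refl _)⟩
    · rintro ⟨X, Y, h1, h2, h3⟩
      refine mem_ext h1 ?_ ((h3.shift ((shiftEquiv D (1 : ℤ)).unitIso.symm.app S)).mem
        h.isSimple.mem)
      exact ⟨h.le_of_mem h2.1, h.ge_zero_iff.2 ⟨h2.1.2,
        (HomVanish.shift_left (a := 1) (m := 0) (by omega)).1 h2.2⟩⟩

end IsSimpleForwardTilt

namespace IsSimpleBackwardTilt

variable (h : H.IsSimpleBackwardTilt S H')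
include h

lemma isSimple : H.IsSimple S := h.1

lemma isRigid : HomVanish S S 1 := h.2.1

lemma exists_torsion (hE : H.mem E) :
    ∃ X Y, IsExt X E Y ∧ ExtGenerated S X ∧ H.rightPerp S Y :=
  (isSimpleBackwardTilt_iff.1 h).2.2.1 E hE

lemma mem_iff : H'.mem E ↔
    ∃ X Y, IsExt X E (Y⟦(-1 : ℤ)⟧) ∧ H.rightPerp S X ∧ ExtGenerated S Y :=
  (isSimpleBackwardTilt_iff.1 h).2.2.2 E

lemma mem_of_rightPerp (hE : H.rightPerp S E) : H'.mem E :=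
  h.mem_iff.2 ⟨E, 0, IsExt.id_zero E (Functor.map_isZero _ (isZero_zero D)), hE,
    .zero (isZero_zero D)⟩

lemma mem_shift_of_extGenerated (hX : ExtGenerated S X) : H'.mem (X⟦(-1 : ℤ)⟧) :=
  h.mem_iff.2 ⟨0, X, IsExt.zero_id _ (isZero_zero D), ⟨mem_of_isZero (isZero_zero D),
    .of_isZero_right (isZero_zero D)⟩, hX⟩

lemma mem_shift : H'.mem (S⟦(-1 : ℤ)⟧) := h.mem_shift_of_extGenerated (.base (Iso.refl _))

lemma unique (h' : H.IsSimpleBackwardTilt S H'') : H' = H'' :=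
  eq_of_mem_imp fun _ hE => h'.mem_iff.2 (h.mem_iff.1 hE)

lemma congr (e : S ≅ S') : H.IsSimpleBackwardTilt S' H' := by
  refine isSimpleBackwardTilt_iff.2 ⟨h.isSimple.of_iso e,
    (h.isRigid.of_iso_left e).of_iso_right e, fun E hE => ?_, fun E => ?_⟩
  · obtain ⟨X, Y, h1, h2, h3⟩ := h.exists_torsion hE
    exact ⟨X, Y, h1, h2.congr e, h3.1, h3.2.of_iso_left e⟩
  · rw [h.mem_iff]
    exact ⟨fun ⟨X, Y, h1, h2, h3⟩ => ⟨X, Y, h1, ⟨h2.1, h2.2.of_iso_left e⟩, h3.congr e⟩,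
      fun ⟨X, Y, h1, h2, h3⟩ => ⟨X, Y, h1, ⟨h2.1, h2.2.of_iso_left e.symm⟩, h3.congr e.symm⟩⟩

/-- `S[-1]` is simple in the backward tilt. -/
lemma isSimple_shift : H'.IsSimple (S⟦(-1 : ℤ)⟧) := by
  refine IsSimple.of_isIso h.mem_shift (fun h0 => h.isSimple.not_isZero (HomVanish.isZero_of_shift h0)) ?_
  intro Y f hY hf hm
  obtain ⟨A, B, ⟨a, b, c, hT⟩, hA, hB⟩ := h.mem_iff.1 hY
  have haf : a ≫ f = 0 := by
    refine HomVanish.zero_iff.1 ((HomVanish.shift_right (n := -1) (by omega)).2 ?_) _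
    exact mem_vanish hA.1 h.isSimple.mem (by omega)
  have hA' := h.mem_of_rightPerp hA
  have hA0 : IsZero A := (IsZero.iff_id_eq_zero _).2 <|
    dist_eq_zero_of_comp₁ hT (mem_vanish hA' (h.mem_shift_of_extGenerated hB) (by omega))
      (by rw [Category.id_comp]; exact hm _ _ hA' haf)
  obtain ⟨e⟩ := (IsExt.of_dist hT).isoOfIsZeroLeft hA0
  have hYG : ExtGenerated (S⟦(-1 : ℤ)⟧) Y := (hB.shift (Iso.refl _)).of_iso e.symm
  obtain ⟨K, k, q, hT'⟩ := distinguished_cocone_triangle₁ f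
  have hK : H'.mem K := by
    have h1 := (extGenerated_iff.1 hYG).fiber ?_ hf hT'
    · exact (ExtGenerated.of_filt h1).mem h.mem_shift
    · rintro X ⟨e⟩ g
      obtain ⟨g', hg'⟩ := (shiftFunctor D (-1 : ℤ)).map_surjective (e.inv ≫ g)
      obtain rfl | h0 := h.isSimple.eq_zero_or_isIso h.isSimple g'
      · left
        rw [Functor.map_zero] at hg'
        have := hg'.symm
        rwa [Preadditive.IsIso.comp_left_eq_zero] at this
      · right
        have : IsIso (e.inv ≫ g) := by rw [← hg']; infer_instance
        exact IsIso.of_isIso_comp_left e.inv g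
  have hk : k = 0 := hm _ _ hK (dist_comp₁₂ hT')
  have : 𝟙 K = 0 := dist_eq_zero_of_comp₁ hT' (mem_vanish hK h.mem_shift (by omega))
    (by rw [hk, comp_zero])
  exact (Triangle.isZero₁_iff_isIso₂ _ hT').1 ((IsZero.iff_id_eq_zero _).2 this)

lemma reverse : H'.IsSimpleForwardTilt (S⟦(-1 : ℤ)⟧) H := by
  refine isSimpleForwardTilt_iff.2 ⟨h.isSimple_shift, h.isRigid.shift_shift, fun E hE => ?_,
    fun E => ?_⟩
  · obtain ⟨X, Y, h1, h2, h3⟩ := h.mem_iff.1 hE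
    exact ⟨_, _, h1, ⟨h.mem_of_rightPerp h2, (HomVanish.shift_right (n := -1) (by omega)).2
      (mem_vanish h2.1 h.isSimple.mem (by omega))⟩, h3.shift (Iso.refl _)⟩
  · constructor
    · intro hE
      obtain ⟨X, Y, h1, h2, h3⟩ := h.exists_torsion hE
      exact ⟨X⟦(-1 : ℤ)⟧, Y, h1.of_iso ((shiftEquiv D (1 : ℤ)).counitIso.symm.app X) (Iso.refl _)
        (Iso.refl _), h2.shift (Iso.refl _), h.mem_of_rightPerp h3,
        (HomVanish.shift_right (n := -1) (by omega)).2
          (mem_vanish h3.1 h.isSimple.mem (by omega))⟩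
    · rintro ⟨X, Y, h1, h2, h3⟩
      refine mem_ext h1 ((h2.shift ((shiftEquiv D (1 : ℤ)).counitIso.app S)).mem
        h.isSimple.mem) ?_
      -- An object of `H'` without maps to `S[-1]` has no part in `⟨S⟩[-1]`, so it already lies in
      -- `H`.
      obtain ⟨A, B, hE, hA, hB⟩ := h.mem_iff.1 h3.1
      have h0 : IsZero (B⟦(-1 : ℤ)⟧) := HomVanish.isZero_of_self <|
        hE.vanish₃ (n := -1) (mem_vanish (h.mem_of_rightPerp hA)
          (h.mem_shift_of_extGenerated hB) (by omega))
          ((hB.shift (Iso.refl _)).vanish_right h3.2)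
      obtain ⟨e⟩ := hE.isoOfIsZeroRight h0
      exact mem_iso hA.1 e

end IsSimpleBackwardTilt

end BddHeart

end Tilting

/-! ### Recognition of simple tilts from families of simples. -/

section SimpleMindedTilting

open ZeroObject

variable {D : Type u} [Category.{v} D] [Preadditive D] [HasZeroObject D] [HasShift D ℤ]
  [∀ n : ℤ, (shiftFunctor D n).Additive] [Pretriangulated D] [IsTriangulated D] {ι : Type v'}
  {S S' : ι → D}

namespace SimpleMinded

variable (hS : SimpleMinded S)
include hS

lemma eq_zero_or_isIso_of_iso {i j : ι} {X Y : D} (e : X ≅ S i) (e' : Y ≅ S j) (f : X ⟶ Y) :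
    f = 0 ∨ IsIso f := by
  let a := (shiftFunctorZero D ℤ).app (S i)
  let b := (shiftFunctorZero D ℤ).app (S j)
  obtain h | h := hS.eq_zero_or_isIso le_rfl (a.hom ≫ e.inv ≫ f ≫ e'.hom ≫ b.inv)
  · left
    rwa [Preadditive.IsIso.comp_left_eq_zero, Preadditive.IsIso.comp_left_eq_zero,
      Preadditive.IsIso.comp_right_eq_zero] at h
  · right
    have : f = e.hom ≫ a.inv ≫ (a.hom ≫ e.inv ≫ f ≫ e'.hom ≫ b.inv) ≫ b.hom ≫ e'.inv := by simp
    rw [this]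
    infer_instance

lemma heart_mem (i : ι) : hS.heart.mem (S i) := hS.heart_mem_iff.2 (.base ⟨i, ⟨Iso.refl _⟩⟩)

lemma heart_isSimple (i : ι) : hS.heart.IsSimple (S i) := by
  refine BddHeart.IsSimple.of_isIso (hS.heart_mem i) (hS.not_isZero i) fun Y f hY hf hm => ?_
  obtain ⟨K, k, q, hK, hT⟩ := (hS.heart_mem_iff.1 hY).exists_fiber
    (fun X ⟨j, ⟨e⟩⟩ g => hS.eq_zero_or_isIso_of_iso e (Iso.refl _) g) hf
  have hK' := hS.heart_mem_iff.2 hK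
  have hk := hm _ k hK' (dist_comp₁₂ hT)
  have : 𝟙 K = 0 := dist_eq_zero_of_comp₁ hT
    (BddHeart.mem_vanish hK' (hS.heart_mem i) (by omega)) (by rw [hk, comp_zero])
  exact (Triangle.isZero₁_iff_isIso₂ _ hT).1 ((IsZero.iff_id_eq_zero _).2 this)

lemma exists_iso_of_isSimple {X : D} (hX : hS.heart.IsSimple X) : ∃ i, Nonempty (X ≅ S i) := by
  cases hS.heart_mem_iff.1 hX.mem with
  | zero h => exact (hX.not_isZero h).elim
  | @cons A _ B h hA hB =>
    obtain ⟨f, g, k, hT⟩ := h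
    obtain ⟨i, ⟨e⟩⟩ := hA
    have hA' : hS.heart.mem A := BddHeart.mem_iso (hS.heart_mem i) e.symm
    obtain h1 | h1 := ((hS.heart_isSimple i).of_iso e.symm).eq_zero_or_isIso hX f
    · subst h1
      have := dist_eq_zero_of_comp₁ hT (X := A) (x := 𝟙 A)
        (BddHeart.mem_vanish hA' (hS.heart_mem_iff.2 hB) (by omega)) (by simp)
      exact (hS.not_isZero i (((IsZero.iff_id_eq_zero _).2 this).of_iso e.symm)).elim
    · exact ⟨i, ⟨(asIso f).symm ≪≫ e⟩⟩

/-- Induction on a composition series. Adding a simple `X` below the torsion part `T'` gives `E₁`.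
If `E₁` maps nontrivially to `S p`, the map is invertible on `X`, as `T'` has no map to `S p`; then
its kernel is `T'`, and the copy of `S p` moves to the torsion-free quotient. -/
lemma exists_leftPerp (p : ι) {E : D} (hE : hS.heart.mem E) :
    ∃ X Y, IsExt X E Y ∧ hS.heart.leftPerp (S p) X ∧ ExtGenerated (S p) Y := by
  rw [hS.heart_mem_iff] at hE
  induction hE with
  | @zero E hE => exact ⟨E, 0, IsExt.id_zero E (isZero_zero D),
      ⟨BddHeart.mem_of_isZero hE, .of_isZero_left hE⟩, .zero (isZero_zero D)⟩
  | @cons X E E' h hX _ ih =>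
    obtain ⟨T', F', h', hT', hF'⟩ := ih
    obtain ⟨E₁, h1, h2⟩ := h.exists_pullback h'
    obtain ⟨i, ⟨e⟩⟩ := hX
    by_cases hv : HomVanish E₁ (S p) 0
    · exact ⟨E₁, F', h2, ⟨BddHeart.mem_ext h1 (BddHeart.mem_iso (hS.heart_mem i) e.symm) hT'.1, hv⟩,
        hF'⟩
    · rw [HomVanish.zero_iff] at hv
      push Not at hv
      obtain ⟨f, hf⟩ := hv
      obtain ⟨x, y, z, hT⟩ := h1
      obtain h0 | h0 := hS.eq_zero_or_isIso_of_iso e (Iso.refl (S p)) (x ≫ f)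
      · obtain ⟨g, rfl⟩ := dist_desc₂ hT f h0
        rw [HomVanish.zero_iff.1 hT'.2 g, comp_zero] at hf
        exact (hf rfl).elim
      · obtain ⟨K, k, q, hK⟩ := distinguished_cocone_triangle₁ f
        obtain ⟨e'⟩ := nonempty_iso_of_isIso_comp hT hK h0
        obtain ⟨E'', h3, h4⟩ := h2.exists_pushout (.of_dist hK)
        exact ⟨K, E'', h4, ⟨BddHeart.mem_iso hT'.1 e'.symm, hT'.2.of_iso_left e'.symm⟩,
          .of_ext h3 (.base (Iso.refl _)) hF'⟩

/-- Dual to `exists_leftPerp`: the simple is now added on top, hence the induction from the sub. -/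
lemma exists_rightPerp (p : ι) {E : D} (hE : hS.heart.mem E) :
    ∃ X Y, IsExt X E Y ∧ ExtGenerated (S p) X ∧ hS.heart.rightPerp (S p) Y := by
  refine (hS.heart_mem_iff.1 hE).snoc_induction (motive := fun E => ∃ X Y, IsExt X E Y ∧
    ExtGenerated (S p) X ∧ hS.heart.rightPerp (S p) Y) ?_ ?_ ?_
  · rintro E E' e ⟨X, Y, h1, h2⟩
    exact ⟨X, Y, h1.of_iso (Iso.refl _) e (Iso.refl _), h2⟩
  · intro E hE
    exact ⟨0, E, IsExt.zero_id E (isZero_zero D), .zero (isZero_zero D),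
      BddHeart.mem_of_isZero hE, .of_isZero_right hE⟩
  · rintro E' E X h - ⟨A', B', h', hA', hB'⟩ ⟨i, ⟨e⟩⟩
    obtain ⟨E₁, h1, h2⟩ := h.exists_pushout h'
    by_cases hv : HomVanish (S p) E₁ 0
    · exact ⟨A', E₁, h2, hA', BddHeart.mem_ext h1 hB'.1
        (BddHeart.mem_iso (hS.heart_mem i) e.symm), hv⟩
    · rw [HomVanish.zero_iff] at hv
      push Not at hv
      obtain ⟨f, hf⟩ := hv
      obtain ⟨x, y, z, hT⟩ := h1
      obtain h0 | h0 := hS.eq_zero_or_isIso_of_iso (Iso.refl (S p)) e (f ≫ y)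
      · obtain ⟨g, rfl⟩ := dist_lift₂ hT f h0
        rw [HomVanish.zero_iff.1 hB'.2 g, zero_comp] at hf
        exact (hf rfl).elim
      · obtain ⟨C, k, q, hC⟩ := distinguished_cocone_triangle f
        obtain ⟨e'⟩ := nonempty_iso_of_isIso_comp hC hT h0
        obtain ⟨E'', h3, h4⟩ := h2.exists_pullback (.of_dist hC)
        exact ⟨E'', C, h4, .of_ext h3 hA' (.base (Iso.refl _)), BddHeart.mem_iso hB'.1 e',
          hB'.2.of_iso_right e'⟩

omit hS in
lemma heart_mem_vanish_left (hS' : SimpleMinded S') {E Y : D} (hE : hS'.heart.mem E) {m : ℤ}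
    (h : ∀ i, HomVanish (S' i) Y m) : HomVanish E Y m :=
  (hS'.heart_mem_iff.1 hE).vanish_left fun _ ⟨i, ⟨e⟩⟩ => (h i).of_iso_left e.symm

omit hS in
lemma heart_mem_vanish_right (hS' : SimpleMinded S') {E Y : D} (hE : hS'.heart.mem E) {m : ℤ}
    (h : ∀ i, HomVanish Y (S' i) m) : HomVanish Y E m :=
  (hS'.heart_mem_iff.1 hE).vanish_right fun _ ⟨i, ⟨e⟩⟩ => (h i).of_iso_right e.symm

omit hS in
lemma le_of_heart_mem (hS' : SimpleMinded S') {H : BddHeart D} {n : ℤ} {E : D}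
    (hE : hS'.heart.mem E) (h : ∀ i, H.t.le n (S' i)) : H.t.le n E :=
  BddHeart.le_of_filt (fun _ ⟨i, ⟨e⟩⟩ => BddHeart.le_iso (h i) e.symm) (hS'.heart_mem_iff.1 hE)

omit hS in
lemma ge_of_heart_mem (hS' : SimpleMinded S') {H : BddHeart D} {n : ℤ} {E : D}
    (hE : hS'.heart.mem E) (h : ∀ i, H.t.ge n (S' i)) : H.t.ge n E :=
  BddHeart.ge_of_filt (fun _ ⟨i, ⟨e⟩⟩ => BddHeart.ge_iso (h i) e.symm) (hS'.heart_mem_iff.1 hE)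

open BddHeart in
/-- Recognition of the simple forward tilt from its simple objects. -/
lemma isSimpleForwardTilt (hS' : SimpleMinded S') {p : ι} (hr : HomVanish (S p) (S p) 1)
    (hp : S' p = (S p)⟦(1 : ℤ)⟧) (hm : ∀ i, i ≠ p → hS.heart.leftPerp (S p) (S' i)) :
    hS.heart.IsSimpleForwardTilt (S p) hS'.heart := by
  refine isSimpleForwardTilt_iff.2 ⟨hS.heart_isSimple p, hr, fun E => hS.exists_leftPerp p, ?_⟩
  have h1 : ∀ Y, hS.heart.leftPerp (S p) Y → hS'.heart.mem Y := by
    rintro Y ⟨hY, hv⟩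
    rw [hS'.heart_mem_iff_vanish]
    refine ⟨fun i m hm' => ?_, fun i m hm' => ?_⟩
    · by_cases hi : i = p
      · subst hi
        rw [hp, HomVanish.shift_right rfl]
        obtain rfl | h := (show m ≤ -1 by omega).eq_or_lt
        · exact hv
        · exact mem_vanish hY (hS.heart_mem i) (by omega)
      · exact mem_vanish hY (hm i hi).1 hm'
    · by_cases hi : i = p
      · subst hi
        rw [hp, HomVanish.shift_left (n := m - 1) (by omega)]
        exact mem_vanish (hS.heart_mem i) hY (by omega)
      · exact mem_vanish (hm i hi).1 hY hm'
  intro E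
  constructor
  · intro hE
    -- The simples of the new heart have cohomology in degrees `-1` and `0` only, so `L[-1]` and `G`
    -- are the two cohomology objects of `E`. They must lie in `⟨S p⟩` and in `leftPerp`
    -- respectively.
    obtain ⟨L, G, hLG, hL, hG⟩ := hS.heart.exists_trunc (-1) E
    have hEle : hS.heart.t.le 0 E := hS'.le_of_heart_mem hE fun i => by
      by_cases hi : i = p
      · subst hi
        rw [hp, le_shift_iff (n := 1) (by omega)]
        exact le_mono (hS.heart_mem i).1 (by omega)
      · exact (hm i hi).1.1
    have hEge : hS.heart.t.ge (-1) E := hS'.ge_of_heart_mem hE fun i => by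
      by_cases hi : i = p
      · subst hi
        rw [hp, ge_shift_iff (n := 0) (by omega)]
        exact (hS.heart_mem i).2
      · exact ge_anti (hm i hi).1.2 (by omega)
    have hG' : hS.heart.mem G := ⟨le_ext₃ hLG (le_mono hL (by omega)) hEle, hG⟩
    have hL' : hS.heart.mem (L⟦(-1 : ℤ)⟧) := ⟨(le_shift_iff (n := -1) (by omega)).2 hL,
      (ge_shift_iff (n := -1) (by omega)).2 (ge_ext₁ hLG (ge_anti hG (by omega)) hEge)⟩
    let e : L⟦(-1 : ℤ)⟧⟦(1 : ℤ)⟧ ≅ L := (shiftEquiv D (1 : ℤ)).counitIso.app L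
    refine ⟨L⟦(-1 : ℤ)⟧, G, hLG.of_iso e.symm (Iso.refl _) (Iso.refl _), ?_, hG', ?_⟩
    -- The torsion part `A` of `L[-1]` lies in the new heart, as does `E`, so `Hom(A, E[-1]) = 0`.
    -- This kills the inclusion of `A`, and `A = 0`.
    · obtain ⟨A, B, h2, hA, hB⟩ := hS.exists_leftPerp p hL'
      have hAL : HomVanish A L (-1) := hLG.coyoneda_vanish₁ (n := -2)
        (mem_vanish hA.1 hG' (by omega)) (mem_vanish (h1 A hA) hE (by omega))
      have : IsZero A := HomVanish.isZero_of_self <| h2.coyoneda_vanish₁ (n := -1)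
        (mem_vanish hA.1 (hB.mem (hS.heart_mem p)) (by omega))
        ((HomVanish.shift_right (by omega)).2 hAL)
      obtain ⟨e'⟩ := h2.isoOfIsZeroLeft this
      exact hB.of_iso e'.symm
    · refine hLG.vanish₃ (n := -1) (vanish_of_le_of_ge hL (hS.heart_mem p).2 (by omega)) ?_
      refine hS'.heart_mem_vanish_left hE fun i => ?_
      by_cases hi : i = p
      · subst hi
        rw [hp, HomVanish.shift_left (n := -1) (by omega)]
        exact mem_vanish (hS.heart_mem i) (hS.heart_mem i) (by omega)
      · exact (hm i hi).2
  · rintro ⟨X, Y, hE, hX, hY⟩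
    refine mem_ext hE ((hX.shift (Iso.refl _)).mem ?_) (h1 _ hY)
    rw [← hp]
    exact hS'.heart_mem p

open BddHeart in
/-- Recognition of the simple backward tilt from its simple objects. -/
lemma isSimpleBackwardTilt (hS' : SimpleMinded S') {p : ι} (hr : HomVanish (S p) (S p) 1)
    (hp : S' p = (S p)⟦(-1 : ℤ)⟧) (hm : ∀ i, i ≠ p → hS.heart.rightPerp (S p) (S' i)) :
    hS.heart.IsSimpleBackwardTilt (S p) hS'.heart := by
  refine isSimpleBackwardTilt_iff.2 ⟨hS.heart_isSimple p, hr, fun E => hS.exists_rightPerp p, ?_⟩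
  have h1 : ∀ Y, hS.heart.rightPerp (S p) Y → hS'.heart.mem Y := by
    rintro Y ⟨hY, hv⟩
    rw [hS'.heart_mem_iff_vanish]
    refine ⟨fun i m hm' => ?_, fun i m hm' => ?_⟩
    · by_cases hi : i = p
      · subst hi
        rw [hp, HomVanish.shift_right rfl]
        exact mem_vanish hY (hS.heart_mem i) (by omega)
      · exact mem_vanish hY (hm i hi).1 hm'
    · by_cases hi : i = p
      · subst hi
        rw [hp, HomVanish.shift_left (n := m + 1) (by omega)]
        obtain rfl | h := (show m ≤ -1 by omega).eq_or_lt
        · exact hv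
        · exact mem_vanish (hS.heart_mem i) hY (by omega)
      · exact mem_vanish (hm i hi).1 hY hm'
  intro E
  constructor
  · intro hE
    obtain ⟨L, G, hLG, hL, hG⟩ := hS.heart.exists_trunc 0 E
    have hEle : hS.heart.t.le 1 E := hS'.le_of_heart_mem hE fun i => by
      by_cases hi : i = p
      · subst hi
        rw [hp, le_shift_iff (n := 0) (by omega)]
        exact (hS.heart_mem i).1
      · exact le_mono (hm i hi).1.1 (by omega)
    have hEge : hS.heart.t.ge 0 E := hS'.ge_of_heart_mem hE fun i => by
      by_cases hi : i = p
      · subst hi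
        rw [hp, ge_shift_iff (n := -1) (by omega)]
        exact ge_anti (hS.heart_mem i).2 (by omega)
      · exact (hm i hi).1.2
    have hL' : hS.heart.mem L := ⟨hL, ge_ext₁ hLG (ge_anti hG (by omega)) hEge⟩
    have hG' : hS.heart.mem (G⟦(1 : ℤ)⟧) := ⟨(le_shift_iff (n := 1) (by omega)).2
      (le_ext₃ hLG (le_mono hL (by omega)) hEle), (ge_shift_iff (n := 1) (by omega)).2 hG⟩
    let e : G ≅ G⟦(1 : ℤ)⟧⟦(-1 : ℤ)⟧ := (shiftEquiv D (1 : ℤ)).unitIso.app G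
    refine ⟨L, G⟦(1 : ℤ)⟧, hLG.of_iso (Iso.refl _) (Iso.refl _) e, ⟨hL', ?_⟩, ?_⟩
    · refine hLG.coyoneda_vanish₁ (n := -1)
        (vanish_of_le_of_ge (hS.heart_mem p).1 hG (by omega)) ?_
      refine hS'.heart_mem_vanish_right hE fun i => ?_
      by_cases hi : i = p
      · subst hi
        rw [hp, HomVanish.shift_right (n := -1) (by omega)]
        exact mem_vanish (hS.heart_mem i) (hS.heart_mem i) (by omega)
      · exact (hm i hi).2
    · obtain ⟨A, B, h2, hA, hB⟩ := hS.exists_rightPerp p hG'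
      have hGB : HomVanish G B (-1) := hLG.vanish₃ (n := -2)
        (mem_vanish hL' hB.1 (by omega)) (mem_vanish hE (h1 B hB) (by omega))
      have : IsZero B := HomVanish.isZero_of_self <| h2.vanish₃ (n := -1)
        (mem_vanish (hA.mem (hS.heart_mem p)) hB.1 (by omega))
        ((HomVanish.shift_left (by omega)).2 hGB)
      obtain ⟨e'⟩ := h2.isoOfIsZeroRight this
      exact hA.of_iso e'
  · rintro ⟨X, Y, hE, hX, hY⟩
    refine mem_ext hE (h1 _ hX) ((hY.shift (Iso.refl _)).mem ?_)
    rw [← hp]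
    exact hS'.heart_mem p

end SimpleMinded

end SimpleMindedTilting

/-! ### Bricks and exceptional families relative to a hereditary heart. -/

section HereditaryHearts

open ZeroObject

variable {D : Type u} [Category.{v} D] [Preadditive D] [HasZeroObject D] [HasShift D ℤ]
  [∀ n : ℤ, (shiftFunctor D n).Additive] [Pretriangulated D] [IsTriangulated D] {ι : Type v'}
  {S : ι → D} {X Y M N : D}

/-- Every endomorphism of `X` is zero or invertible. -/
def IsBrick (X : D) : Prop := ∀ f : X ⟶ X, f = 0 ∨ IsIso f

omit [HasZeroObject D] [∀ n : ℤ, (shiftFunctor D n).Additive] [Pretriangulated D]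
  [IsTriangulated D] in
lemma IsBrick.shift [∀ n : ℤ, (shiftFunctor D n).Additive] (h : IsBrick X) (a : ℤ) :
    IsBrick (X⟦a⟧) := by
  intro f
  obtain ⟨g, rfl⟩ := (shiftFunctor D a).map_surjective f
  obtain rfl | hg := h g
  · left; simp
  · right; infer_instance

/-- The triangle splits, and the projector of `X` onto the summand `G` is zero or invertible. -/
lemma IsBrick.isZero_or_isZero {L G : D} (h : IsBrick X) (hE : IsExt L X G)
    (hv : HomVanish G L 1) : IsZero L ∨ IsZero G := by
  obtain ⟨f, g, k, hT⟩ := hE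
  obtain rfl : k = 0 := hv k
  obtain ⟨s, hs⟩ := dist_lift₃ hT (𝟙 G) (by simp)
  obtain h0 | h0 := h (g ≫ s)
  · right
    rw [IsZero.iff_id_eq_zero, ← Category.id_comp (𝟙 G), hs, Category.assoc, reassoc_of% h0]
    simp
  · left
    refine (Triangle.isZero₁_iff _ hT).2 ⟨?_, rfl⟩
    have : f ≫ g ≫ s = 0 := by rw [← Category.assoc, dist_comp₁₂ hT, zero_comp]
    rwa [Preadditive.IsIso.comp_right_eq_zero] at this

namespace BddHeart

variable {H : BddHeart D}

/-- The heart is hereditary: `Ext^m` vanishes on it for `m ≥ 2`. -/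
def Hereditary (H : BddHeart D) : Prop :=
  ∀ X Y (m : ℤ), H.mem X → H.mem Y → 2 ≤ m → HomVanish X Y m

lemma Hereditary.vanish (hH : H.Hereditary) {a b m : ℤ} (hX : H.t.ge a X) (hY : H.t.le b Y)
    (h : 2 + b ≤ m + a) : HomVanish X Y m := by
  refine (filt_of_ge hX).vanish_left ?_
  rintro Z ⟨E, n, hE, hn, ⟨e⟩⟩
  refine .of_iso_left e.symm ((HomVanish.shift_left (n := m - n) (by omega)).2 ?_)
  refine (filt_of_le hY).vanish_right ?_
  rintro Z' ⟨E', n', hE', hn', ⟨e'⟩⟩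
  refine .of_iso_right e'.symm ((HomVanish.shift_right (n := n' + (m - n)) (by omega)).2 ?_)
  simp only [Set.mem_Iic, Set.mem_Ici] at hn hn'
  exact hH _ _ _ hE hE' (by omega)

/-- By heredity the truncation triangles of `X` split, so one truncation of a brick vanishes at each
step. The interval that contains its cohomology shrinks to one point. -/
lemma Hereditary.exists_degree (hH : H.Hereditary) (hX : IsBrick X) :
    ∃ d : ℤ, (H.shift d).mem X := by
  obtain ⟨⟨a, ha⟩, ⟨b, hb⟩⟩ := H.bounded X
  replace ha := ha.ge
  replace hb := hb.le
  obtain ⟨k, hk⟩ : ∃ k : ℕ, b ≤ a + k := ⟨(b - a).toNat, by omega⟩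
  induction k generalizing b with
  | zero => exact ⟨-b, shift_mem_iff.2 ⟨by simpa using hb, ge_anti ha (by simp at hk ⊢; omega)⟩⟩
  | succ k ih =>
    obtain ⟨L, G, hE, hL, hG⟩ := H.exists_trunc (b - 1) X
    obtain h0 | h0 := hX.isZero_or_isZero hE (hH.vanish hG hL (by omega))
    · obtain ⟨e⟩ := hE.isoOfIsZeroLeft h0
      exact ⟨-b, shift_mem_iff.2 ⟨by simpa using hb, ge_iso (ge_anti hG (by omega)) e.symm⟩⟩
    · obtain ⟨e⟩ := hE.isoOfIsZeroRight h0
      exact ih (b - 1) (le_iso hL e) (by push_cast at hk; omega)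

/-- A nonzero morphism between bricks of a hereditary heart is a monomorphism or an epimorphism,
provided that there are no extensions in the other direction. -/
lemma Hereditary.mono_or_epi (hH : H.Hereditary) (hM : H.mem M) (hN : H.mem N) (bM : IsBrick M)
    (bN : IsBrick N) (hv : HomVanish N M 1) {f : M ⟶ N} (hf : f ≠ 0) :
    ∃ K, H.mem K ∧ (IsExt K M N ∨ IsExt M N K) := by
  obtain ⟨C, c, z, hT⟩ := distinguished_cocone_triangle f
  -- `L[-1]` is the kernel of `f` in the heart and `G` is its cokernel.
  obtain ⟨L, G, ⟨a, b, k, hT'⟩, hL, hG⟩ := H.exists_trunc (-1) C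
  have hE := IsExt.of_dist hT
  have hE' := IsExt.of_dist hT'
  have hC1 : H.t.le 0 C := le_ext₃ hE (le_mono hM.1 (by omega)) hN.1
  have hC2 : H.t.ge (-1) C := ge_ext₃ hE hM.2 (ge_anti hN.2 (by omega))
  have hG' : H.mem G := ⟨le_ext₃ hE' (le_mono hL (by omega)) hC1, hG⟩
  have hL' : H.t.ge (-1) L := ge_ext₁ hE' (ge_anti hG (by omega)) hC2
  -- Heredity splits the cone: `C = L ⊕ G`, with section `s` of `b` and retraction `r` of `a`.
  obtain rfl : k = 0 := hH.vanish hG hL (by omega) k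
  have : Mono a := (Triangle.mor₃_eq_zero_iff_mono₁ _ hT').1 rfl
  obtain ⟨s, hs⟩ := dist_lift₃ hT' (𝟙 G) (by simp)
  obtain ⟨r, hr⟩ := dist_lift₂ hT' (𝟙 C - b ≫ s) (by
    rw [Preadditive.sub_comp, Category.assoc, ← hs]; simp)
  have hsr : s ≫ r = 0 := by
    rw [← cancel_mono a, Category.assoc, ← hr, Preadditive.comp_sub, ← Category.assoc s b, ← hs]
    simp
  have har : a ≫ r = 𝟙 L := by
    rw [← cancel_mono a, Category.assoc, ← hr, Preadditive.comp_sub, ← Category.assoc a b,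
      dist_comp₁₂ hT']
    simp
  -- The projector of `C` onto `G` lifts to an endomorphism `g` of `N`, because `Hom(N, M[1]) = 0`.
  -- If `g = 0`, the cokernel vanishes. If `g` is invertible, `c` vanishes on the component `L`,
  -- which becomes a retract of the brick `M[1]`. Then either `L = 0`, or `L` is all of `M[1]` and
  -- `f = 0`.
  obtain ⟨g, hg⟩ := dist_lift₃ hT (c ≫ b ≫ s) (hv _)
  obtain rfl | hg' := bN g
  · have hcb : c ≫ b = 0 := by
      rw [← Category.comp_id (c ≫ b), hs, ← Category.assoc, Category.assoc c b s, hg]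
      simp
    have hb0 : b = 0 := dist_eq_zero_of_comp₂ hT (mem_vanish hM hG' (by omega)) hcb
    have hG0 : IsZero G := by rw [IsZero.iff_id_eq_zero, hs, hb0, comp_zero]
    obtain ⟨e⟩ := hE'.isoOfIsZeroRight hG0
    refine ⟨L⟦(-1 : ℤ)⟧, ⟨(le_shift_iff (n := -1) (by omega)).2 hL,
      (ge_shift_iff (n := -1) (by omega)).2 hL'⟩, .inl ?_⟩
    exact (hE.of_iso (Iso.refl _) (Iso.refl _) e.symm).invRotate
  · have hcr : c ≫ r = 0 := by
      have : g ≫ c ≫ r = 0 := by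
        rw [← Category.assoc, ← hg]
        simp [hsr]
      rwa [Preadditive.IsIso.comp_left_eq_zero] at this
    obtain ⟨t, ht⟩ := dist_desc₃ hT r hcr
    have hat : (a ≫ z) ≫ t = 𝟙 L := by rw [Category.assoc, ← ht, har]
    obtain h0 | h0 := bM.shift 1 (t ≫ a ≫ z)
    · have hL0 : IsZero L := by
        rw [IsZero.iff_id_eq_zero, ← Category.id_comp (𝟙 L), ← hat]
        rw [Category.assoc _ t, ← Category.assoc t, h0]
        simp
      obtain ⟨e⟩ := hE'.isoOfIsZeroLeft hL0
      exact ⟨G, hG', .inr (hE.of_iso (Iso.refl _) (Iso.refl _) e)⟩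
    · have : (t ≫ a ≫ z) ≫ f⟦(1 : ℤ)⟧' = 0 := by
        have : z ≫ f⟦(1 : ℤ)⟧' = 0 := comp_distTriang_mor_zero₃₁ _ hT
        simp [this]
      rw [Preadditive.IsIso.comp_left_eq_zero] at this
      refine (hf ((shiftFunctor D (1 : ℤ)).map_injective ?_)).elim
      rw [this, Functor.map_zero]

end BddHeart

/-- A family of simple objects that can be ordered into an exceptional sequence. -/
structure ExceptionalFamily (S : ι → D) : Prop extends SimpleMinded S where
  rigid : ∀ i m, 0 < m → HomVanish (S i) (S i) m
  exists_rank : ∃ r : ι → ℤ, ∀ i j m, i ≠ j → ¬ HomVanish (S i) (S j) m → r i < r j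

namespace ExceptionalFamily

variable {H : BddHeart D} (hH : H.Hereditary) (hS : ExceptionalFamily S) {d : ι → ℤ}
  (hd : ∀ i, (H.shift (d i)).mem (S i))

include hS

lemma vanish_self {i : ι} {m : ℤ} (hm : m ≠ 0) : HomVanish (S i) (S i) m := by
  obtain h | h := lt_or_gt_of_ne hm
  · exact hS.hom_neg _ _ _ h
  · exact hS.rigid _ _ h

lemma pos {i j : ι} (hij : i ≠ j) {m : ℤ} (h : ¬ HomVanish (S i) (S j) m) : 1 ≤ m := by
  by_contra hm
  obtain rfl | hm := (show m ≤ 0 by omega).eq_or_lt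
  · exact h (hS.hom_ne _ _ hij)
  · exact h (hS.hom_neg _ _ _ hm)

lemma vanish_symm {i j : ι} (hij : i ≠ j) {m : ℤ} (h : ¬ HomVanish (S i) (S j) m) (n : ℤ) :
    HomVanish (S j) (S i) n := by
  obtain ⟨r, hr⟩ := hS.exists_rank
  by_contra h'
  have := hr _ _ _ hij h
  have := hr _ _ _ hij.symm h'
  omega

include hd

omit hS in
lemma mem_shift (i : ι) : H.mem ((S i)⟦-d i⟧) := by
  obtain ⟨h1, h2⟩ := BddHeart.shift_mem_iff.1 (hd i)
  exact ⟨(BddHeart.le_shift_iff (n := -d i) (by omega)).2 h1,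
    (BddHeart.ge_shift_iff (n := -d i) (by omega)).2 h2⟩

omit hS hd in
lemma vanish_shift_iff {X Y : D} {a b m n : ℤ} (hn : n = m + a - b) :
    HomVanish (X⟦-a⟧) (Y⟦-b⟧) m ↔ HomVanish X Y n := by
  rw [HomVanish.shift_left (n := m + a) (by omega), HomVanish.shift_right (n := n) (by omega)]

include hH

omit hS in
lemma degree_of_not_vanish {i j : ι} {m : ℤ} (h : ¬ HomVanish (S i) (S j) m) :
    m = d i - d j ∨ m = d i - d j + 1 := by
  rw [← vanish_shift_iff (a := d i) (b := d j) (m := m - d i + d j) (by omega)] at h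
  by_contra hm
  push Not at hm
  apply h
  obtain h1 | h1 : m - d i + d j < 0 ∨ 2 ≤ m - d i + d j := by omega
  · exact BddHeart.mem_vanish (mem_shift hd i) (mem_shift hd j) h1
  · exact hH _ _ _ (mem_shift hd i) (mem_shift hd j) h1

/-- A nonzero graded Hom between distinct members has `1 ≤ m ≤ d i - d j + 1`. -/
lemma degree_le {i j : ι} (hij : i ≠ j) {m : ℤ} (h : ¬ HomVanish (S i) (S j) m) : d j ≤ d i := by
  have h1 := hS.pos hij h
  have h2 := degree_of_not_vanish hH hd h
  omega

/-- A nonzero morphism between shifts of two members of the family is a monomorphism or an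
epimorphism in the hereditary heart, hence induces surjections on extensions. -/
lemma ext_surjective {i j : ι} (hij : i ≠ j) (h : ¬ HomVanish (S i) (S j) (d i - d j)) :
    (∀ l, HomVanish (S l) (S i) (1 + d l - d i) → HomVanish (S l) (S j) (1 + d l - d j)) ∨
      (∀ l, HomVanish (S j) (S l) (1 + d j - d l) → HomVanish (S i) (S l) (1 + d i - d l)) := by
  have h' := h
  rw [← vanish_shift_iff (a := d i) (b := d j) (m := 0) (by omega), HomVanish.zero_iff] at h'
  push Not at h'
  obtain ⟨f, hf⟩ := h'
  have hb : ∀ i, IsBrick ((S i)⟦-d i⟧) := fun i => IsBrick.shift (hS.brick i) _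
  obtain ⟨K, hK, hE | hE⟩ := hH.mono_or_epi (mem_shift hd i) (mem_shift hd j) (hb i) (hb j)
    ((vanish_shift_iff rfl).2 (hS.vanish_symm hij h _)) hf
  · left
    intro l hl
    rw [← vanish_shift_iff (a := d l) (b := d i) (m := 1) (by omega)] at hl
    rw [← vanish_shift_iff (a := d l) (b := d j) (m := 1) (by omega)]
    exact hE.coyoneda_vanish₃ (hH _ _ 2 (mem_shift hd l) hK le_rfl) hl
  · right
    intro l hl
    rw [← vanish_shift_iff (a := d j) (b := d l) (m := 1) (by omega)] at hl
    rw [← vanish_shift_iff (a := d i) (b := d l) (m := 1) (by omega)]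
    exact hE.vanish₁ (hH _ _ 2 hK (mem_shift hd l) le_rfl) hl

/-- Let `M i` be the shift of `S i` into the hereditary heart. If the Homs lived in two degrees, a
nonzero `M i ⟶ M j` would be mono or epi, so that `Ext¹(M j, M j)` or `Ext¹(M i, M i)`, both zero,
would surject onto `Ext¹(M i, M j) ≠ 0`. -/
lemma concentrated {i j : ι} (hij : i ≠ j) {m m' : ℤ} (h : ¬ HomVanish (S i) (S j) m)
    (h' : ¬ HomVanish (S i) (S j) m') : m = m' := by
  have key : ¬ (¬ HomVanish (S i) (S j) (d i - d j) ∧ ¬ HomVanish (S i) (S j) (d i - d j + 1)) := by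
    rintro ⟨h1, h2⟩
    obtain h3 | h3 := ext_surjective hH hS hd hij h1
    · apply h2
      rw [show d i - d j + 1 = 1 + d i - d j by omega]
      exact h3 i (hS.vanish_self (by omega))
    · apply h2
      rw [show d i - d j + 1 = 1 + d i - d j by omega]
      exact h3 j (hS.vanish_self (by omega))
  obtain h1 | h1 := degree_of_not_vanish hH hd h <;>
    obtain h2 | h2 := degree_of_not_vanish hH hd h' <;> subst h1 <;> subst h2
  · rfl
  · exact (key ⟨h, h'⟩).elim
  · exact (key ⟨h', h⟩).elim
  · rfl

omit hH hd hS in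
/-- There is a nonzero morphism from `S i` to a shift of `S j`. -/
def Arrow (S : ι → D) (i j : ι) : Prop := i ≠ j ∧ ∃ m, ¬ HomVanish (S i) (S j) m

omit hH hd hS in
lemma rank_le {r : ι → ℤ} (hr : ∀ i j m, i ≠ j → ¬ HomVanish (S i) (S j) m → r i < r j) {a b : ι}
    (h : Relation.ReflTransGen (Arrow S) a b) : r a ≤ r b := by
  induction h with
  | refl => exact le_rfl
  | tail _ h ih =>
    obtain ⟨h1, m, h2⟩ := h
    exact ih.trans (hr _ _ _ h1 h2).le

lemma degree_le_of_path {a b : ι} (h : Relation.ReflTransGen (Arrow S) a b) : d b ≤ d a := by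
  induction h with
  | refl => exact le_rfl
  | tail _ h ih =>
    obtain ⟨h1, m, h2⟩ := h
    exact (degree_le hH hS hd h1 h2).trans ih

/-- After forward mutation at `p` there may be nonzero Homs from an unmutated `b` with `Hom^m(S b, S
p) ≠ 0`, `m ≥ 2`, to the mutated members. This lemma prevents them from closing a cycle with the old
ones. -/
lemma no_path_forward {p a b : ι} (ha : a ≠ p) (hb : b ≠ p) (ha1 : ¬ HomVanish (S a) (S p) 1)
    {m : ℤ} (hm : 2 ≤ m) (hb1 : ¬ HomVanish (S b) (S p) m) :
    ¬ Relation.ReflTransGen (Arrow S) a b := by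
  intro hab
  obtain ⟨r, hr⟩ := hS.exists_rank
  have hrab := rank_le hr hab
  have hdab := degree_le_of_path hH hS hd hab
  have hda := degree_of_not_vanish hH hd ha1
  have hdb := degree_of_not_vanish hH hd hb1
  have hrb := hr _ _ _ hb hb1
  have e1 : d a = d p + 1 := by omega
  have e2 : d b = d p + 1 := by omega
  have e3 : m = 2 := by omega
  subst e3
  obtain h3 | h3 := ext_surjective hH hS hd ha
    (by rwa [show d a - d p = 1 by omega])
  · apply hb1
    rw [show (2 : ℤ) = 1 + d b - d p by omega]
    apply h3
    by_cases hba : b = a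
    · subst hba
      exact hS.vanish_self (by omega)
    · by_contra h4
      have := hr _ _ _ hba h4
      omega
  · obtain rfl | ⟨x, hax, hxb⟩ := hab.cases_head
    · exact absurd (concentrated hH hS hd ha ha1 hb1) (by omega)
    · have hrxb := rank_le hr hxb
      have h5 := degree_le_of_path hH hS hd hxb
      obtain ⟨h6, n, h7⟩ := hax
      have h8 := degree_le hH hS hd h6 h7
      have h9 := degree_of_not_vanish hH hd h7
      have h10 := hS.pos h6 h7
      have h11 : n = 1 + d a - d x := by omega
      subst h11
      have h12 := mt (h3 x) h7
      have : p ≠ x := by rintro rfl; omega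
      have := hr _ _ _ this h12
      omega

lemma no_path_backward {p a b : ι} (ha : p ≠ a) (hb : p ≠ b) (ha1 : ¬ HomVanish (S p) (S a) 1)
    {m : ℤ} (hm : 2 ≤ m) (hb1 : ¬ HomVanish (S p) (S b) m) :
    ¬ Relation.ReflTransGen (Arrow S) b a := by
  intro hab
  obtain ⟨r, hr⟩ := hS.exists_rank
  have hrab := rank_le hr hab
  have hdab := degree_le_of_path hH hS hd hab
  have hda := degree_of_not_vanish hH hd ha1
  have hdb := degree_of_not_vanish hH hd hb1
  have hrb := hr _ _ _ hb hb1
  have e1 : d p = d a + 1 := by omega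
  have e2 : d p = d b + 1 := by omega
  have e3 : m = 2 := by omega
  subst e3
  -- Dual to the forward case: an epi is treated with the last step `x → a` of the path, which would
  -- give `r b ≤ r x < r p < r b`. A mono would make `Ext¹` from `p` to `b` a quotient of the zero
  -- space `Ext¹` from `a` to `b`.
  obtain h3 | h3 := ext_surjective hH hS hd ha
    (by rwa [show d p - d a = 1 by omega])
  · obtain rfl | ⟨x, hbx, hxa⟩ := hab.cases_tail
    · exact absurd (concentrated hH hS hd ha ha1 hb1) (by omega)
    · have hrbx := rank_le hr hbx
      have h5 := degree_le_of_path hH hS hd hbx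
      obtain ⟨h6, n, h7⟩ := hxa
      have h8 := degree_le hH hS hd h6 h7
      have h9 := degree_of_not_vanish hH hd h7
      have h10 := hS.pos h6 h7
      have h11 : n = 1 + d x - d a := by omega
      subst h11
      have h12 := mt (h3 x) h7
      have : x ≠ p := by rintro rfl; omega
      have := hr _ _ _ this h12
      omega
  · apply hb1
    rw [show (2 : ℤ) = 1 + d p - d b by omega]
    apply h3
    by_cases hba : a = b
    · subst hba
      exact hS.vanish_self (by omega)
    · by_contra h4
      have := hr _ _ _ hba h4
      omega

end ExceptionalFamily

end HereditaryHearts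

/-! ### Universal extensions and mutation of exceptional families. -/

section Mutation

open ZeroObject

variable {D : Type u} [Category.{v} D] [Preadditive D] [HasZeroObject D] [HasShift D ℤ]
  [∀ n : ℤ, (shiftFunctor D n).Additive] [Pretriangulated D] [IsTriangulated D] {ι : Type v'}
  {S S' : ι → D}

lemma finrank_lt_of_surjective {k V W : Type*} [Field k] [AddCommGroup V] [Module k V]
    [AddCommGroup W] [Module k W] [Module.Finite k V] {φ : V →ₗ[k] W}
    (hφ : Function.Surjective φ) {x : V} (hx : x ≠ 0) (h : φ x = 0) :
    Module.finrank k W < Module.finrank k V := by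
  have h1 := φ.finrank_range_add_finrank_ker
  rw [LinearMap.range_eq_top.2 hφ, finrank_top] at h1
  have h2 : 0 < Module.finrank k φ.ker :=
    Module.finrank_pos_iff_exists_ne_zero.2 ⟨⟨x, h⟩, by simpa [Subtype.ext_iff] using hx⟩
  omega

section UniversalExtension

variable {k : Type u'} [Field k] [Linear k D] (hfin : ∀ X Y : D, Module.Finite k (X ⟶ Y))
include hfin

/-- The universal extension of `X` by the rigid brick `B`. -/
lemma exists_universal_extension {B : D} (hB : IsBrick B) (hr : HomVanish B B 1) (X : D)
    (hX : HomVanish X B 0) : ∃ F X', IsExt F X' X ∧ ExtGenerated B F ∧ HomVanish X' B 0 ∧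
      HomVanish X' B 1 := by
  induction hn : Module.finrank k (X ⟶ B⟦(1 : ℤ)⟧) using Nat.strong_induction_on generalizing X
    with
  | _ n ih =>
    by_cases hv : HomVanish X B 1
    · exact ⟨0, X, IsExt.zero_id X (isZero_zero D), .zero (isZero_zero D), hX, hv⟩
    · simp only [HomVanish, not_forall] at hv
      obtain ⟨ξ, hξ⟩ := hv
      -- One copy of `B` is glued along one nonzero class `ξ`. A map `X₁ ⟶ B` invertible on that
      -- copy would split the extension, so `Hom(X₁, B)` stays zero. No assumption on the size of
      -- `End B` is needed.
      obtain ⟨X₁, f, g, hT⟩ := distinguished_cocone_triangle₂ ξ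
      have h1 : HomVanish X₁ B 0 := by
        rw [HomVanish.zero_iff]
        intro u
        obtain h0 | h0 := hB (f ≫ u)
        · obtain ⟨y, rfl⟩ := dist_desc₂ hT u h0
          rw [HomVanish.zero_iff.1 hX y, comp_zero]
        · have : ξ ≫ (f ≫ u)⟦(1 : ℤ)⟧' = 0 := by
            have : ξ ≫ f⟦(1 : ℤ)⟧' = 0 := comp_distTriang_mor_zero₃₁ _ hT
            rw [Functor.map_comp, reassoc_of% this, zero_comp]
          rw [Preadditive.IsIso.comp_right_eq_zero] at this
          exact (hξ this).elim
      -- `Hom(X, B[1]) ⟶ Hom(X₁, B[1])` is onto because `Hom(B, B[1]) = 0`, and it kills `ξ`.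
      have h2 : Module.finrank k (X₁ ⟶ B⟦(1 : ℤ)⟧) < n := by
        have := hfin X (B⟦(1 : ℤ)⟧)
        rw [← hn]
        refine finrank_lt_of_surjective (φ := Linear.leftComp k (B⟦(1 : ℤ)⟧) g) ?_ hξ
          (dist_comp₂₃ hT)
        intro x
        obtain ⟨y, hy⟩ := dist_desc₂ hT x (hr _)
        exact ⟨y, hy.symm⟩
      obtain ⟨F, X', hE, hF, h3, h4⟩ := ih _ h2 X₁ h1 rfl
      obtain ⟨E, h5, h6⟩ := hE.exists_pullback (.of_dist hT)
      exact ⟨E, X', h6, .of_ext h5 hF (.base (Iso.refl _)), h3, h4⟩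

/-- The universal coextension of `X` by the rigid brick `B`. -/
lemma exists_universal_coextension {B : D} (hB : IsBrick B) (hr : HomVanish B B 1) (X : D)
    (hX : HomVanish B X 0) : ∃ F X', IsExt X X' F ∧ ExtGenerated B F ∧ HomVanish B X' 0 ∧
      HomVanish B X' 1 := by
  induction hn : Module.finrank k (B ⟶ X⟦(1 : ℤ)⟧) using Nat.strong_induction_on generalizing X
    with
  | _ n ih =>
    by_cases hv : HomVanish B X 1
    · exact ⟨0, X, IsExt.id_zero X (isZero_zero D), .zero (isZero_zero D), hX, hv⟩
    · simp only [HomVanish, not_forall] at hv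
      obtain ⟨ξ, hξ⟩ := hv
      obtain ⟨X₁, f, g, hT⟩ := distinguished_cocone_triangle₂ ξ
      have h1 : HomVanish B X₁ 0 := by
        rw [HomVanish.zero_iff]
        intro u
        obtain h0 | h0 := hB (u ≫ g)
        · obtain ⟨y, rfl⟩ := dist_lift₂ hT u h0
          rw [HomVanish.zero_iff.1 hX y, zero_comp]
        · have : (u ≫ g) ≫ ξ = 0 := by rw [Category.assoc, dist_comp₂₃ hT, comp_zero]
          rw [Preadditive.IsIso.comp_left_eq_zero] at this
          exact (hξ this).elim
      have h2 : Module.finrank k (B ⟶ X₁⟦(1 : ℤ)⟧) < n := by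
        have := hfin B (X⟦(1 : ℤ)⟧)
        rw [← hn]
        refine finrank_lt_of_surjective (φ := Linear.rightComp k B (f⟦(1 : ℤ)⟧')) ?_ hξ
          (comp_distTriang_mor_zero₃₁ _ hT)
        intro x
        obtain ⟨y, hy⟩ := dist_lift₂ (rot_of_distTriang _ (rot_of_distTriang _
          (rot_of_distTriang _ hT))) x (hr _)
        refine ⟨-y, ?_⟩
        rw [hy]
        exact (Preadditive.neg_comp _ _).trans (Preadditive.comp_neg _ _).symm
      obtain ⟨F, X', hE, hF, h3, h4⟩ := ih _ h2 X₁ h1 rfl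
      obtain ⟨E, h5, h6⟩ := hE.exists_pushout (.of_dist hT)
      exact ⟨E, X', h6, .of_ext h5 (.base (Iso.refl _)) hF, h3, h4⟩

end UniversalExtension

/-- Endomorphisms of `X'` descend to `X` since `Hom(F, X) = 0`, faithfully since `Hom(X', F) = 0`;
the inverse of an automorphism of `X` lifts since `Hom(X', F[1]) = 0`. -/
lemma IsBrick.of_extension {F X X' : D} (hX : IsBrick X) (h : IsExt F X' X)
    (h1 : HomVanish F X 0) (h2 : HomVanish X' F 0) (h3 : HomVanish X' F 1) : IsBrick X' := by
  obtain ⟨i, q, e, hT⟩ := h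
  rw [HomVanish.zero_iff] at h1 h2
  have key : ∀ x : X' ⟶ X', x ≫ q = 0 → x = 0 := by
    intro x hx
    obtain ⟨y, rfl⟩ := dist_lift₂ hT x hx
    rw [h2 y, zero_comp]
  intro f
  obtain ⟨g, hg⟩ := dist_desc₂ hT (f ≫ q) (h1 _)
  obtain rfl | h0 := hX g
  · exact .inl (key f (by rw [hg, comp_zero]))
  · obtain ⟨f', hf'⟩ := dist_lift₃ hT (q ≫ inv g) (h3 _)
    refine .inr ⟨f', ?_, ?_⟩
    · rw [← sub_eq_zero]
      apply key
      rw [Preadditive.sub_comp, Category.assoc, ← hf', reassoc_of% hg]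
      simp
    · rw [← sub_eq_zero]
      apply key
      rw [Preadditive.sub_comp, Category.assoc, hg, ← reassoc_of% hf']
      simp

lemma IsBrick.of_coextension {F X X' : D} (hX : IsBrick X) (h : IsExt X X' F)
    (h1 : HomVanish X F 0) (h2 : HomVanish F X' 0) (h3 : HomVanish F X' 1) : IsBrick X' := by
  obtain ⟨i, q, e, hT⟩ := h
  rw [HomVanish.zero_iff] at h1 h2
  have h3' := HomVanish.zero_iff.1 ((HomVanish.shift_left (a := -1) (m := 0) (by omega)).2 h3)
  have key : ∀ x : X' ⟶ X', i ≫ x = 0 → x = 0 := by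
    intro x hx
    obtain ⟨y, rfl⟩ := dist_desc₂ hT x hx
    rw [h2 y, comp_zero]
  intro f
  obtain ⟨g, hg⟩ := dist_lift₂ hT (i ≫ f) (h1 _)
  obtain rfl | h0 := hX g
  · exact .inl (key f (by rw [hg, zero_comp]))
  · obtain ⟨f' : X' ⟶ X', hf' : inv g ≫ i = i ≫ f'⟩ :=
      dist_desc₂ (inv_rot_of_distTriang _ hT) (show X ⟶ X' from inv g ≫ i) (h3' _)
    refine .inr ⟨f', ?_, ?_⟩
    · rw [← sub_eq_zero]
      apply key
      rw [Preadditive.comp_sub, reassoc_of% hg, ← hf']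
      simp
    · rw [← sub_eq_zero]
      apply key
      rw [Preadditive.comp_sub, ← reassoc_of% hf', hg]
      simp

namespace ExceptionalFamily

variable {H : BddHeart D} (hH : H.Hereditary) (hS : ExceptionalFamily S) {d : ι → ℤ}
  (hd : ∀ i, (H.shift (d i)).mem (S i))

/-- `S'` is obtained from `S` by the forward mutation at `p`. -/
structure IsForwardMutation (S : ι → D) (p : ι) (S' : ι → D) : Prop where
  shift : S' p = (S p)⟦(1 : ℤ)⟧
  eq : ∀ i, i ≠ p → HomVanish (S i) (S p) 1 → S' i = S i
  ext : ∀ i, i ≠ p → ¬ HomVanish (S i) (S p) 1 → ∃ F, IsExt F (S' i) (S i) ∧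
    ExtGenerated (S p) F ∧ HomVanish (S' i) (S p) 0 ∧ HomVanish (S' i) (S p) 1

/-- `S'` is obtained from `S` by the backward mutation at `p`. -/
structure IsBackwardMutation (S : ι → D) (p : ι) (S' : ι → D) : Prop where
  shift : S' p = (S p)⟦(-1 : ℤ)⟧
  eq : ∀ i, i ≠ p → HomVanish (S p) (S i) 1 → S' i = S i
  ext : ∀ i, i ≠ p → ¬ HomVanish (S p) (S i) 1 → ∃ F, IsExt (S i) (S' i) F ∧
    ExtGenerated (S p) F ∧ HomVanish (S p) (S' i) 0 ∧ HomVanish (S p) (S' i) 1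

include hS in
lemma exists_isForwardMutation {k : Type u'} [Field k] [Linear k D]
    (hfin : ∀ X Y : D, Module.Finite k (X ⟶ Y)) (p : ι) : ∃ S', IsForwardMutation S p S' := by
  classical
  have : ∀ i, ∃ X', (i = p → X' = (S p)⟦(1 : ℤ)⟧) ∧
      (i ≠ p → HomVanish (S i) (S p) 1 → X' = S i) ∧
      (i ≠ p → ¬ HomVanish (S i) (S p) 1 → ∃ F, IsExt F X' (S i) ∧
        ExtGenerated (S p) F ∧ HomVanish X' (S p) 0 ∧ HomVanish X' (S p) 1) := by
    intro i
    by_cases hi : i = p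
    · exact ⟨_, fun _ => rfl, fun h => (h hi).elim, fun h => (h hi).elim⟩
    by_cases hv : HomVanish (S i) (S p) 1
    · exact ⟨_, fun h => (hi h).elim, fun _ _ => rfl, fun _ h => (h hv).elim⟩
    obtain ⟨F, X', h⟩ := exists_universal_extension hfin (hS.brick p) (hS.vanish_self (by omega))
      (S i) (hS.hom_ne _ _ hi)
    exact ⟨X', fun h => (hi h).elim, fun _ h => (hv h).elim, fun _ _ => ⟨F, h⟩⟩
  choose S' h1 h2 h3 using this
  exact ⟨S', h1 p rfl, h2, h3⟩

include hS in
lemma exists_isBackwardMutation {k : Type u'} [Field k] [Linear k D]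
    (hfin : ∀ X Y : D, Module.Finite k (X ⟶ Y)) (p : ι) : ∃ S', IsBackwardMutation S p S' := by
  classical
  have : ∀ i, ∃ X', (i = p → X' = (S p)⟦(-1 : ℤ)⟧) ∧
      (i ≠ p → HomVanish (S p) (S i) 1 → X' = S i) ∧
      (i ≠ p → ¬ HomVanish (S p) (S i) 1 → ∃ F, IsExt (S i) X' F ∧
        ExtGenerated (S p) F ∧ HomVanish (S p) X' 0 ∧ HomVanish (S p) X' 1) := by
    intro i
    by_cases hi : i = p
    · exact ⟨_, fun _ => rfl, fun h => (h hi).elim, fun h => (h hi).elim⟩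
    by_cases hv : HomVanish (S p) (S i) 1
    · exact ⟨_, fun h => (hi h).elim, fun _ _ => rfl, fun _ h => (h hv).elim⟩
    obtain ⟨F, X', h⟩ := exists_universal_coextension hfin (hS.brick p)
      (hS.vanish_self (by omega)) (S i) (hS.hom_ne _ _ (Ne.symm hi))
    exact ⟨X', fun h => (hi h).elim, fun _ h => (hv h).elim, fun _ _ => ⟨F, h⟩⟩
  choose S' h1 h2 h3 using this
  exact ⟨S', h1 p rfl, h2, h3⟩

/-! ### Forward mutation yields an exceptional family, namely the simples of the forward tilt. -/

namespace IsForwardMutation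

variable {p : ι} (h : IsForwardMutation S p S')
include hH hS hd h

/-- The universal extension takes care of degrees `0` and `1`; in all other degrees `Hom^m(S i, S
p)` vanishes by `concentrated`. -/
lemma vanish_p {i : ι} (hi : i ≠ p) (hv : ¬ HomVanish (S i) (S p) 1) (m : ℤ) :
    HomVanish (S' i) (S p) m := by
  obtain ⟨F, hE, hF, h0, h1⟩ := h.ext i hi hv
  by_cases hm0 : m = 0
  · rwa [hm0]
  by_cases hm1 : m = 1
  · rwa [hm1]
  refine hE.vanish₂ (hF.vanish_left (hS.vanish_self hm0)) ?_
  by_contra h'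
  exact hm1 (hS.concentrated hH hd hi h' hv)

lemma vanish_self (i : ι) {m : ℤ} (hm : m ≠ 0) : HomVanish (S' i) (S' i) m := by
  by_cases hi : i = p
  · rw [hi, h.shift]
    exact (hS.vanish_self hm).shift_shift
  by_cases hv : HomVanish (S i) (S p) 1
  · rw [h.eq i hi hv]
    exact hS.vanish_self hm
  obtain ⟨F, hE, hF, h0, h1⟩ := h.ext i hi hv
  exact hE.coyoneda_vanish₂ (hF.vanish_right (h.vanish_p hH hS hd hi hv m))
    (hE.vanish₂ (hF.vanish_left (hS.vanish_symm hi hv m)) (hS.vanish_self hm))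

omit h hH hd in
lemma left_of_ne {i j : ι} (h : IsForwardMutation S p S') (hi : i ≠ p) {m : ℤ}
    (hm : ¬ HomVanish (S' i) (S j) m) :
    ¬ HomVanish (S i) (S j) m ∨ (¬ HomVanish (S i) (S p) 1 ∧ ¬ HomVanish (S p) (S j) m) := by
  by_cases hv : HomVanish (S i) (S p) 1
  · rw [h.eq i hi hv] at hm
    exact .inl hm
  · obtain ⟨F, hE, hF, -⟩ := h.ext i hi hv
    by_contra! hc
    exact hm (hE.vanish₂ (hF.vanish_left (hc.2 hv)) hc.1)

/-- The long exact sequences of the two universal extensions leave three origins: an old Hom, an old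
composable pair through `p`, or a genuinely new one. The last starts at an unmutated `i` with
`Hom^m(S i, S p) ≠ 0` and ends at a mutated `j`. -/
lemma cases_of_ne {i j : ι} (hi : i ≠ p) (hj : j ≠ p) {m : ℤ}
    (hm : ¬ HomVanish (S' i) (S' j) m) :
    ¬ HomVanish (S i) (S j) m ∨ (¬ HomVanish (S i) (S p) 1 ∧ ¬ HomVanish (S p) (S j) m) ∨
      (HomVanish (S i) (S p) 1 ∧ ¬ HomVanish (S j) (S p) 1 ∧ ¬ HomVanish (S i) (S p) m) := by
  by_cases hv : HomVanish (S j) (S p) 1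
  · rw [h.eq j hj hv] at hm
    have := h.left_of_ne hS hi hm
    tauto
  · obtain ⟨F, hE, hF, -⟩ := h.ext j hj hv
    by_cases h2 : HomVanish (S' i) F m
    · have := h.left_of_ne hS hi fun h3 => hm (hE.coyoneda_vanish₂ h2 h3)
      tauto
    · have h3 : HomVanish (S i) (S p) 1 := by
        by_contra h3
        exact h2 (hF.vanish_right (h.vanish_p hH hS hd hi h3 m))
      rw [h.eq i hi h3] at h2
      exact .inr (.inr ⟨h3, hv, fun h4 => h2 (hF.vanish_right h4)⟩)

lemma cases_right {i : ι} (hi : i ≠ p) {m : ℤ} (hm : ¬ HomVanish (S' i) (S' p) m) :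
    HomVanish (S i) (S p) 1 ∧ ¬ HomVanish (S i) (S p) (m + 1) := by
  rw [h.shift, HomVanish.shift_right (n := m + 1) (by omega)] at hm
  by_cases hv : HomVanish (S i) (S p) 1
  · rw [h.eq i hi hv] at hm
    exact ⟨hv, hm⟩
  · exact (hm (h.vanish_p hH hS hd hi hv _)).elim

/-- For a mutated `j` there are no Homs from `S p` to `S j`, so only the part `F ∈ ⟨S p⟩` of `S' j`
counts; rigidity of `S p` then leaves `m = 1`. -/
lemma cases_left {j : ι} (hj : j ≠ p) {m : ℤ} (hm : ¬ HomVanish (S' p) (S' j) m) :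
    (¬ HomVanish (S j) (S p) 1 ∧ m = 1) ∨ ¬ HomVanish (S p) (S j) (m - 1) := by
  rw [h.shift, HomVanish.shift_left (n := m - 1) (by omega)] at hm
  by_cases hv : HomVanish (S j) (S p) 1
  · rw [h.eq j hj hv] at hm
    exact .inr hm
  · left
    refine ⟨hv, ?_⟩
    by_contra hm1
    obtain ⟨F, hE, hF, -⟩ := h.ext j hj hv
    exact hm (hE.coyoneda_vanish₂ (hF.vanish_right (hS.vanish_self (by omega)))
      (hS.vanish_symm hj hv _))

lemma vanish_of_nonpos {i j : ι} (hij : i ≠ j) {m : ℤ} (hm : m ≤ 0) :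
    HomVanish (S' i) (S' j) m := by
  by_contra hv
  by_cases hi : i = p
  · subst hi
    obtain ⟨-, h1⟩ | h1 := h.cases_left hH hS hd hij.symm hv
    · omega
    · have := hS.pos hij h1
      omega
  by_cases hj : j = p
  · subst hj
    obtain ⟨h1, h2⟩ := h.cases_right hH hS hd hi hv
    have := hS.pos hij h2
    -- In degree zero, `Hom(S i, S p[1])` is what remains, and it vanishes exactly because `i` was
    -- not mutated.
    obtain rfl : m = 0 := by omega
    exact h2 h1
  obtain h1 | ⟨-, h1⟩ | ⟨-, -, h1⟩ := h.cases_of_ne hH hS hd hi hj hv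
  · have := hS.pos hij h1
    omega
  · have := hS.pos (Ne.symm hj) h1
    omega
  · have := hS.pos hi h1
    omega

/-- Rotating the universal extension writes `S i` as an extension of `F[1]`, filtered by copies of
`S' p`, by `S' i`. So the mutated family still generates. -/
lemma filt (i : ι) : Filt (shiftsOf S' Set.univ) (S i) := by
  have base : ∀ {X : D} (i : ι) (m : ℤ), (X ≅ (S' i)⟦m⟧) → Filt (shiftsOf S' Set.univ) X :=
    fun i m e => .base ⟨i, m, trivial, ⟨e⟩⟩
  by_cases hi : i = p
  · refine base p (-1) ?_
    rw [h.shift, hi]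
    exact (shiftEquiv D (1 : ℤ)).unitIso.app (S p)
  by_cases hv : HomVanish (S i) (S p) 1
  · refine base i 0 ?_
    rw [h.eq i hi hv]
    exact ((shiftFunctorZero D ℤ).app _).symm
  · obtain ⟨F, hE, hF, -⟩ := h.ext i hi hv
    refine .cons hE.rotate ⟨i, 0, trivial, ⟨((shiftFunctorZero D ℤ).app _).symm⟩⟩
      ((extGenerated_iff.1 hF).shift ?_)
    rintro X ⟨e⟩
    refine ⟨p, 0, trivial, ⟨?_⟩⟩
    rw [h.shift]
    exact (shiftFunctor D (1 : ℤ)).mapIso e ≪≫ ((shiftFunctorZero D ℤ).app _).symm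

lemma simpleMinded : SimpleMinded S' where
  not_isZero i hz := by
    by_cases hi : i = p
    · rw [hi, h.shift] at hz
      exact hS.not_isZero _ (HomVanish.isZero_of_shift hz)
    by_cases hv : HomVanish (S i) (S p) 1
    · rw [h.eq i hi hv] at hz
      exact hS.not_isZero _ hz
    · obtain ⟨F, hE, hF, -⟩ := h.ext i hi hv
      refine hS.not_isZero i (HomVanish.isZero_of_self (hE.vanish₃ (n := -1) ?_
        (.of_isZero_left hz)))
      exact hF.vanish_left (hS.vanish_symm hi hv _)
  hom_neg i j m hm := by
    by_cases hij : i = j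
    · subst hij
      exact h.vanish_self hH hS hd i hm.ne
    · exact h.vanish_of_nonpos hH hS hd hij hm.le
  hom_ne i j hij := h.vanish_of_nonpos hH hS hd hij le_rfl
  brick i := by
    change IsBrick (S' i)
    by_cases hi : i = p
    · rw [hi, h.shift]
      exact IsBrick.shift (hS.brick p) 1
    by_cases hv : HomVanish (S i) (S p) 1
    · rw [h.eq i hi hv]
      exact hS.brick i
    · obtain ⟨F, hE, hF, h0, h1⟩ := h.ext i hi hv
      exact IsBrick.of_extension (hS.brick i) hE (hF.vanish_left (hS.vanish_symm hi hv _))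
        (hF.vanish_right h0) (hF.vanish_right h1)
  gen A := (hS.gen A).bind fun X ⟨i, m, _, ⟨e⟩⟩ =>
    ((h.filt hH hS hd i).shiftsOf_shift (J := Set.univ) (a := m) (fun _ _ => trivial)).of_iso e.symm

lemma exceptionalFamily [Finite ι] : ExceptionalFamily S' where
  toSimpleMinded := h.simpleMinded hH hS hd
  rigid i m hm := h.vanish_self hH hS hd i hm.ne'
  exists_rank := by
    classical
    obtain ⟨r, hr⟩ := hS.exists_rank
    obtain ⟨M, hM⟩ : ∃ M : ℤ, ∀ i, |r i| ≤ M := by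
      obtain ⟨M, hM⟩ := (Set.finite_range fun i => |r i|).bddAbove
      exact ⟨M, fun i => hM ⟨i, rfl⟩⟩
    simp only [abs_le] at hM
    -- `U` is closed under the old arrows and contains `p` and the mutated indices. By
    -- `no_path_forward` it avoids the unmutated sources of arrows into `p`, so every new arrow
    -- points to `p` from outside `U`, or into `U`.
    let U : Set ι := {x | (∃ a, a ≠ p ∧ ¬ HomVanish (S a) (S p) 1 ∧
      Relation.ReflTransGen (Arrow S) a x) ∨ Relation.ReflTransGen (Arrow S) p x}
    have hU : ∀ {x y : ι} {m : ℤ}, x ≠ y → ¬ HomVanish (S x) (S y) m → x ∈ U → y ∈ U := by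
      rintro x y m hxy hv (⟨a, h1, h2, h3⟩ | h3)
      · exact .inl ⟨a, h1, h2, h3.tail ⟨hxy, m, hv⟩⟩
      · exact .inr (h3.tail ⟨hxy, m, hv⟩)
    have hUp : p ∈ U := .inr .refl
    have hUA : ∀ {x}, x ≠ p → ¬ HomVanish (S x) (S p) 1 → x ∈ U :=
      fun hx hv => .inl ⟨_, hx, hv, .refl⟩
    have hU' : ∀ {x : ι} {m : ℤ}, x ≠ p → HomVanish (S x) (S p) 1 → ¬ HomVanish (S x) (S p) m →
        x ∉ U := by
      rintro x m hx hv hm (⟨a, h1, h2, h3⟩ | h3)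
      · have hm1 := hS.pos hx hm
        refine hS.no_path_forward hH hd h1 hx h2 (m := m) ?_ hm h3
        by_contra hm2
        obtain rfl : m = 1 := by omega
        exact hm hv
      · have h4 := rank_le hr h3
        have h5 := hr _ _ _ hx hm
        omega
    -- As `|r| ≤ M`, the new rank puts everything outside `U` below `p`, and the rest of `U` above
    -- `p`; inside each block the old order is kept.
    refine ⟨fun x => if x = p then M + 1 else if x ∈ U then r x + 2 * M + 2 else r x, ?_⟩
    intro i j m hij hv
    have hMi := hM i
    have hMj := hM j
    dsimp only
    by_cases hi : i = p
    · subst hi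
      have hj : j ∈ U := by
        obtain ⟨h1, -⟩ | h1 := h.cases_left hH hS hd hij.symm hv
        · exact hUA hij.symm h1
        · exact hU hij h1 hUp
      rw [if_pos rfl, if_neg hij.symm, if_pos hj]
      omega
    by_cases hj : j = p
    · subst hj
      obtain ⟨h1, h2⟩ := h.cases_right hH hS hd hi hv
      rw [if_neg hi, if_pos rfl, if_neg (hU' hi h1 h2)]
      omega
    rw [if_neg hi, if_neg hj]
    have key : (r i < r j ∧ (i ∈ U → j ∈ U)) ∨ (i ∉ U ∧ j ∈ U) := by
      obtain h1 | ⟨h1, h2⟩ | ⟨h1, h2, h3⟩ := h.cases_of_ne hH hS hd hi hj hv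
      · exact .inl ⟨hr _ _ _ hij h1, hU hij h1⟩
      · exact .inl ⟨(hr _ _ _ hi h1).trans (hr _ _ _ (Ne.symm hj) h2),
          fun _ => hU (Ne.symm hj) h2 hUp⟩
      · exact .inr ⟨hU' hi h1 h3, hUA hj h2⟩
    split_ifs with h1 h2 h2
    · obtain ⟨h3, -⟩ | ⟨h3, -⟩ := key
      · omega
      · exact (h3 h1).elim
    · obtain ⟨-, h3⟩ | ⟨h3, -⟩ := key
      · exact (h2 (h3 h1)).elim
      · exact (h3 h1).elim
    · omega
    · obtain ⟨h3, -⟩ | ⟨-, h3⟩ := key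
      · omega
      · exact (h2 h3).elim

lemma isSimpleForwardTilt (hS' : SimpleMinded S') :
    hS.heart.IsSimpleForwardTilt (S p) hS'.heart := by
  refine hS.toSimpleMinded.isSimpleForwardTilt hS' (hS.vanish_self (by omega)) h.shift
    fun i hi => ?_
  by_cases hv : HomVanish (S i) (S p) 1
  · rw [h.eq i hi hv]
    exact ⟨hS.heart_mem i, hS.hom_ne _ _ hi⟩
  · obtain ⟨F, hE, hF, h0, -⟩ := h.ext i hi hv
    exact ⟨BddHeart.mem_ext hE (hF.mem (hS.heart_mem p)) (hS.heart_mem i), h0⟩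

end IsForwardMutation

/-! ### Backward mutation, by the dual arguments. -/

namespace IsBackwardMutation

variable {p : ι} (h : IsBackwardMutation S p S')
include hH hS hd h

lemma vanish_p {i : ι} (hi : i ≠ p) (hv : ¬ HomVanish (S p) (S i) 1) (m : ℤ) :
    HomVanish (S p) (S' i) m := by
  obtain ⟨F, hE, hF, h0, h1⟩ := h.ext i hi hv
  by_cases hm0 : m = 0
  · rwa [hm0]
  by_cases hm1 : m = 1
  · rwa [hm1]
  refine hE.coyoneda_vanish₂ ?_ (hF.vanish_right (hS.vanish_self hm0))
  by_contra h'
  exact hm1 (hS.concentrated hH hd (Ne.symm hi) h' hv)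

lemma vanish_self (i : ι) {m : ℤ} (hm : m ≠ 0) : HomVanish (S' i) (S' i) m := by
  by_cases hi : i = p
  · rw [hi, h.shift]
    exact (hS.vanish_self hm).shift_shift
  by_cases hv : HomVanish (S p) (S i) 1
  · rw [h.eq i hi hv]
    exact hS.vanish_self hm
  obtain ⟨F, hE, hF, h0, h1⟩ := h.ext i hi hv
  exact hE.vanish₂ (hE.coyoneda_vanish₂ (hS.vanish_self hm)
    (hF.vanish_right (hS.vanish_symm (Ne.symm hi) hv m)))
    (hF.vanish_left (h.vanish_p hH hS hd hi hv m))

omit h hH hd in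
lemma right_of_ne {i j : ι} (h : IsBackwardMutation S p S') (hj : j ≠ p) {m : ℤ}
    (hm : ¬ HomVanish (S i) (S' j) m) :
    ¬ HomVanish (S i) (S j) m ∨ (¬ HomVanish (S p) (S j) 1 ∧ ¬ HomVanish (S i) (S p) m) := by
  by_cases hv : HomVanish (S p) (S j) 1
  · rw [h.eq j hj hv] at hm
    exact .inl hm
  · obtain ⟨F, hE, hF, -⟩ := h.ext j hj hv
    by_contra! hc
    exact hm (hE.coyoneda_vanish₂ hc.1 (hF.vanish_right (hc.2 hv)))

lemma cases_of_ne {i j : ι} (hi : i ≠ p) (hj : j ≠ p) {m : ℤ}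
    (hm : ¬ HomVanish (S' i) (S' j) m) :
    ¬ HomVanish (S i) (S j) m ∨ (¬ HomVanish (S p) (S j) 1 ∧ ¬ HomVanish (S i) (S p) m) ∨
      (HomVanish (S p) (S j) 1 ∧ ¬ HomVanish (S p) (S i) 1 ∧ ¬ HomVanish (S p) (S j) m) := by
  by_cases hv : HomVanish (S p) (S i) 1
  · rw [h.eq i hi hv] at hm
    have := h.right_of_ne hS hj hm
    tauto
  · obtain ⟨F, hE, hF, -⟩ := h.ext i hi hv
    by_cases h2 : HomVanish F (S' j) m
    · have := h.right_of_ne hS hj fun h3 => hm (hE.vanish₂ h3 h2)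
      tauto
    · have h3 : HomVanish (S p) (S j) 1 := by
        by_contra h3
        exact h2 (hF.vanish_left (h.vanish_p hH hS hd hj h3 m))
      rw [h.eq j hj h3] at h2
      exact .inr (.inr ⟨h3, hv, fun h4 => h2 (hF.vanish_left h4)⟩)

lemma cases_left {j : ι} (hj : j ≠ p) {m : ℤ} (hm : ¬ HomVanish (S' p) (S' j) m) :
    HomVanish (S p) (S j) 1 ∧ ¬ HomVanish (S p) (S j) (m + 1) := by
  rw [h.shift, HomVanish.shift_left (n := m + 1) (by omega)] at hm
  by_cases hv : HomVanish (S p) (S j) 1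
  · rw [h.eq j hj hv] at hm
    exact ⟨hv, hm⟩
  · exact (hm (h.vanish_p hH hS hd hj hv _)).elim

lemma cases_right {i : ι} (hi : i ≠ p) {m : ℤ} (hm : ¬ HomVanish (S' i) (S' p) m) :
    (¬ HomVanish (S p) (S i) 1 ∧ m = 1) ∨ ¬ HomVanish (S i) (S p) (m - 1) := by
  rw [h.shift, HomVanish.shift_right (n := m - 1) (by omega)] at hm
  by_cases hv : HomVanish (S p) (S i) 1
  · rw [h.eq i hi hv] at hm
    exact .inr hm
  · left
    refine ⟨hv, ?_⟩
    by_contra hm1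
    obtain ⟨F, hE, hF, -⟩ := h.ext i hi hv
    exact hm (hE.vanish₂ (hS.vanish_symm (Ne.symm hi) hv _)
      (hF.vanish_left (hS.vanish_self (by omega))))

lemma vanish_of_nonpos {i j : ι} (hij : i ≠ j) {m : ℤ} (hm : m ≤ 0) :
    HomVanish (S' i) (S' j) m := by
  by_contra hv
  by_cases hj : j = p
  · subst hj
    obtain ⟨-, h1⟩ | h1 := h.cases_right hH hS hd hij hv
    · omega
    · have := hS.pos hij h1
      omega
  by_cases hi : i = p
  · subst hi
    obtain ⟨h1, h2⟩ := h.cases_left hH hS hd hj hv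
    have := hS.pos hij h2
    obtain rfl : m = 0 := by omega
    exact h2 h1
  obtain h1 | ⟨-, h1⟩ | ⟨-, -, h1⟩ := h.cases_of_ne hH hS hd hi hj hv
  · have := hS.pos hij h1
    omega
  · have := hS.pos hi h1
    omega
  · have := hS.pos (Ne.symm hj) h1
    omega

lemma filt (i : ι) : Filt (shiftsOf S' Set.univ) (S i) := by
  have base : ∀ {X : D} (i : ι) (m : ℤ), (X ≅ (S' i)⟦m⟧) → Filt (shiftsOf S' Set.univ) X :=
    fun i m e => .base ⟨i, m, trivial, ⟨e⟩⟩
  by_cases hi : i = p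
  · refine base p 1 ?_
    rw [h.shift, hi]
    exact ((shiftEquiv D (1 : ℤ)).counitIso.app (S p)).symm
  by_cases hv : HomVanish (S p) (S i) 1
  · refine base i 0 ?_
    rw [h.eq i hi hv]
    exact ((shiftFunctorZero D ℤ).app _).symm
  · obtain ⟨F, hE, hF, -⟩ := h.ext i hi hv
    refine .ext hE.invRotate ((extGenerated_iff.1 hF).shift (P' := shiftsOf S' Set.univ) ?_)
      (base i 0 ((shiftFunctorZero D ℤ).app _).symm)
    rintro X ⟨e⟩
    refine ⟨p, 0, trivial, ⟨?_⟩⟩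
    rw [h.shift]
    exact (shiftFunctor D (-1 : ℤ)).mapIso e ≪≫ ((shiftFunctorZero D ℤ).app _).symm

lemma simpleMinded : SimpleMinded S' where
  not_isZero i hz := by
    by_cases hi : i = p
    · rw [hi, h.shift] at hz
      exact hS.not_isZero _ (HomVanish.isZero_of_shift hz)
    by_cases hv : HomVanish (S p) (S i) 1
    · rw [h.eq i hi hv] at hz
      exact hS.not_isZero _ hz
    · obtain ⟨F, hE, hF, -⟩ := h.ext i hi hv
      refine hS.not_isZero i (HomVanish.isZero_of_self (hE.coyoneda_vanish₁ (n := -1) ?_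
        (.of_isZero_right hz)))
      exact hF.vanish_right (hS.vanish_symm (Ne.symm hi) hv _)
  hom_neg i j m hm := by
    by_cases hij : i = j
    · subst hij
      exact h.vanish_self hH hS hd i hm.ne
    · exact h.vanish_of_nonpos hH hS hd hij hm.le
  hom_ne i j hij := h.vanish_of_nonpos hH hS hd hij le_rfl
  brick i := by
    change IsBrick (S' i)
    by_cases hi : i = p
    · rw [hi, h.shift]
      exact IsBrick.shift (hS.brick p) (-1)
    by_cases hv : HomVanish (S p) (S i) 1
    · rw [h.eq i hi hv]
      exact hS.brick i
    · obtain ⟨F, hE, hF, h0, h1⟩ := h.ext i hi hv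
      exact IsBrick.of_coextension (hS.brick i) hE
        (hF.vanish_right (hS.vanish_symm (Ne.symm hi) hv _)) (hF.vanish_left h0)
        (hF.vanish_left h1)
  gen A := (hS.gen A).bind fun X ⟨i, m, _, ⟨e⟩⟩ =>
    ((h.filt hH hS hd i).shiftsOf_shift (J := Set.univ) (a := m) (fun _ _ => trivial)).of_iso e.symm

lemma exceptionalFamily [Finite ι] : ExceptionalFamily S' where
  toSimpleMinded := h.simpleMinded hH hS hd
  rigid i m hm := h.vanish_self hH hS hd i hm.ne'
  exists_rank := by
    classical
    obtain ⟨r, hr⟩ := hS.exists_rank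
    obtain ⟨M, hM⟩ : ∃ M : ℤ, ∀ i, |r i| ≤ M := by
      obtain ⟨M, hM⟩ := (Set.finite_range fun i => |r i|).bddAbove
      exact ⟨M, fun i => hM ⟨i, rfl⟩⟩
    simp only [abs_le] at hM
    let U : Set ι := {x | (∃ a, a ≠ p ∧ ¬ HomVanish (S p) (S a) 1 ∧
      Relation.ReflTransGen (Arrow S) x a) ∨ Relation.ReflTransGen (Arrow S) x p}
    have hU : ∀ {x y : ι} {m : ℤ}, x ≠ y → ¬ HomVanish (S x) (S y) m → y ∈ U → x ∈ U := by
      rintro x y m hxy hv (⟨a, h1, h2, h3⟩ | h3)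
      · exact .inl ⟨a, h1, h2, h3.head ⟨hxy, m, hv⟩⟩
      · exact .inr (h3.head ⟨hxy, m, hv⟩)
    have hUp : p ∈ U := .inr .refl
    have hUA : ∀ {x}, x ≠ p → ¬ HomVanish (S p) (S x) 1 → x ∈ U :=
      fun hx hv => .inl ⟨_, hx, hv, .refl⟩
    have hU' : ∀ {x : ι} {m : ℤ}, x ≠ p → HomVanish (S p) (S x) 1 → ¬ HomVanish (S p) (S x) m →
        x ∉ U := by
      rintro x m hx hv hm (⟨a, h1, h2, h3⟩ | h3)
      · have hm1 := hS.pos (Ne.symm hx) hm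
        refine hS.no_path_backward hH hd (Ne.symm h1) (Ne.symm hx) h2 (m := m) ?_ hm h3
        by_contra hm2
        obtain rfl : m = 1 := by omega
        exact hm hv
      · have h4 := rank_le hr h3
        have h5 := hr _ _ _ (Ne.symm hx) hm
        omega
    -- Mirror image of the forward case: `U` is closed under predecessors and, apart from `p`, is
    -- placed below `p`; its complement lies above.
    refine ⟨fun x => if x = p then -M - 1 else if x ∈ U then r x - 2 * M - 2 else r x, ?_⟩
    intro i j m hij hv
    have hMi := hM i
    have hMj := hM j
    dsimp only
    by_cases hj : j = p
    · subst hj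
      have hi : i ∈ U := by
        obtain ⟨h1, -⟩ | h1 := h.cases_right hH hS hd hij hv
        · exact hUA hij h1
        · exact hU hij h1 hUp
      rw [if_pos rfl, if_neg hij, if_pos hi]
      omega
    by_cases hi : i = p
    · subst hi
      obtain ⟨h1, h2⟩ := h.cases_left hH hS hd hj hv
      rw [if_neg hj, if_pos rfl, if_neg (hU' hj h1 h2)]
      omega
    rw [if_neg hi, if_neg hj]
    have key : (r i < r j ∧ (j ∈ U → i ∈ U)) ∨ (j ∉ U ∧ i ∈ U) := by
      obtain h1 | ⟨h1, h2⟩ | ⟨h1, h2, h3⟩ := h.cases_of_ne hH hS hd hi hj hv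
      · exact .inl ⟨hr _ _ _ hij h1, hU hij h1⟩
      · exact .inl ⟨(hr _ _ _ hi h2).trans (hr _ _ _ (Ne.symm hj) h1),
          fun _ => hU hi h2 hUp⟩
      · exact .inr ⟨hU' hj h1 h3, hUA hi h2⟩
    split_ifs with h1 h2 h2
    · obtain ⟨h3, -⟩ | ⟨h3, -⟩ := key
      · omega
      · exact (h3 h2).elim
    · omega
    · obtain ⟨-, h3⟩ | ⟨h3, -⟩ := key
      · exact (h1 (h3 h2)).elim
      · exact (h3 h2).elim
    · obtain ⟨h3, -⟩ | ⟨-, h3⟩ := key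
      · omega
      · exact (h1 h3).elim

lemma isSimpleBackwardTilt (hS' : SimpleMinded S') :
    hS.heart.IsSimpleBackwardTilt (S p) hS'.heart := by
  refine hS.toSimpleMinded.isSimpleBackwardTilt hS' (hS.vanish_self (by omega)) h.shift
    fun i hi => ?_
  by_cases hv : HomVanish (S p) (S i) 1
  · rw [h.eq i hi hv]
    exact ⟨hS.heart_mem i, hS.hom_ne _ _ (Ne.symm hi)⟩
  · obtain ⟨F, hE, hF, h0, -⟩ := h.ext i hi hv
    exact ⟨BddHeart.mem_ext hE (hS.heart_mem i) (hF.mem (hS.heart_mem p)), h0⟩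

end IsBackwardMutation

end ExceptionalFamily

end Mutation

/-! ### Intersections and components of full subgraphs. -/

section FullSubgraphs

open OrientedGraph

variable {G : OrientedGraph.{v, u}}

lemma OrientedGraph.Subgraph.full_inter_full (V W : Set G.Vert) :
    (Subgraph.full G V).inter (Subgraph.full G W) = Subgraph.full G (V ∩ W) := by
  ext e
  · rfl
  · change (_ ∧ _) ∧ (_ ∧ _) ↔ (_ ∧ _) ∧ (_ ∧ _)
    tauto

/-- An edge of a full subgraph is detected by its end points, and this property passes to the
component. Intersections with lines can then be computed on vertices. -/
lemma OrientedGraph.Subgraph.component_full (V : Set G.Vert) (a : G.Vert) :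
    (Subgraph.full G V).component a =
      Subgraph.full G ((Subgraph.full G V).component a).verts := by
  ext e
  · rfl
  · constructor
    · intro he
      exact ⟨Subgraph.src_mem _ e he, Subgraph.tgt_mem _ e he⟩
    · rintro ⟨h1, h2⟩
      exact ⟨⟨h1.1, h2.1⟩, h1.2⟩

lemma OrientedGraph.Subgraph.component_isSubgraphOf {H K : Subgraph G} (h : H.IsSubgraphOf K)
    {a b : G.Vert} (hab : Relation.ReflTransGen K.Joined a b) :
    (H.component b).IsSubgraphOf (K.component a) := by
  have hJ : ∀ {x y}, Relation.ReflTransGen H.Joined x y → Relation.ReflTransGen K.Joined x y :=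
    fun hxy => hxy.lift id fun _ _ ⟨e, he, h'⟩ => ⟨e, h.2 he, h'⟩
  exact ⟨fun x hx => ⟨h.1 hx.1, hab.trans (hJ hx.2)⟩, fun e he => ⟨h.2 he.1, hab.trans (hJ he.2)⟩⟩

end FullSubgraphs

/-! ### Lines as sequences of forward tilts indexed by the integers. -/

section Lines

variable {D : Type u} [Category.{v} D] [Preadditive D] [HasZeroObject D] [HasShift D ℤ]
  [∀ n : ℤ, (shiftFunctor D n).Additive] [Pretriangulated D] [IsTriangulated D]

lemma BddHeart.IsSimpleForwardTilt.ne {H H' : BddHeart D} {S : D}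
    (h : H.IsSimpleForwardTilt S H') : H ≠ H' := by
  rintro rfl
  exact h.isSimple.not_isZero (HomVanish.isZero_of_self (h.le_zero_iff.1 h.isSimple.mem.1).2)

/-- A sequence of simple forward tilts at the shifts of `S`. -/
def IsTiltSequence (S : D) (l : ℤ → BddHeart D) : Prop :=
  ∀ m : ℤ, (l m).IsSimpleForwardTilt (S⟦m⟧) (l (m + 1))

/-- A backward tilt at `S[-m]` is inverse to a forward tilt at `S[-m-1]`, so both halves of the line
obey one rule. -/
lemma isIteratedTilt_iff {H : BddHeart D} {S : D} {l : ℤ → BddHeart D} :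
    IsIteratedTilt H S l ↔ l 0 = H ∧ IsTiltSequence S l := by
  constructor
  · refine fun h => ⟨h.zero, fun m => ?_⟩
    obtain ⟨n, rfl | rfl⟩ : ∃ n : ℕ, m = n ∨ m = -(n : ℤ) - 1 := by
      obtain hm | hm := le_or_gt 0 m
      · exact ⟨m.toNat, .inl (by omega)⟩
      · exact ⟨(-m - 1).toNat, .inr (by omega)⟩
    · exact h.forward n
    · have := (h.backward n).reverse.congr
        ((shiftFunctorAdd' D (-(n : ℤ)) (-1) (-(n : ℤ) - 1) (by omega)).app S).symm
      rwa [show -(n : ℤ) - 1 + 1 = -(n : ℤ) by omega]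
  · rintro ⟨h0, h⟩
    refine ⟨h0, fun m => h m, fun m => ?_⟩
    have := (h (-(m : ℤ) - 1)).reverse.congr
      ((shiftFunctorAdd' D (-(m : ℤ) - 1) 1 (-(m : ℤ)) (by omega)).app S).symm
    rwa [show -(m : ℤ) - 1 + 1 = -(m : ℤ) by omega] at this

namespace IsTiltSequence

variable {S S' : D} {l l' : ℤ → BddHeart D} (h : IsTiltSequence S l)
include h

lemma reindex (c : ℤ) : IsTiltSequence (S⟦c⟧) fun m => l (m + c) := by
  intro m
  have := (h (m + c)).congr ((shiftFunctorAdd' D c m (m + c) (by omega)).app S)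
  rwa [show m + c + 1 = m + 1 + c by omega] at this

lemma le {i j : ℤ} (hij : i ≤ j) : (l i).LE (l j) := by
  induction j, hij using Int.leInduction with
  | base => exact BddHeart.LE.refl _
  | succ j _ ih => exact ih.trans (h j).le

lemma not_lt_of_le {i j : ℤ} (hij : (l j).LE (l i)) : j ≤ i := by
  by_contra hc
  exact (h i).ne ((h i).le.antisymm ((h.le (show i + 1 ≤ j by omega)).trans hij))

lemma injective : Function.Injective l := fun _ _ hij =>
  le_antisymm (h.not_lt_of_le (hij ▸ BddHeart.LE.refl _))
    (h.not_lt_of_le (hij ▸ BddHeart.LE.refl _))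

/-- A simple tilt of `l i` is at most `(l i)[1]`, whose aisle contains `S[i+1]`. If `j ≥ i + 2`,
then `S[i+1]` would lie in the aisle of `l (i + 2)`, which has no maps to `S[i+1]`. So a line
carries no edges besides the obvious ones. -/
lemma eq_succ {i j : ℤ} {X : D} (hX : (l i).IsSimpleForwardTilt X (l j)) : j = i + 1 := by
  have h1 := h.not_lt_of_le hX.le
  have h2 : i ≠ j := fun hij => hX.ne (congrArg l hij)
  by_contra hij
  have h3 : (l (i + 1)).IsSimpleForwardTilt (S⟦i + 1⟧) (l (i + 1 + 1)) := h (i + 1)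
  have h4 : ((l i).shift 1).mem (S⟦i + 1⟧) := BddHeart.mem_iso
    (BddHeart.shift_mem_shift (h i).isSimple.mem)
    ((shiftFunctorAdd' D i 1 (i + 1) rfl).app S).symm
  have h5 := ((h.le (show i + 1 + 1 ≤ j by omega)).trans hX.le_shift_one).le h4.1
  exact h3.isSimple.not_isZero (HomVanish.isZero_of_self (h3.le_zero_iff.1 h5).2)

lemma eq_of_zero (h' : IsTiltSequence S l') (h0 : l 0 = l' 0) : l = l' := by
  funext m
  induction m using Int.induction_on with
  | zero => exact h0
  | succ m ih =>
    have h1 := h' m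
    rw [← ih] at h1
    exact (h m).unique h1
  | pred m ih =>
    have h1 := (h (-(m : ℤ) - 1)).reverse
    have h2 := (h' (-(m : ℤ) - 1)).reverse
    rw [show -(m : ℤ) - 1 + 1 = -(m : ℤ) by omega] at h1 h2
    rw [← ih] at h2
    exact h1.unique h2

end IsTiltSequence

end Lines

/-! ### Exceptional hearts are stable under tilting; existence of lines; passage to the shifted
heart. -/

section ExceptionalHearts

open OrientedGraph

variable {D : Type u} [Category.{v} D] [Preadditive D] [HasZeroObject D] [HasShift D ℤ]
  [∀ n : ℤ, (shiftFunctor D n).Additive] [Pretriangulated D] [IsTriangulated D]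

/-- `H'` is a simple forward tilt of `H`. -/
def ForwardTilt (H H' : BddHeart D) : Prop := ∃ S, H.IsSimpleForwardTilt S H'

/-- The simple objects of the heart `H` form an exceptional family indexed by `ι`. -/
def IsExceptionalHeart (ι : Type v') (H : BddHeart D) : Prop :=
  ∃ (S : ι → D) (hS : ExceptionalFamily S), H = hS.heart

variable {k : Type u'} [Field k] [Linear k D] (hfin : ∀ X Y : D, Module.Finite k (X ⟶ Y))
  {ι : Type v'} [Finite ι] {H₀ : BddHeart D} (hH₀ : H₀.Hereditary)
  {H H' : BddHeart D} {S X : D}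

lemma BddHeart.IsSimple.isBrick (hX : H.IsSimple X) : IsBrick X := fun f => hX.eq_zero_or_isIso hX f

namespace IsExceptionalHeart

include hfin hH₀

/-- Each simple of `H` is a member of the family up to isomorphism, and mutation there gives the
tilt together with its exceptional family, so tilting can be iterated. -/
lemma exists_forward (h : IsExceptionalHeart ι H) (hX : H.IsSimple X) :
    ∃ H', H.IsSimpleForwardTilt X H' ∧ IsExceptionalHeart ι H' := by
  obtain ⟨S, hS, rfl⟩ := h
  choose d hd using fun i => hH₀.exists_degree (hS.brick i)
  obtain ⟨p, ⟨e⟩⟩ := hS.exists_iso_of_isSimple hX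
  obtain ⟨S', hS'⟩ := hS.exists_isForwardMutation hfin p
  have hE := hS'.exceptionalFamily hH₀ hS hd
  exact ⟨_, (hS'.isSimpleForwardTilt hH₀ hS hd hE.toSimpleMinded).congr e.symm, S', hE, rfl⟩

lemma exists_backward (h : IsExceptionalHeart ι H) (hX : H.IsSimple X) :
    ∃ H', H.IsSimpleBackwardTilt X H' ∧ IsExceptionalHeart ι H' := by
  obtain ⟨S, hS, rfl⟩ := h
  choose d hd using fun i => hH₀.exists_degree (hS.brick i)
  obtain ⟨p, ⟨e⟩⟩ := hS.exists_iso_of_isSimple hX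
  obtain ⟨S', hS'⟩ := hS.exists_isBackwardMutation hfin p
  have hE := hS'.exceptionalFamily hH₀ hS hd
  exact ⟨_, (hS'.isSimpleBackwardTilt hH₀ hS hd hE.toSimpleMinded).congr e.symm, S', hE, rfl⟩

lemma of_tilt (h : IsExceptionalHeart ι H) (hT : H.IsSimpleForwardTilt X H') :
    IsExceptionalHeart ι H' := by
  obtain ⟨H'', h1, h2⟩ := h.exists_forward hfin hH₀ hT.isSimple
  rwa [hT.unique h1]

lemma of_tilt' (h : IsExceptionalHeart ι H') (hT : H.IsSimpleForwardTilt X H') :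
    IsExceptionalHeart ι H := by
  obtain ⟨H'', h1, h2⟩ := h.exists_backward hfin hH₀ hT.reverse.isSimple
  rwa [hT.reverse.unique h1]

lemma of_forwardTilt (h : IsExceptionalHeart ι H) (hp : Relation.ReflTransGen ForwardTilt H H') :
    IsExceptionalHeart ι H' := by
  induction hp with
  | refl => exact h
  | tail _ hT ih =>
    obtain ⟨X, hX⟩ := hT
    exact ih.of_tilt hfin hH₀ hX

lemma of_reflTransGen (h : IsExceptionalHeart ι H)
    (hp : Relation.ReflTransGen (Subgraph.full (exchangeGraph D) Set.univ).Joined H H') :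
    IsExceptionalHeart ι H' := by
  induction hp with
  | refl => exact h
  | tail _ hj ih =>
    obtain ⟨e, -, ⟨rfl, rfl⟩ | ⟨rfl, rfl⟩⟩ := hj
    · obtain ⟨X, -, hX⟩ := e.isTilt
      exact ih.of_tilt hfin hH₀ hX
    · obtain ⟨X, -, hX⟩ := e.isTilt
      exact ih.of_tilt' hfin hH₀ hX

lemma exists_isIteratedTilt (h : IsExceptionalHeart ι H) (hS : H.IsSimple S) :
    ∃ l, IsIteratedTilt H S l := by
  have hS0 : H.IsSimple (S⟦((0 : ℕ) : ℤ)⟧) := hS.of_iso ((shiftFunctorZero D ℤ).app S).symm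
  have hS0' : H.IsSimple (S⟦-((0 : ℕ) : ℤ)⟧) := hS.of_iso ((shiftFunctorZero D ℤ).app S).symm
  have hf : ∀ (n : ℕ) (G : BddHeart D), IsExceptionalHeart ι G ∧ G.IsSimple (S⟦(n : ℤ)⟧) →
      ∃ G' : BddHeart D, G.IsSimpleForwardTilt (S⟦(n : ℤ)⟧) G' ∧
        IsExceptionalHeart ι G' ∧ G'.IsSimple (S⟦((n + 1 : ℕ) : ℤ)⟧) := by
    rintro n G ⟨h1, h2⟩
    obtain ⟨G', h3, h4⟩ := h1.exists_forward hfin hH₀ h2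
    exact ⟨G', h3, h4, h3.isSimple_shift.of_iso
      ((shiftFunctorAdd' D (n : ℤ) 1 ((n + 1 : ℕ) : ℤ) (by simp)).app S).symm⟩
  have hg : ∀ (n : ℕ) (G : BddHeart D), IsExceptionalHeart ι G ∧ G.IsSimple (S⟦-(n : ℤ)⟧) →
      ∃ G' : BddHeart D, G.IsSimpleBackwardTilt (S⟦-(n : ℤ)⟧) G' ∧
        IsExceptionalHeart ι G' ∧ G'.IsSimple (S⟦-((n + 1 : ℕ) : ℤ)⟧) := by
    rintro n G ⟨h1, h2⟩
    obtain ⟨G', h3, h4⟩ := h1.exists_backward hfin hH₀ h2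
    exact ⟨G', h3, h4, h3.isSimple_shift.of_iso
      ((shiftFunctorAdd' D (-(n : ℤ)) (-1) (-((n + 1 : ℕ) : ℤ)) (by simp; omega)).app S).symm⟩
  choose F hF hF' using hf
  choose G hG hG' using hg
  -- The recursion carries the exceptionality of the heart and the simplicity of the shift of `S` at
  -- which it is tilted next. `g` is the backward half; both start from `H`.
  let f : ∀ n : ℕ, {K : BddHeart D // IsExceptionalHeart ι K ∧ K.IsSimple (S⟦(n : ℤ)⟧)} :=
    fun n => Nat.rec ⟨H, h, hS0⟩ (fun n K => ⟨F n K.1 K.2, hF' n K.1 K.2⟩) n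
  let g : ∀ n : ℕ, {K : BddHeart D // IsExceptionalHeart ι K ∧ K.IsSimple (S⟦-(n : ℤ)⟧)} :=
    fun n => Nat.rec ⟨H, h, hS0'⟩ (fun n K => ⟨G n K.1 K.2, hG' n K.1 K.2⟩) n
  let l : ℤ → BddHeart D := fun m => if 0 ≤ m then (f m.toNat).1 else (g (-m).toNat).1
  have hl : ∀ n : ℕ, l n = (f n).1 := fun n => by simp [l]
  have hl' : ∀ n : ℕ, l (-n) = (g n).1 := fun n => by
    obtain rfl | hn := n.eq_zero_or_pos
    · simp [l, f, g]
    · rw [show l (-n) = (g (- -(n : ℤ)).toNat).1 from if_neg (by omega), neg_neg,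
        Int.toNat_natCast]
  refine ⟨l, hl 0, fun m => ?_, fun m => ?_⟩
  · rw [hl, show ((m : ℤ) + 1) = ((m + 1 : ℕ) : ℤ) by simp, hl]
    exact hF m _ (f m).2
  · rw [hl', show (-(m : ℤ) - 1) = -((m + 1 : ℕ) : ℤ) by simp; omega, hl']
    exact hG m _ (g m).2

lemma existsUnique_isIteratedTilt (h : IsExceptionalHeart ι H) (hS : H.IsSimple S) :
    ∃! l, IsIteratedTilt H S l := by
  obtain ⟨l, hl⟩ := h.exists_isIteratedTilt hfin hH₀ hS
  refine ⟨l, hl, fun l' hl' => ?_⟩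
  rw [isIteratedTilt_iff] at hl hl'
  exact hl'.2.eq_of_zero hl.2 (hl'.1.trans hl.1.symm)

omit hfin in
/-- Tilting successively at all the simple objects of a heart leads to its shift. -/
lemma reflTransGen_shift_one (h : IsExceptionalHeart ι H) :
    Relation.ReflTransGen ForwardTilt H (H.shift 1) := by
  classical
  obtain ⟨S, hS, rfl⟩ := h
  obtain ⟨r, hr⟩ := hS.exists_rank
  cases nonempty_fintype ι
  let T : Finset ι → ι → D := fun I i => if i ∈ I then (S i)⟦(1 : ℤ)⟧ else S i
  -- `I` is the set of indices already tilted; their simples have been replaced by the shifts by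
  -- one.
  have key : ∀ n ≤ Fintype.card ι, ∃ (I : Finset ι) (hT : ExceptionalFamily (T I)),
      I.card = n ∧ Relation.ReflTransGen ForwardTilt hS.heart hT.heart := by
    intro n
    induction n with
    | zero =>
      have hT : T ∅ = S := by funext i; simp [T]
      have hT' : ∀ S', S' = S → ∃ hS' : ExceptionalFamily S', hS'.heart = hS.heart := by
        rintro _ rfl
        exact ⟨hS, rfl⟩
      obtain ⟨h1, h2⟩ := hT' _ hT
      exact fun _ => ⟨∅, h1, rfl, by rw [h2]⟩
    | succ n ih =>
      intro hn
      obtain ⟨I, hT, hI, hp⟩ := ih (by omega)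
      have hne : Iᶜ.Nonempty := by
        rw [← Finset.card_pos, Finset.card_compl]
        omega
      -- For `p` of minimal rank among the remaining indices, no other current simple has `Hom^1` to
      -- `S p`: a remaining one by the rank, a shifted one because `Hom(S i, S p) = 0`. The mutation
      -- therefore only shifts `S p`.
      obtain ⟨p, hp1, hp2⟩ := Finset.exists_min_image Iᶜ r hne
      rw [Finset.mem_compl] at hp1
      choose d hd using fun i => hH₀.exists_degree (hT.brick i)
      have hm : ExceptionalFamily.IsForwardMutation (T I) p (T (insert p I)) := by
        refine ⟨by simp [T, hp1], fun i hi _ => by simp [T, hi], fun i hi hv => (hv ?_).elim⟩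
        by_cases hiI : i ∈ I
        · simp only [T, if_pos hiI, if_neg hp1]
          exact (HomVanish.shift_left (by omega)).2 (hS.hom_ne _ _ hi)
        · simp only [T, if_neg hiI, if_neg hp1]
          by_contra hv
          have := hr _ _ _ hi hv
          have := hp2 i (by simpa using hiI)
          omega
      have hT' := hm.exceptionalFamily hH₀ hT hd
      refine ⟨insert p I, hT', by rw [Finset.card_insert_of_notMem hp1, hI], hp.tail ?_⟩
      exact ⟨_, hm.isSimpleForwardTilt hH₀ hT hd hT'.toSimpleMinded⟩
  obtain ⟨I, hT, hI, hp⟩ := key _ le_rfl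
  rw [Finset.card_eq_iff_eq_univ] at hI
  have : hT.heart = hS.heart.shift 1 := by
    refine BddHeart.eq_of_mem_imp fun E hE => BddHeart.mem_of_filt ?_ (hT.heart_mem_iff.1 hE)
    rintro Z ⟨i, ⟨e⟩⟩
    refine BddHeart.mem_iso (BddHeart.shift_mem_shift (hS.heart_mem i)) (eqToIso ?_ ≪≫ e.symm)
    simp [T, hI]
  rwa [this] at hp

end IsExceptionalHeart

end ExceptionalHearts

/-- `Fin n` numbering separates the wrap-around from the ordinary steps. Edges are automatically
distinct, since their sources are. -/
lemma OrientedGraph.Subgraph.isCycle_of_fin {G : OrientedGraph.{v, u}} {H : G.Subgraph} {n : ℕ}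
    (hn : 1 ≤ n) (x : Fin n → G.Vert) (e : Fin n → G.Edge) (hx : Function.Injective x)
    (hx' : ∀ a, a ∈ H.verts ↔ ∃ i, x i = a) (he : ∀ a, a ∈ H.edges ↔ ∃ i, e i = a)
    (hs : ∀ i, G.src (e i) = x i) (ht : ∀ i j : Fin n, i.1 + 1 = j.1 → G.tgt (e i) = x j)
    (ht' : ∀ i j : Fin n, i.1 + 1 = n → j.1 = 0 → G.tgt (e i) = x j) : H.IsCycle n := by
  have : NeZero n := ⟨by omega⟩
  have hxe : Function.Injective e := fun i j hij => hx (by rw [← hs, ← hs, hij])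
  let φ : ZMod n → Fin n := fun i => ⟨i.val, i.val_lt⟩
  have hφ : Function.Injective φ := fun i j hij => ZMod.val_injective n (Fin.mk.inj hij)
  have hφ' : Function.Surjective φ := fun i =>
    ⟨(i.1 : ZMod n), Fin.ext (by simp [φ, ZMod.val_natCast, Nat.mod_eq_of_lt i.2])⟩
  refine ⟨hn, x ∘ φ, e ∘ φ, hx.comp hφ, ?_, hxe.comp hφ, ?_, fun i => ⟨hs _, ?_⟩⟩
  · ext a
    rw [hx', hφ'.range_comp, Set.mem_range]
  · ext a
    rw [he, hφ'.range_comp, Set.mem_range]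
  · have h1 : (i + 1).val = (i.val + 1) % n := by
      rw [ZMod.val_add, ZMod.val_one_eq_one_mod, Nat.add_mod_mod]
    have h2 := i.val_lt
    obtain h3 | h3 := (show i.val + 1 ≤ n from h2).lt_or_eq
    · rw [Nat.mod_eq_of_lt h3] at h1
      exact ht _ _ h1.symm
    · rw [h3, Nat.mod_self] at h1
      exact ht' _ _ h3 h1

/-! ### The principal component: degrees of simples, convexity, basic cycles, source and sink. -/

section PrincipalComponent

open OrientedGraph

variable {D : Type u} [Category.{v} D] [Preadditive D] [HasZeroObject D] [HasShift D ℤ]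
  [∀ n : ℤ, (shiftFunctor D n).Additive] [Pretriangulated D] [IsTriangulated D]
  {H₀ G G' : BddHeart D} {X S : D} {l : ℤ → BddHeart D} {d c : ℤ} {N : ℕ}

namespace BddHeart

lemma shift_mem_shift_add (hX : (H₀.shift d).mem X) (i : ℤ) :
    (H₀.shift (d + i)).mem (X⟦i⟧) := by
  rw [shift_mem_iff] at hX ⊢
  exact ⟨(le_shift_iff (n := -d) (by omega)).2 hX.1, (ge_shift_iff (n := -d) (by omega)).2 hX.2⟩

/-- `X` lies in the aisle of `H₀[1]`; for `d ≤ 0` it would also be right orthogonal to that aisle,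
hence zero. -/
lemma IsSimple.one_le_degree (hX : G.IsSimple X) (hd : (H₀.shift d).mem X)
    (h : (H₀.shift 1).LE G) : 1 ≤ d := by
  by_contra hc
  have h1 : (H₀.shift 1).t.le 0 X := h.le hX.mem.1
  rw [shift_le_iff] at h1
  rw [shift_mem_iff] at hd
  exact hX.not_isZero (HomVanish.isZero_of_self (vanish_of_le_of_ge h1 hd.2 (by omega)))

lemma IsSimple.degree_le (hX : G.IsSimple X) (hd : (H₀.shift d).mem X)
    (h : G.LE (H₀.shift c)) : d ≤ c := by
  by_contra hc
  have h1 : (H₀.shift c).t.ge 0 X := h.ge hX.mem.2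
  rw [shift_ge_iff] at h1
  rw [shift_mem_iff] at hd
  exact hX.not_isZero (HomVanish.isZero_of_self (vanish_of_le_of_ge hd.1 h1 (by omega)))

/-- The tilt removes from the aisle only objects with maps to `X`. Objects of the aisle of `H₀[c]`
have none, because `X` has degree less than `c`. -/
lemma IsSimpleForwardTilt.le_shift (h : G.IsSimpleForwardTilt X G') (hd : (H₀.shift d).mem X)
    (hG : G.LE (H₀.shift c)) (hc : d < c) : G'.LE (H₀.shift c) := by
  intro Y hY
  rw [h.le_zero_iff]
  refine ⟨hG.le hY, ?_⟩
  rw [shift_le_iff] at hY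
  rw [shift_mem_iff] at hd
  exact vanish_of_le_of_ge hY hd.2 (by omega)

lemma IsSimpleForwardTilt.shift_le (h : G.IsSimpleForwardTilt X G') (hd : (H₀.shift d).mem X)
    (hG : (H₀.shift c).LE G') (hc : c ≤ d) : (H₀.shift c).LE G := by
  refine LE.of_ge (n := 0) fun Y hY => ?_
  rw [h.ge_zero_iff]
  refine ⟨hG.ge hY, ?_⟩
  rw [shift_ge_iff] at hY
  rw [shift_mem_iff] at hd
  exact vanish_of_le_of_ge hd.1 hY (by omega)

end BddHeart

lemma mem_EGbasePrincipal_edges {e : ExchangeEdge D} : e ∈ (EGbasePrincipal N H₀).edges ↔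
    e.src ∈ (EGbasePrincipal N H₀).verts ∧ e.tgt ∈ (EGbasePrincipal N H₀).verts := by
  have := Subgraph.component_full {H : (exchangeGraph D).Vert |
    (H₀.shift 1).LE H ∧ BddHeart.LE H (H₀.shift ((N : ℤ) - 1))} (H₀.shift 1)
  exact iff_of_eq (congrArg (fun K : Subgraph (exchangeGraph D) => e ∈ K.edges) this)

lemma EGbasePrincipal_mem_range (hG : G ∈ (EGbasePrincipal N H₀).verts) :
    (H₀.shift 1).LE G ∧ G.LE (H₀.shift ((N : ℤ) - 1)) := hG.1

lemma EGbasePrincipal_forward (hG : G ∈ (EGbasePrincipal N H₀).verts)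
    (h : G.IsSimpleForwardTilt X G') (hd : (H₀.shift d).mem X) (hN : d < (N : ℤ) - 1) :
    G' ∈ (EGbasePrincipal N H₀).verts := by
  have h1 := EGbasePrincipal_mem_range hG
  have h2 : (H₀.shift 1).LE G' ∧ G'.LE (H₀.shift ((N : ℤ) - 1)) :=
    ⟨h1.1.trans h.le, h.le_shift hd h1.2 hN⟩
  exact ⟨h2, hG.2.tail ⟨⟨G, G', _, X, rfl, h⟩, ⟨h1, h2⟩, .inl ⟨rfl, rfl⟩⟩⟩

lemma EGbasePrincipal_backward (hG' : G' ∈ (EGbasePrincipal N H₀).verts)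
    (h : G.IsSimpleForwardTilt X G') (hd : (H₀.shift d).mem X) (h1d : 1 ≤ d) :
    G ∈ (EGbasePrincipal N H₀).verts := by
  have h1 := EGbasePrincipal_mem_range hG'
  have h2 : (H₀.shift 1).LE G ∧ G.LE (H₀.shift ((N : ℤ) - 1)) :=
    ⟨h.shift_le hd h1.1 h1d, h.le.trans h1.2⟩
  exact ⟨h2, hG'.2.tail ⟨⟨G, G', _, X, rfl, h⟩, ⟨h2, h1⟩, .inr ⟨rfl, rfl⟩⟩⟩

lemma BddHeart.Hereditary.exists_degree_of_isTiltSequence (hH₀ : H₀.Hereditary)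
    (h : IsTiltSequence S l) : ∃ d, (H₀.shift d).mem S :=
  hH₀.exists_degree ((h 0).isSimple.of_iso ((shiftFunctorZero D ℤ).app S)).isBrick

/-- A line that meets the principal component meets it in `N - 1` consecutive hearts. -/
lemma IsTiltSequence.mem_EGbasePrincipal_iff (h : IsTiltSequence S l) (hd : (H₀.shift d).mem S)
    {j : ℤ} (hj : l j ∈ (EGbasePrincipal N H₀).verts) (i : ℤ) :
    l i ∈ (EGbasePrincipal N H₀).verts ↔ 1 ≤ d + i ∧ d + i ≤ (N : ℤ) - 1 := by
  have key : ∀ i, l i ∈ (EGbasePrincipal N H₀).verts → 1 ≤ d + i ∧ d + i ≤ (N : ℤ) - 1 := by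
    intro i hi
    have h1 := EGbasePrincipal_mem_range hi
    have h2 := BddHeart.shift_mem_shift_add hd i
    exact ⟨(h i).isSimple.one_le_degree h2 h1.1, (h i).isSimple.degree_le h2 h1.2⟩
  refine ⟨key i, fun hi => ?_⟩
  have hj' := key j hj
  obtain hij | hij := le_total j i
  · induction i, hij using Int.leInduction with
    | base => exact hj
    | succ i hij ih =>
      exact EGbasePrincipal_forward (ih (by omega)) (h i) (BddHeart.shift_mem_shift_add hd i)
        (by omega)
  · induction i, hij using Int.leInductionDown with
    | base => exact hj
    | pred i hij ih =>
      have h1 := h (i - 1)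
      rw [show i - 1 + 1 = i by omega] at h1
      exact EGbasePrincipal_backward (ih (by omega)) h1 (BddHeart.shift_mem_shift_add hd (i - 1))
        (by omega)

lemma inter_EGbasePrincipal (V : Set (exchangeGraph D).Vert) :
    (Subgraph.full (exchangeGraph D) V).inter (EGbasePrincipal N H₀) =
      Subgraph.full (exchangeGraph D) (V ∩ (EGbasePrincipal N H₀).verts) := by
  have h := Subgraph.component_full {H : (exchangeGraph D).Vert |
    (H₀.shift 1).LE H ∧ BddHeart.LE H (H₀.shift ((N : ℤ) - 1))} (H₀.shift 1)
  exact (congrArg (Subgraph.inter (Subgraph.full _ V)) h).trans (Subgraph.full_inter_full _ _)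

lemma isConvex_EGbasePrincipal (hH₀ : H₀.Hereditary) (hN : 2 ≤ N) :
    IsConvex (EGbasePrincipal N H₀) := by
  rintro _ ⟨H, S, l, hS, hl, rfl⟩ ⟨_, ⟨j, rfl⟩, hj⟩
  rw [isIteratedTilt_iff] at hl
  have h := hl.2
  obtain ⟨d, hd⟩ := hH₀.exists_degree_of_isTiltSequence h
  have key := h.mem_EGbasePrincipal_iff hd hj
  -- The top of the segment is the heart at which the shift of `S` has degree `N - 1`, the bottom
  -- the one at which it has degree `1`. The line is renumbered to start at the top.
  refine ⟨N - 1, l ((N : ℤ) - 1 - d), l (1 - d), by omega, S⟦(N : ℤ) - 1 - d⟧,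
    fun m => l (m + ((N : ℤ) - 1 - d)), (h _).isSimple, ?_, ?_, ?_, ?_⟩
  · exact isIteratedTilt_iff.2 ⟨congrArg l (by omega), h.reindex _⟩
  · congr 1
    ext H
    constructor
    · rintro ⟨i, rfl⟩
      exact ⟨i - ((N : ℤ) - 1 - d), congrArg l (by omega)⟩
    · rintro ⟨i, rfl⟩
      exact ⟨_, rfl⟩
  · refine (inter_EGbasePrincipal _).trans ?_
    congr 1
    ext H
    constructor
    · rintro ⟨⟨i, rfl⟩, hi⟩
      obtain ⟨h1, h2⟩ := (key i).1 hi
      exact ⟨((N : ℤ) - 1 - d - i).toNat, by omega, congrArg l (by omega)⟩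
    · rintro ⟨i, hi, rfl⟩
      exact ⟨⟨_, rfl⟩, (key _).2 (by omega)⟩
  · exact congrArg l (by omega)

lemma isCycle_basicCycle (hH₀ : H₀.Hereditary) (a : AddedEdge (EGbasePrincipal N H₀)) :
    (basicCycle a).IsCycle (N - 1) := by
  obtain ⟨m, hm, S, l, -, hl, hL, hW, hbot⟩ := a.isSegment
  rw [isIteratedTilt_iff] at hl
  obtain ⟨hl0, h⟩ := hl
  obtain ⟨d, hd⟩ := hH₀.exists_degree_of_isTiltSequence h
  rw [hL] at hW
  have hV : Set.range l ∩ (EGbasePrincipal N H₀).verts =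
    {H : BddHeart D | ∃ i : ℕ, i < m ∧ H = l (-i)} :=
    congrArg Subgraph.verts ((inter_EGbasePrincipal _).symm.trans hW)
  have h0 : l 0 ∈ (EGbasePrincipal N H₀).verts := by
    rw [hl0]
    exact a.top_mem
  have key := h.mem_EGbasePrincipal_iff hd h0
  have key' : ∀ i : ℤ, (1 ≤ d + i ∧ d + i ≤ (N : ℤ) - 1) ↔ -(m : ℤ) < i ∧ i ≤ 0 := by
    intro i
    rw [← key]
    have := Set.ext_iff.1 hV (l i)
    constructor
    · intro hi
      obtain ⟨j, hj, hj'⟩ := this.1 ⟨⟨i, rfl⟩, hi⟩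
      have := h.injective hj'
      omega
    · intro hi
      exact (this.2 ⟨(-i).toNat, by omega, congrArg l (by omega)⟩).2
  -- Two descriptions of the same segment are compared at its ends and just outside them, which
  -- forces `d = N - 1` and `m = N - 1`.
  have k1 := key' 0
  have k2 := key' 1
  have k3 := key' (-m)
  have k4 := key' (-m + 1)
  have hdN : d = (N : ℤ) - 1 := by omega
  have hmN : m = N - 1 := by omega
  clear k1 k2 k3 k4 key'
  subst hdN
  have hmem : ∀ i : Fin (N - 1), l ((i.1 : ℤ) - (N - 2 : ℕ)) ∈ (EGbasePrincipal N H₀).verts :=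
    fun i => (key _).2 (by omega)
  -- The vertices are numbered upwards from `bot` at `0` to `top` at `N - 2`, along the forward
  -- tilts. The last edge is the added one, back from `top` to `bot`. For `N = 2` it is a loop and
  -- the only edge.
  let x : Fin (N - 1) → (cyclicCompletion (EGbasePrincipal N H₀)).Vert :=
    fun i => ⟨l ((i.1 : ℤ) - (N - 2 : ℕ)), hmem i⟩
  let ed : ℤ → ExchangeEdge D := fun i => ⟨l i, l (i + 1), _, S⟦i⟧, rfl, h i⟩
  have hed : ∀ i : Fin (N - 1), i.1 + 1 < N - 1 →
      ed ((i.1 : ℤ) - (N - 2 : ℕ)) ∈ (EGbasePrincipal N H₀).edges := fun i hi =>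
    mem_EGbasePrincipal_edges.2 ⟨(key _).2 (by omega), (key _).2 (by omega)⟩
  let e : Fin (N - 1) → (cyclicCompletion (EGbasePrincipal N H₀)).Edge := fun i =>
    if hi : i.1 + 1 < N - 1 then .inl ⟨_, hed i hi⟩ else .inr a
  have he : ∀ i (hi : i.1 + 1 < N - 1), e i = .inl ⟨_, hed i hi⟩ := fun i hi => dif_pos hi
  have he' : ∀ i : Fin (N - 1), ¬ i.1 + 1 < N - 1 → e i = .inr a := fun i hi => dif_neg hi
  refine Subgraph.isCycle_of_fin (by omega) x e ?_ ?_ ?_ ?_ ?_ ?_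
  · intro i j hij
    have := h.injective (congrArg Subtype.val hij)
    exact Fin.ext (by omega)
  · rintro ⟨H, hH⟩
    change H ∈ a.line.verts ↔ _
    rw [hL]
    constructor
    · rintro ⟨i, rfl⟩
      have := (key i).1 hH
      exact ⟨⟨(i + (N - 2 : ℕ)).toNat, by omega⟩, Subtype.ext (congrArg l (by dsimp; omega))⟩
    · rintro ⟨i, hi⟩
      exact ⟨_, congrArg Subtype.val hi⟩
  · rintro (⟨f, hf⟩ | a')
    · change f ∈ a.line.edges ↔ _
      rw [hL]
      constructor
      -- An edge of the component with both ends on the line joins consecutive hearts by `eq_succ`,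
      -- and its label is forced by `label_unique`.
      · rintro ⟨⟨i, hi⟩, ⟨j, hj⟩⟩
        change l i = f.src at hi
        change l j = f.tgt at hj
        obtain ⟨X, hX, hX'⟩ := f.isTilt
        rw [← hi, ← hj] at hX'
        obtain rfl := h.eq_succ hX'
        obtain ⟨iso⟩ := hX'.label_unique (h i)
        have h1 := mem_EGbasePrincipal_edges.1 hf
        rw [← hi, ← hj, key, key] at h1
        refine ⟨⟨(i + (N - 2 : ℕ)).toNat, by omega⟩, ?_⟩
        rw [he _ (by dsimp; omega)]
        refine congrArg Sum.inl (Subtype.ext ?_)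
        have : (((⟨(i + (N - 2 : ℕ)).toNat, by omega⟩ : Fin (N - 1)).1 : ℤ) - (N - 2 : ℕ)) = i := by
          dsimp; omega
        refine (congrArg ed this).trans (ExchangeEdge.ext hi hj ?_)
        rw [← hX]
        exact Quotient.sound ⟨iso.symm⟩
      · rintro ⟨i, hi⟩
        by_cases hi' : i.1 + 1 < N - 1
        · rw [he i hi'] at hi
          have := congrArg Subtype.val (Sum.inl.inj hi)
          dsimp only at this
          subst this
          exact ⟨⟨_, rfl⟩, ⟨_, rfl⟩⟩
        · rw [he' i hi'] at hi
          cases hi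
    · change a' = a ↔ _
      constructor
      · rintro rfl
        exact ⟨⟨N - 2, by omega⟩, he' _ (by dsimp; omega)⟩
      · rintro ⟨i, hi⟩
        by_cases hi' : i.1 + 1 < N - 1
        · rw [he i hi'] at hi
          cases hi
        · rw [he' i hi'] at hi
          exact (Sum.inr.inj hi).symm
  · intro i
    by_cases hi : i.1 + 1 < N - 1
    · rw [he i hi]
      rfl
    · rw [he' i hi]
      exact Subtype.ext (hl0.symm.trans (congrArg l (by omega)))
  · intro i j hij
    have hi : i.1 + 1 < N - 1 := by omega
    rw [he i hi]
    exact Subtype.ext (congrArg l (by omega))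
  · intro i j hi hj
    rw [he' i (by omega)]
    exact Subtype.ext (hbot.trans (congrArg l (by omega)))

section

variable {k : Type u'} [Field k] [Linear k D] (hfin : ∀ X Y : D, Module.Finite k (X ⟶ Y))
  {ι : Type v'} [Finite ι] (hH₀ : H₀.Hereditary) (hE : IsExceptionalHeart ι H₀)

-- The component is based at `H₀[1]`, so a path from `H₀` to `H₀[1]` in the whole exchange graph is
-- needed; tilting successively at all simples provides it.
include hH₀ hE in
lemma EGbasePrincipal_isSubgraphOf : (EGbasePrincipal N H₀).IsSubgraphOf (EGcomponent H₀) :=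
  Subgraph.component_isSubgraphOf (K := Subgraph.full (exchangeGraph D) Set.univ)
    ⟨fun _ _ => trivial, fun _ _ => ⟨trivial, trivial⟩⟩
    ((hE.reflTransGen_shift_one hH₀).lift id fun G G' ⟨X, hX⟩ =>
      ⟨⟨G, G', _, X, rfl, hX⟩, ⟨trivial, trivial⟩, .inl ⟨rfl, rfl⟩⟩)

include hfin hH₀ hE

lemma isExceptionalHeart_of_mem (hG : G ∈ (EGcomponent H₀).verts) : IsExceptionalHeart ι G :=
  hE.of_reflTransGen hfin hH₀ hG.2

/-- If all simples had degree `c`, the heart `G` would be contained in `H₀[c]`, and nested hearts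
are equal. -/
lemma exists_simple_of_ne (hG : G ∈ (EGbasePrincipal N H₀).verts) (hne : G ≠ H₀.shift c) :
    ∃ X d, G.IsSimple X ∧ (H₀.shift d).mem X ∧ d ≠ c := by
  obtain ⟨S, hS, rfl⟩ := isExceptionalHeart_of_mem hfin hH₀ hE
    ((EGbasePrincipal_isSubgraphOf hH₀ hE).1 hG)
  by_contra! hc
  refine hne (BddHeart.eq_of_mem_imp fun E hE' => BddHeart.mem_of_filt ?_ (hS.heart_mem_iff.1 hE'))
  rintro Z ⟨i, ⟨e⟩⟩
  obtain ⟨d, hd⟩ := hH₀.exists_degree (hS.brick i)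
  rw [hc _ _ (hS.heart_isSimple i) hd] at hd
  exact BddHeart.mem_iso hd e.symm

lemma isSource_EGbasePrincipal_iff (hN : 2 ≤ N) :
    (EGbasePrincipal N H₀).IsSource G ↔ G = H₀.shift 1 := by
  constructor
  · rintro ⟨hG, hs⟩
    by_contra hne
    obtain ⟨X, d, hX, hd, hd'⟩ := exists_simple_of_ne hfin hH₀ hE hG hne
    have h1 := hX.one_le_degree hd (EGbasePrincipal_mem_range hG).1
    obtain ⟨G', hG', -⟩ := (isExceptionalHeart_of_mem hfin hH₀ hE
      ((EGbasePrincipal_isSubgraphOf hH₀ hE).1 hG)).exists_backward hfin hH₀ hX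
    -- `X` has degree at least `2`, so the forward tilt that leads back to `G` is made at `X[-1]`,
    -- of degree at least `1`, and starts inside the component.
    have h2 := EGbasePrincipal_backward hG hG'.reverse (BddHeart.shift_mem_shift_add hd (-1))
      (by omega)
    exact hs ⟨G', G, _, _, rfl, hG'.reverse⟩ (mem_EGbasePrincipal_edges.2 ⟨h2, hG⟩) rfl
  · rintro rfl
    refine ⟨⟨⟨BddHeart.LE.refl _, BddHeart.shift_LE_shift (by omega)⟩, .refl⟩, ?_⟩
    intro (e : ExchangeEdge D) he het
    change e.tgt = _ at het
    have h1 := (EGbasePrincipal_mem_range (mem_EGbasePrincipal_edges.1 he).1).1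
    obtain ⟨X, -, hX⟩ := e.isTilt
    refine hX.ne (hX.le.antisymm ?_)
    rwa [het]

lemma shift_mem_EGbasePrincipal (hN : 2 ≤ N) :
    H₀.shift ((N : ℤ) - 1) ∈ (EGbasePrincipal N H₀).verts := by
  have hshift : ∀ j : ℕ, IsExceptionalHeart ι (H₀.shift (j + 1)) ∧
      Relation.ReflTransGen ForwardTilt (H₀.shift 1) (H₀.shift (j + 1)) := by
    intro j
    induction j with
    | zero => exact ⟨hE.of_forwardTilt hfin hH₀ (hE.reflTransGen_shift_one hH₀), .refl⟩
    | succ j ih =>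
      have h1 := ih.1.reflTransGen_shift_one hH₀
      have h2 : (H₀.shift (j + 1)).shift 1 = H₀.shift ((j + 1 : ℕ) + 1) := by
        refine BddHeart.ext_of_le fun X => ?_
        simp only [BddHeart.shift_le_iff]
        rw [show (0 : ℤ) - 1 - (j + 1) = 0 - ((j + 1 : ℕ) + 1) by push_cast; ring]
      rw [h2] at h1
      exact ⟨ih.1.of_forwardTilt hfin hH₀ h1, ih.2.trans h1⟩
  have hle : ∀ {G G' : BddHeart D}, Relation.ReflTransGen ForwardTilt G G' → G.LE G' := by
    intro G G' h
    induction h with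
    | refl => exact BddHeart.LE.refl _
    | tail _ h ih =>
      obtain ⟨X, hX⟩ := h
      exact ih.trans hX.le
  -- Forward tilts increase the order, so a path of forward tilts between the two bounds never
  -- leaves the interval.
  have key : ∀ G, Relation.ReflTransGen ForwardTilt (H₀.shift 1) G → G.LE (H₀.shift ((N : ℤ) - 1)) →
      G ∈ (EGbasePrincipal N H₀).verts := by
    intro G hG
    induction hG with
    | refl =>
      exact fun h => ⟨⟨BddHeart.LE.refl _, h⟩, .refl⟩
    | @tail G G' h1 h2 ih =>
      intro h
      obtain ⟨X, hX⟩ := h2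
      have h3 := ih (hX.le.trans h)
      exact ⟨⟨h3.1.1.trans hX.le, h⟩, h3.2.tail
        ⟨⟨G, G', _, X, rfl, hX⟩, ⟨h3.1, h3.1.1.trans hX.le, h⟩, .inl ⟨rfl, rfl⟩⟩⟩
  have := (hshift (N - 2)).2
  rw [show (((N - 2 : ℕ) : ℤ) + 1) = (N : ℤ) - 1 by omega] at this
  exact key _ this (BddHeart.LE.refl _)

lemma isSink_EGbasePrincipal_iff (hN : 2 ≤ N) :
    (EGbasePrincipal N H₀).IsSink G ↔ G = H₀.shift ((N : ℤ) - 1) := by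
  constructor
  · rintro ⟨hG, hs⟩
    by_contra hne
    obtain ⟨X, d, hX, hd, hd'⟩ := exists_simple_of_ne hfin hH₀ hE hG hne
    have h1 := hX.degree_le hd (EGbasePrincipal_mem_range hG).2
    obtain ⟨G', hG', -⟩ := (isExceptionalHeart_of_mem hfin hH₀ hE
      ((EGbasePrincipal_isSubgraphOf hH₀ hE).1 hG)).exists_forward hfin hH₀ hX
    have h2 := EGbasePrincipal_forward hG hG' hd (by omega)
    exact hs ⟨G, G', _, _, rfl, hG'⟩ (mem_EGbasePrincipal_edges.2 ⟨hG, h2⟩) rfl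
  · rintro rfl
    refine ⟨shift_mem_EGbasePrincipal hfin hH₀ hE hN, ?_⟩
    intro (e : ExchangeEdge D) he het
    change e.src = _ at het
    have h1 := (EGbasePrincipal_mem_range (mem_EGbasePrincipal_edges.1 he).2).2
    obtain ⟨X, -, hX⟩ := e.isTilt
    refine hX.ne (hX.le.antisymm ?_)
    rwa [het]

end

end PrincipalComponent

/-! ### Finite dimensionality of Homs along extensions and filtrations. -/

section HomFinite

lemma Module.Finite.of_exact_of_field {k M N P : Type*} [Field k] [AddCommGroup M] [Module k M]
    [AddCommGroup N] [Module k N] [AddCommGroup P] [Module k P] {f : M →ₗ[k] N} {g : N →ₗ[k] P}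
    (h : Function.Exact f g) [Module.Finite k M] [Module.Finite k P] : Module.Finite k N :=
  Module.Finite.of_exact (f := f) (g := g.rangeRestrict)
    (fun x => by rw [← h x, ← Subtype.coe_inj]; rfl) g.surjective_rangeRestrict

variable (k : Type u') [Field k] {D : Type u} [Category.{v} D] [Preadditive D] [HasZeroObject D]
  [HasShift D ℤ] [∀ n : ℤ, (shiftFunctor D n).Additive] [Pretriangulated D] [Linear k D]

/-- `Hom(X, Y[m])` is finite dimensional. -/
def HomFinite (X Y : D) (m : ℤ) : Prop := Module.Finite k (X ⟶ Y⟦m⟧)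

namespace HomFinite

variable {k} {A B C X X' Y Y' : D} {m n a : ℤ}

lemma of_vanish (h : HomVanish X Y m) : HomFinite k X Y m := by
  have : Subsingleton (X ⟶ Y⟦m⟧) := ⟨fun f g => by rw [h f, h g]⟩
  exact Module.Finite.of_finite

lemma zero_iff : HomFinite k X Y 0 ↔ Module.Finite k (X ⟶ Y) :=
  Module.Finite.equiv_iff (Linear.homCongr k (Iso.refl X) ((shiftFunctorZero D ℤ).app Y))

lemma of_iso_left (e : X ≅ X') (h : HomFinite k X Y m) : HomFinite k X' Y m :=
  (Module.Finite.equiv_iff (Linear.homCongr k e (Iso.refl _))).1 h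

lemma of_iso_right (e : Y ≅ Y') (h : HomFinite k X Y m) : HomFinite k X Y' m :=
  (Module.Finite.equiv_iff (Linear.homCongr k (Iso.refl _) ((shiftFunctor D m).mapIso e))).1 h

lemma shift_right (hn : n = a + m) : HomFinite k X (Y⟦a⟧) m ↔ HomFinite k X Y n :=
  (Module.Finite.equiv_iff (Linear.homCongr k (Iso.refl _)
    ((shiftFunctorAdd' D a m n hn.symm).app Y))).symm

lemma shift_left [∀ n : ℤ, (shiftFunctor D n).Linear k] (hm : m = n + a)
    (h : HomFinite k X Y n) : HomFinite k (X⟦a⟧) Y m := by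
  have : Module.Finite k (X ⟶ Y⟦n⟧) := h
  have h1 : Module.Finite k (X⟦a⟧ ⟶ Y⟦n⟧⟦a⟧) :=
    Module.Finite.of_surjective ((shiftFunctor D a).mapLinearMap k) (shiftFunctor D a).map_surjective
  exact (Module.Finite.equiv_iff (Linear.homCongr k (Iso.refl _)
    ((shiftFunctorAdd' D n a m hm.symm).app Y))).2 h1

lemma of_isExt_right (h : IsExt A B C) (hA : HomFinite k X A m) (hC : HomFinite k X C m) :
    HomFinite k X B m := by
  obtain ⟨f, g, e, hT⟩ := h.shift m
  have : Module.Finite k (X ⟶ A⟦m⟧) := hA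
  have : Module.Finite k (X ⟶ C⟦m⟧) := hC
  refine Module.Finite.of_exact_of_field (f := Linear.rightComp k X f) (g := Linear.rightComp k X g)
    fun x => ⟨fun hx => ?_, ?_⟩
  · obtain ⟨y, hy⟩ := dist_lift₂ hT x hx
    exact ⟨y, hy.symm⟩
  · rintro ⟨y, rfl⟩
    change (y ≫ f) ≫ g = 0
    rw [Category.assoc, dist_comp₁₂ hT, comp_zero]

lemma of_isExt_left (h : IsExt A B C) (hA : HomFinite k A Y m) (hC : HomFinite k C Y m) :
    HomFinite k B Y m := by
  obtain ⟨f, g, e, hT⟩ := h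
  have : Module.Finite k (A ⟶ Y⟦m⟧) := hA
  have : Module.Finite k (C ⟶ Y⟦m⟧) := hC
  refine Module.Finite.of_exact_of_field (f := Linear.leftComp k (Y⟦m⟧) g)
    (g := Linear.leftComp k (Y⟦m⟧) f) fun x => ⟨fun hx => ?_, ?_⟩
  · obtain ⟨y, hy⟩ := dist_desc₂ hT x hx
    exact ⟨y, hy.symm⟩
  · rintro ⟨y, rfl⟩
    change f ≫ g ≫ y = 0
    rw [← Category.assoc, dist_comp₁₂ hT, zero_comp]

lemma of_filt_left {P : ObjectProperty D} (hP : ∀ X, P X → HomFinite k X Y m) (h : Filt P X) :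
    HomFinite k X Y m := by
  induction h with
  | zero hX => exact of_vanish (.of_isZero_left hX)
  | cons h hX _ ih => exact of_isExt_left h (hP _ hX) ih

lemma of_filt_right {P : ObjectProperty D} (hP : ∀ Y, P Y → HomFinite k X Y m) (h : Filt P Y) :
    HomFinite k X Y m := by
  induction h with
  | zero hX => exact of_vanish (.of_isZero_right hX)
  | cons h hX _ ih => exact of_isExt_right h (hP _ hX) ih

end HomFinite

end HomFinite

/-! ### From injective resolutions of length one to a hereditary exceptional heart. -/

section HereditaryRecognition

variable {D : Type u} [Category.{v} D] [Preadditive D] [HasZeroObject D] [HasShift D ℤ]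
  [∀ n : ℤ, (shiftFunctor D n).Additive] [Pretriangulated D] [IsTriangulated D]

/-- The simple objects of a heart of finite length, with injective resolutions of length one. -/
structure HereditarySimples {ι : Type v'} (H : BddHeart D) (S : ι → D) : Prop where
  mem : ∀ i, H.mem (S i)
  not_isZero : ∀ i, ¬ IsZero (S i)
  brick : ∀ i, IsBrick (S i)
  hom_ne : ∀ i j, i ≠ j → HomVanish (S i) (S j) 0
  filt : ∀ E, H.mem E → Filt (fun X => ∃ i, Nonempty (X ≅ S i)) E
  exists_resolution : ∃ (I J : ι → D) (r : ι → ℤ), (∀ i, IsExt (S i) (I i) (J i)) ∧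
    (∀ i, H.mem (J i)) ∧
    (∀ i E m, H.mem E → 1 ≤ m → HomVanish E (I i) m ∧ HomVanish E (J i) m) ∧
    ∀ i j, ¬ HomVanish (S i) (J j) 0 → r i < r j

namespace HereditarySimples

variable {ι : Type v'} {H : BddHeart D} {S : ι → D} (h : HereditarySimples H S)
include h

lemma vanish {E : D} (hE : H.mem E) {m : ℤ} (hm : 2 ≤ m) (i : ι) : HomVanish E (S i) m := by
  obtain ⟨I, J, r, hext, -, hinj, -⟩ := h.exists_resolution
  exact (hext i).coyoneda_vanish₁ (n := m - 1) (hinj i E _ hE (by omega)).2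
    (hinj i E _ hE (by omega)).1

lemma hereditary : H.Hereditary := fun _ Y _ hX hY hm =>
  (h.filt Y hY).vanish_right fun _ ⟨i, ⟨e⟩⟩ => (h.vanish hX hm i).of_iso_right e.symm

lemma gen (A : D) : Filt (shiftsOf S Set.univ) A := by
  obtain ⟨⟨a, ha⟩, ⟨b, hb⟩⟩ := H.bounded A
  refine (BddHeart.filt_of_le_of_ge hb.le ha.ge).bind ?_
  rintro X ⟨E, n, hE, -, ⟨e⟩⟩
  refine ((h.filt E hE).shift (a := n) ?_).of_iso e.symm
  rintro Y ⟨i, ⟨e'⟩⟩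
  exact ⟨i, n, trivial, ⟨(shiftFunctor D n).mapIso e'⟩⟩

/-- `Ext¹(S i, S j)` is a quotient of `Hom(S i, J j)`, which is zero unless `r i < r j`; in
particular `Ext¹(S i, S i) = 0`. The other degrees vanish for distinct members, and positive ones
vanish by heredity. -/
lemma exceptionalFamily : ExceptionalFamily S := by
  obtain ⟨I, J, r, hext, hJ, hinj, hr⟩ := h.exists_resolution
  have h1 : ∀ i j, ¬ HomVanish (S i) (S j) 1 → r i < r j := fun i j hv =>
    hr i j fun h0 => hv ((hext j).coyoneda_vanish₁ h0 (hinj j _ _ (h.mem i) le_rfl).1)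
  refine ⟨⟨h.not_isZero, fun i j m hm => BddHeart.mem_vanish (h.mem i) (h.mem j) hm, h.hom_ne,
    h.brick, h.gen⟩, fun i m hm => ?_, r, fun i j m hij hv => ?_⟩
  · obtain rfl | hm := (show 1 ≤ m from hm).eq_or_lt
    · by_contra hv
      exact (h1 i i hv).false
    · exact h.vanish (h.mem i) hm i
  · obtain hm | rfl | rfl | hm : m < 0 ∨ m = 0 ∨ m = 1 ∨ 2 ≤ m := by omega
    · exact (hv (BddHeart.mem_vanish (h.mem i) (h.mem j) hm)).elim
    · exact (hv (h.hom_ne i j hij)).elim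
    · exact h1 i j hv
    · exact (hv (h.vanish (h.mem i) hm j)).elim

lemma isExceptionalHeart : IsExceptionalHeart ι H :=
  ⟨S, h.exceptionalFamily, BddHeart.eq_of_mem_imp fun E hE =>
    h.exceptionalFamily.heart_mem_iff.2 (h.filt E hE)⟩

/-- Only `Hom` and `Ext¹` between simples matter, and `Ext¹` is a quotient of a Hom space of the
heart by the resolution. Filtrations of `X` and `Y` by shifted simples do the rest. -/
lemma homFinite {k : Type u'} [Field k] [Linear k D] [∀ n : ℤ, (shiftFunctor D n).Linear k]
    (hfin : ∀ X Y, H.mem X → H.mem Y → Module.Finite k (X ⟶ Y)) (X Y : D) :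
    Module.Finite k (X ⟶ Y) := by
  obtain ⟨I, J, r, hext, hJ, hinj, -⟩ := h.exists_resolution
  have key : ∀ i j m, HomFinite k (S i) (S j) m := by
    intro i j m
    obtain hm | rfl | rfl | hm : m < 0 ∨ m = 0 ∨ m = 1 ∨ 2 ≤ m := by omega
    · exact .of_vanish (BddHeart.mem_vanish (h.mem i) (h.mem j) hm)
    · exact HomFinite.zero_iff.2 (hfin _ _ (h.mem i) (h.mem j))
    · exact .of_isExt_right (hext j).invRotate ((HomFinite.shift_right (n := 0) (by omega)).2
        (HomFinite.zero_iff.2 (hfin _ _ (h.mem i) (hJ j))))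
        (.of_vanish (hinj j _ _ (h.mem i) le_rfl).1)
    · exact .of_vanish (h.vanish (h.mem i) hm j)
  refine HomFinite.zero_iff.1 (.of_filt_left ?_ (h.gen X))
  rintro X ⟨i, a, -, ⟨e⟩⟩
  refine .of_iso_left e.symm (.of_filt_right ?_ (h.gen Y))
  rintro Y ⟨j, b, -, ⟨e'⟩⟩
  exact .of_iso_right e'.symm (.shift_left (n := -a) (by omega)
    ((HomFinite.shift_right rfl).2 (key i j _)))

end HereditarySimples

end HereditaryRecognition

/-! ### An abelian category as the heart of its bounded derived category. -/

section BoundedDerivedCategory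

section

variable {D : Type u} [Category.{v} D] [Preadditive D] [HasZeroObject D] [HasShift D ℤ]
  [∀ n : ℤ, (shiftFunctor D n).Additive] [Pretriangulated D]
  {D' : Type u'} [Category.{v'} D'] [Preadditive D'] [HasZeroObject D'] [HasShift D' ℤ]
  [∀ n : ℤ, (shiftFunctor D' n).Additive] [Pretriangulated D'] (F : D ⥤ D') [F.CommShift ℤ]
  [F.Full] [F.Faithful]

lemma HomVanish.of_map [F.PreservesZeroMorphisms] {X Y : D} {m : ℤ}
    (h : HomVanish (F.obj X) (F.obj Y) m) : HomVanish X Y m := by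
  intro f
  apply F.map_injective
  have := h (F.map f ≫ (F.commShiftIso m).hom.app Y)
  rw [Preadditive.IsIso.comp_right_eq_zero] at this
  rw [this, F.map_zero]

lemma IsExt.of_map [F.IsTriangulated] {A B C : D} (h : IsExt (F.obj A) (F.obj B) (F.obj C)) :
    IsExt A B C := by
  obtain ⟨f, g, e, hT⟩ := h
  obtain ⟨f, rfl⟩ := F.map_surjective f
  obtain ⟨g, rfl⟩ := F.map_surjective g
  obtain ⟨e', he'⟩ := F.map_surjective (e ≫ (F.commShiftIso (1 : ℤ)).inv.app A)
  obtain rfl : e = F.map e' ≫ (F.commShiftIso (1 : ℤ)).hom.app A := by simp [he']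
  exact ⟨f, g, e', (F.map_distinguished_iff _).1 hT⟩

end

variable (C : Type u) [Category.{v} C] [Abelian C] [HasDerivedCategory.{w} C]

open DerivedCategory

/-- The embedding of an abelian category in its bounded derived category. -/
noncomputable def boundedSingle : C ⥤ Bounded C :=
  TStructure.t.bounded.lift (singleFunctor C 0) fun _ =>
    ⟨⟨0, inferInstance⟩, ⟨0, inferInstance⟩⟩

instance : (boundedSingle C).Full where
  map_surjective f := ⟨(singleFunctor C 0).preimage (Bounded.ι.map f),
    Bounded.ι.map_injective ((singleFunctor C 0).map_preimage _)⟩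

instance : (boundedSingle C).Faithful where
  map_injective h := (singleFunctor C 0).map_injective (congrArg Bounded.ι.map h)

instance : (boundedSingle C).Additive where
  map_add := Bounded.ι.map_injective ((singleFunctor C 0).map_add)

instance (k : Type u') [Field k] [Linear k C] : (boundedSingle C).Linear k where
  map_smul f r := Bounded.ι.map_injective (Functor.map_smul (singleFunctor C 0) r f)

instance (k : Type u') [Field k] [Linear k C] (n : ℤ) :
    (shiftFunctor (Bounded C) n).Linear k where
  map_smul {X Y} f r := by
    apply Bounded.ι.map_injective
    rw [← cancel_mono ((Bounded.ι.commShiftIso n).hom.app Y),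
      Functor.map_smul Bounded.ι r (f⟦n⟧'), Linear.smul_comp,
      Functor.commShiftIso_hom_naturality, Functor.commShiftIso_hom_naturality,
      Functor.map_smul Bounded.ι r f, Functor.map_smul (shiftFunctor (DerivedCategory C) n),
      Linear.comp_smul]

variable {C}

lemma isExt_boundedSingle {T : ShortComplex C} (hT : T.ShortExact) :
    IsExt ((boundedSingle C).obj T.X₁) ((boundedSingle C).obj T.X₂)
      ((boundedSingle C).obj T.X₃) :=
  IsExt.of_map (Bounded.ι) ⟨_, _, _, hT.singleTriangle_distinguished⟩

/-- Homs between shifted single complexes are the `Ext` groups, which vanish in positive degrees on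
an injective. -/
lemma homVanish_boundedSingle_of_injective (X : C) {I : C} [Injective I] {m : ℤ} (hm : 1 ≤ m) :
    HomVanish ((boundedSingle C).obj X) ((boundedSingle C).obj I) m := by
  have := hasExt_of_hasDerivedCategory.{w} C
  refine HomVanish.of_map Bounded.ι fun f => ?_
  obtain ⟨n, rfl⟩ : ∃ n : ℕ, m = (n + 1 : ℕ) := ⟨(m - 1).toNat, by omega⟩
  obtain ⟨e, he⟩ := (Abelian.Ext.homAddEquiv (X := X) (Y := I) (n := n + 1)).surjective f
  rw [Abelian.Ext.eq_zero_of_injective e, map_zero] at he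
  exact he.symm

lemma mem_heart_onBounded_iff {X : Bounded C} :
    (TStructure.t (C := C)).onBounded.heart X ↔
      ∃ V, Nonempty (X ≅ (boundedSingle C).obj V) := by
  constructor
  · rintro ⟨h1, h2⟩
    have h1' : (Bounded.ι.obj X).IsLE 0 := ⟨h1⟩
    have h2' : (Bounded.ι.obj X).IsGE 0 := ⟨h2⟩
    obtain ⟨V, ⟨e⟩⟩ := exists_iso_singleFunctor_obj_of_isGE_of_isLE (Bounded.ι.obj X) 0
    exact ⟨V, ⟨Bounded.ι.preimageIso e⟩⟩
  · rintro ⟨V, ⟨e⟩⟩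
    refine (TStructure.t (C := C)).onBounded.heart.prop_of_iso e.symm ⟨?_, ?_⟩
    · exact (inferInstance : ((singleFunctor C 0).obj V).IsLE 0).le
    · exact (inferInstance : ((singleFunctor C 0).obj V).IsGE 0).ge

end BoundedDerivedCategory

/-! ### Finite acyclic quivers: a rank on vertices, and finiteness of path sets. -/

section AcyclicQuivers

variable {Q : Type u} [Quiver.{v} Q]

/-- The number of vertices from which there is a path to `a`. -/
noncomputable def vertexRank (a : Q) : ℕ := {x : Q | Nonempty (Quiver.Path x a)}.ncard

variable [Finite Q] (hQ : QuiverIsAcyclic Q)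
include hQ

/-- Predecessors of `a` are predecessors of `b`, and `b` itself is a new one: a path from `b` to `a`
would close a cycle with `e`. -/
lemma vertexRank_lt {a b : Q} (e : a ⟶ b) : vertexRank a < vertexRank b := by
  refine Set.ncard_lt_ncard ⟨?_, fun h => ?_⟩ (Set.toFinite _)
  · rintro x ⟨p⟩
    exact ⟨p.cons e⟩
  · obtain ⟨p⟩ := h (show b ∈ {x : Q | Nonempty (Quiver.Path x b)} from ⟨.nil⟩)
    have := congrArg Quiver.Path.length (hQ b (p.cons e))
    simp at this

lemma finite_path [∀ a b : Q, Finite (a ⟶ b)] (a b : Q) : Finite (Quiver.Path a b) := by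
  induction hn : vertexRank b using Nat.strong_induction_on generalizing b with
  | _ n ih =>
    have : ∀ c : Q, Finite (Quiver.Path a c × (c ⟶ b)) := by
      intro c
      obtain h | ⟨⟨e⟩⟩ := isEmpty_or_nonempty (c ⟶ b)
      · infer_instance
      · have := ih _ (hn ▸ vertexRank_lt hQ e) c rfl
        infer_instance
    let φ : Quiver.Path a b → Option (Σ c, Quiver.Path a c × (c ⟶ b)) := fun p =>
      match p with
      | .nil => none
      | .cons q e => some ⟨_, q, e⟩
    refine Finite.of_injective φ fun p q h => ?_
    cases p <;> cases q
    · rfl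
    · simp [φ] at h
    · simp [φ] at h
    · simp only [φ, Option.some.injEq, Sigma.mk.injEq] at h
      obtain ⟨rfl, h⟩ := h
      obtain ⟨rfl, rfl⟩ := Prod.mk.inj (eq_of_heq h)
      rfl

end AcyclicQuivers

/-! ### Kernels of representations, and coinduced injective representations. -/

section Representations

variable {k : Type u'} [Field k] {Q : Type u} [Quiver.{v} Q]

namespace QuiverRep

/-- The linear maps of a representation. -/
def act (V : QuiverRep k Q) {i j : Paths Q} (p : i ⟶ j) : V.obj i →ₗ[k] V.obj j :=
  (V.map p).hom.hom

/-- The components of a morphism of representations. -/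
def ev {V W : QuiverRep k Q} (f : V ⟶ W) (j : Paths Q) : V.obj j →ₗ[k] W.obj j :=
  (f.app j).hom.hom

variable {U V W : QuiverRep k Q} {i j l : Paths Q}

lemma act_comp (p : i ⟶ j) (q : j ⟶ l) (v : V.obj i) :
    act V (p ≫ q) v = act V q (act V p v) := by
  simp [act]

lemma act_id (v : V.obj i) : act V (𝟙 i) v = v := by
  simp [act]

lemma ev_act (f : V ⟶ W) (p : i ⟶ j) (v : V.obj i) :
    ev f j (act V p v) = act W p (ev f i v) :=
  congrArg (fun g => g.hom.hom v) (f.naturality p)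

lemma ev_comp (f : U ⟶ V) (g : V ⟶ W) (v : U.obj j) : ev (f ≫ g) j v = ev g j (ev f j v) := rfl

lemma ev_id (v : V.obj j) : ev (𝟙 V) j v = v := rfl

lemma ev_zero (v : V.obj j) : ev (0 : V ⟶ W) j v = 0 := rfl

lemma hom_ext {f g : V ⟶ W} (h : ∀ j v, ev f j v = ev g j v) : f = g := by
  exact NatTrans.ext (funext fun j => FGModuleCat.hom_ext (LinearMap.ext (h j)))

/-- Construct a morphism of representations. -/
def homMk (φ : ∀ j, V.obj j →ₗ[k] W.obj j)
    (h : ∀ {i j : Paths Q} (p : i ⟶ j) (v : V.obj i), φ j (act V p v) = act W p (φ i v)) :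
    V ⟶ W where
  app j := FGModuleCat.ofHom (φ j)
  naturality _ _ p := FGModuleCat.hom_ext (LinearMap.ext fun v => h p v)

lemma isZero_of_subsingleton (h : ∀ j, Subsingleton (V.obj j)) : IsZero V := by
  rw [IsZero.iff_id_eq_zero]
  exact hom_ext fun j v => (h j).elim _ _

lemma epi_of_surjective (f : V ⟶ W) (h : ∀ j, Function.Surjective (ev f j)) : Epi f := by
  constructor
  intro U g g' hg
  refine hom_ext fun j w => ?_
  obtain ⟨v, rfl⟩ := h j w
  rw [← ev_comp, hg, ev_comp]

/-- The kernel of a morphism of representations. -/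
def kerRep (g : V ⟶ W) : QuiverRep k Q where
  obj j := FGModuleCat.of k (LinearMap.ker (ev g j))
  map {i j} p := FGModuleCat.ofHom ((act V p).restrict (p := LinearMap.ker (ev g i))
    (q := LinearMap.ker (ev g j)) fun v hv => by
      rw [LinearMap.mem_ker] at hv ⊢
      rw [ev_act, hv, map_zero])
  map_id i := FGModuleCat.hom_ext (LinearMap.ext fun v => Subtype.ext (act_id v.1))
  map_comp p q := FGModuleCat.hom_ext (LinearMap.ext fun v => Subtype.ext (act_comp p q v.1))

/-- The inclusion of the kernel. -/
def kerι (g : V ⟶ W) : kerRep g ⟶ V := homMk (fun _ => Submodule.subtype _) fun _ _ => rfl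

lemma kerι_comp (g : V ⟶ W) : kerι g ≫ g = 0 := hom_ext fun _ v => v.2

/-- The universal property of the kernel. -/
def kerLift (g : V ⟶ W) (f : U ⟶ V) (h : f ≫ g = 0) : U ⟶ kerRep g :=
  homMk (fun j => (ev f j).codRestrict _ fun v => by
    rw [LinearMap.mem_ker, ← ev_comp, h, ev_zero]) fun p v => Subtype.ext (ev_act f p v)

lemma kerLift_kerι (g : V ⟶ W) (f : U ⟶ V) (h : f ≫ g = 0) : kerLift g f h ≫ kerι g = f := rfl

lemma shortExact_kerι (g : V ⟶ W) (hg : ∀ j, Function.Surjective (ev g j)) :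
    (ShortComplex.mk (kerι g) g (kerι_comp g)).ShortExact := by
  have hm : Mono (kerι g) := ⟨fun f f' h => hom_ext fun j v =>
    Subtype.ext (congrArg (fun x => ev x j v) h)⟩
  exact
    { exact := ShortComplex.exact_of_f_is_kernel _
        (KernelFork.IsLimit.ofι' _ _ fun f h => ⟨kerLift g f h, kerLift_kerι g f h⟩)
      mono_f := hm
      epi_g := epi_of_surjective g hg }

lemma injective_ev_of_mono (f : V ⟶ W) [Mono f] (j : Paths Q) : Function.Injective (ev f j) := by
  have h : kerι f = 0 := by
    rw [← cancel_mono f, kerι_comp, zero_comp]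
  rw [← LinearMap.ker_eq_bot, LinearMap.ker_eq_bot']
  intro v hv
  exact congrArg (fun x : kerRep f ⟶ V => ev x j (⟨v, hv⟩ : LinearMap.ker (ev f j))) h

section Coinduced

variable [∀ i j : Paths Q, Finite (i ⟶ j)] {A : Type w} [Finite A] (t : A → Paths Q)

/-- The representation of functions on the paths that end in the family `t` of vertices. -/
noncomputable def coind : QuiverRep k Q where
  -- The finite index type is shrunk so that the function space lies in the universe of `k`.
  obj j := FGModuleCat.of k (Shrink.{0} (Σ a, j ⟶ t a) → k)
  map {i j} p := FGModuleCat.ofHom (LinearMap.funLeft k k fun x : Shrink.{0} (Σ a, j ⟶ t a) =>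
    equivShrink.{0} (Σ a, i ⟶ t a) ⟨((equivShrink _).symm x).1, p ≫ ((equivShrink _).symm x).2⟩)
  map_id i := FGModuleCat.hom_ext (LinearMap.ext fun v => funext fun x => by
    change v (equivShrink.{0} (Σ a, i ⟶ t a) ⟨((equivShrink.{0} (Σ a, i ⟶ t a)).symm x).1,
      𝟙 i ≫ ((equivShrink.{0} (Σ a, i ⟶ t a)).symm x).2⟩) = v x
    rw [Category.id_comp]
    exact congrArg v ((equivShrink.{0} (Σ a, i ⟶ t a)).apply_symm_apply x))
  map_comp {i j l} p q := FGModuleCat.hom_ext (LinearMap.ext fun v => funext fun x => by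
    -- The index is generalised to a variable `y`, so that the round trip through `equivShrink` can
    -- be removed by substitution despite the dependent pair.
    have : ∀ (y) (z : Σ a, l ⟶ t a), y = (⟨z.1, q ≫ z.2⟩ : Σ a, j ⟶ t a) →
        (⟨z.1, (p ≫ q) ≫ z.2⟩ : Σ a, i ⟶ t a) = ⟨y.1, p ≫ y.2⟩ := by
      rintro _ z rfl
      rw [Category.assoc]
    exact congrArg (fun x => v (equivShrink.{0} (Σ a, i ⟶ t a) x))
      (this _ _ ((equivShrink.{0} (Σ a, j ⟶ t a)).symm_apply_apply _)))

variable {t}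

/-- The value of a function on a path. -/
noncomputable def coord (a : A) (q : j ⟶ t a) : (coind (k := k) t).obj j →ₗ[k] k :=
  LinearMap.proj (equivShrink.{0} (Σ a, j ⟶ t a) ⟨a, q⟩)

lemma coord_ext {φ ψ : (coind (k := k) t).obj j} (h : ∀ a (q : j ⟶ t a), coord a q φ = coord a q ψ) :
    φ = ψ := by
  funext x
  obtain ⟨⟨a, q⟩, rfl⟩ := (equivShrink.{0} (Σ a, j ⟶ t a)).surjective x
  exact h a q

lemma exists_coord (f : ∀ a, (j ⟶ t a) → k) :
    ∃ φ : (coind (k := k) t).obj j, ∀ a q, coord a q φ = f a q :=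
  ⟨fun x => f _ ((equivShrink.{0} (Σ a, j ⟶ t a)).symm x).2, fun a q => by
    have : ∀ y : Σ a, j ⟶ t a, y = ⟨a, q⟩ → f y.1 y.2 = f a q := by
      rintro _ rfl
      rfl
    exact this _ ((equivShrink.{0} (Σ a, j ⟶ t a)).symm_apply_apply ⟨a, q⟩)⟩

lemma coord_act (p : i ⟶ j) (φ : (coind (k := k) t).obj i) (a : A) (q : j ⟶ t a) :
    coord a q (act (coind t) p φ) = coord a (p ≫ q) φ := by
  change φ (equivShrink.{0} (Σ a, i ⟶ t a) ⟨((equivShrink.{0} (Σ a, j ⟶ t a)).symm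
    (equivShrink.{0} (Σ a, j ⟶ t a) ⟨a, q⟩)).1, p ≫ ((equivShrink.{0} (Σ a, j ⟶ t a)).symm
    (equivShrink.{0} (Σ a, j ⟶ t a) ⟨a, q⟩)).2⟩) = φ (equivShrink.{0} (Σ a, i ⟶ t a) ⟨a, p ≫ q⟩)
  have : ∀ y : Σ a, j ⟶ t a, y = ⟨a, q⟩ →
      (⟨y.1, p ≫ y.2⟩ : Σ a, i ⟶ t a) = ⟨a, p ≫ q⟩ := by
    rintro _ rfl
    rfl
  rw [this _ ((equivShrink.{0} (Σ a, j ⟶ t a)).symm_apply_apply ⟨a, q⟩)]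

/-- By naturality the value on a path `q` is the value on the trivial path after acting by `q`. With
`coindLift`, morphisms to `coind t` amount to families of linear forms on the spaces `V.obj (t a)`.
-/
lemma coind_hom_ext {f g : V ⟶ coind t}
    (h : ∀ a v, coord a (𝟙 (t a)) (ev f _ v) = coord a (𝟙 (t a)) (ev g _ v)) : f = g := by
  have key : ∀ (f : V ⟶ coind t) j v a (q : j ⟶ t a),
      coord a q (ev f j v) = coord a (𝟙 (t a)) (ev f _ (act V q v)) := by
    intro f j v a q
    rw [ev_act, coord_act, Category.comp_id]
  refine hom_ext fun j v => coord_ext fun a q => ?_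
  rw [key f, key g, h]

lemma exists_coindLift (l : ∀ a, V.obj (t a) →ₗ[k] k) : ∃ f : V ⟶ coind t,
    ∀ j (v : V.obj j) a (q : j ⟶ t a), coord a q (ev f j v) = l a (act V q v) := by
  let φ (j : Paths Q) : V.obj j →ₗ[k] (coind (k := k) t).obj j := LinearMap.pi fun x =>
    l _ ∘ₗ act V ((equivShrink.{0} (Σ a, j ⟶ t a)).symm x).2
  have hφ (j) (v : V.obj j) (a) (q : j ⟶ t a) : coord a q (φ j v) = l a (act V q v) := by
    have : ∀ y : Σ a, j ⟶ t a, y = ⟨a, q⟩ → l y.1 (act V y.2 v) = l a (act V q v) := by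
      rintro _ rfl
      rfl
    exact this _ ((equivShrink.{0} (Σ a, j ⟶ t a)).symm_apply_apply ⟨a, q⟩)
  exact ⟨homMk φ fun p v => coord_ext fun a q => by rw [hφ, coord_act, hφ, act_comp],
    fun j v a q => hφ j v a q⟩

variable (t) in
/-- The morphism to a coinduced representation that is given by a family of linear forms. -/
noncomputable def coindLift (l : ∀ a, V.obj (t a) →ₗ[k] k) : V ⟶ coind t :=
  (exists_coindLift l).choose

lemma coord_coindLift (l : ∀ a, V.obj (t a) →ₗ[k] k) (v : V.obj j) (a : A) (q : j ⟶ t a) :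
    coord a q (ev (coindLift t l) j v) = l a (act V q v) :=
  (exists_coindLift l).choose_spec j v a q

/-- Extending a morphism along a monomorphism means extending linear forms from subspaces, which is
possible over a field. -/
instance : Injective (coind (k := k) t) where
  factors {V W} f g hg := by
    have : ∀ a, ∃ m : W.obj (t a) →ₗ[k] k,
        m ∘ₗ ev g (t a) = coord a (𝟙 (t a)) ∘ₗ ev f (t a) := fun a =>
      LinearMap.exists_leftInverse_of_injective _
        (LinearMap.ker_eq_bot.2 (injective_ev_of_mono g (t a))) |>.elim fun r hr =>
          ⟨(coord a (𝟙 (t a)) ∘ₗ ev f (t a)) ∘ₗ r, by rw [LinearMap.comp_assoc, hr]; rfl⟩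
    choose m hm using this
    refine ⟨coindLift t m, coind_hom_ext fun a v => ?_⟩
    rw [ev_comp, coord_coindLift, act_id]
    exact LinearMap.congr_fun (hm a) v

end Coinduced

end QuiverRep

end Representations

/-! ### Vertex simples, their injective resolutions, and the standard heart. -/

section VertexSimples

variable {k : Type u'} [Field k] {Q : Type u} [Quiver.{v} Q]

namespace QuiverRep

variable {V W : QuiverRep k Q}

lemma ev_smul (c : k) (f : V ⟶ W) {j : Paths Q} (v : V.obj j) : ev (c • f) j v = c • ev f j v := rfl

lemma finite_hom [Finite Q] (V W : QuiverRep k Q) : Module.Finite k (V ⟶ W) := by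
  have : Finite (Paths Q) := inferInstanceAs (Finite Q)
  let φ : (V ⟶ W) →ₗ[k] ∀ j : Paths Q, V.obj j →ₗ[k] W.obj j :=
    { toFun := fun f j => ev f j
      map_add' := fun _ _ => rfl
      map_smul' := fun _ _ => rfl }
  exact Module.Finite.of_injective φ fun f g h =>
    hom_ext fun j v => LinearMap.congr_fun (congrFun h j) v

/-- The arrows of the quiver, as a type that is indexed by objects of the path category. -/
def Arrow (b i : Paths Q) : Type v := @Quiver.Hom Q _ b i

/-- The path of an arrow. -/
def Arrow.path {b i : Paths Q} (e : Arrow b i) : b ⟶ i := Quiver.Hom.toPath (V := Q) e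

lemma eq_eqToHom_or_comp {j i : Paths Q} (q : j ⟶ i) :
    (∃ h : j = i, q = eqToHom h) ∨ ∃ (b : _) (e : Arrow b i) (p : j ⟶ b), q = p ≫ e.path := by
  have : ∀ (i : Paths Q) (q : Quiver.Path (V := Q) j i), (∃ h : j = i, q = eqToHom h) ∨
      ∃ (b : Paths Q) (e : Arrow b i) (p : j ⟶ b), q = p ≫ e.path := by
    intro i q
    cases q with
    | nil => exact .inl ⟨rfl, rfl⟩
    | cons p e => exact .inr ⟨_, e, p, rfl⟩
  exact this i q

/-- A path is trivial or has a unique last arrow, so both kinds of value can be prescribed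
independently. This makes `vertexMap` surjective, with one-dimensional kernel at `i`. -/
lemma exists_path_function {j i : Paths Q} (c : k) (F : ∀ b, Arrow b i → (j ⟶ b) → k) :
    ∃ f : (j ⟶ i) → k, (∀ h : j = i, f (eqToHom h) = c) ∧
      ∀ (b) (e : Arrow b i) (p : j ⟶ b), f (p ≫ e.path) = F b e p := by
  let f (q : Quiver.Path (V := Q) j i) : k :=
    match i, q, F with
    | _, .nil, _ => c
    | _, .cons p e, F => F _ e p
  refine ⟨f, ?_, fun b e p => rfl⟩
  rintro rfl
  rfl

variable [∀ i j : Paths Q, Finite (i ⟶ j)] [∀ a b : Q, Finite (a ⟶ b)] [Finite Q]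

instance (b i : Paths Q) : Finite (Arrow b i) := (inferInstance : ∀ a b : Q, Finite (a ⟶ b)) b i

instance : Finite (Paths Q) := inferInstanceAs (Finite Q)

variable (k) in
/-- The injective hull of the simple representation at a vertex. -/
noncomputable abbrev vertexInjective (i : Paths Q) : QuiverRep k Q := coind (fun _ : Unit => i)

variable (k) in
/-- The cokernel of the inclusion of the simple representation at a vertex in its hull. -/
noncomputable abbrev vertexCokernel (i : Paths Q) : QuiverRep k Q :=
  coind (Sigma.fst : (Σ b : Paths Q, Arrow b i) → Paths Q)

variable (k) in
/-- The restriction of functions on paths, by composition with the last arrow. -/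
noncomputable def vertexMap (i : Paths Q) : vertexInjective k i ⟶ vertexCokernel k i :=
  coindLift _ fun x => coord (t := fun _ : Unit => i) () x.2.path

variable (k) in
/-- The simple representation at a vertex. -/
noncomputable def vertexSimple (i : Paths Q) : QuiverRep k Q := kerRep (vertexMap k i)

variable (k) in
/-- The inclusion of the simple representation at a vertex in its injective hull. -/
noncomputable def vertexι (i : Paths Q) : vertexSimple k i ⟶ vertexInjective k i :=
  kerι (vertexMap k i)

variable {i j b : Paths Q}

lemma coord_vertexMap (e : Arrow b i) (q : j ⟶ b) (φ : (vertexInjective k i).obj j) :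
    coord (t := (Sigma.fst : (Σ b : Paths Q, Arrow b i) → Paths Q)) ⟨b, e⟩ q
      (ev (vertexMap k i) j φ) = coord (t := fun _ : Unit => i) () (q ≫ e.path) φ :=
  (coord_coindLift (t := (Sigma.fst : (Σ b : Paths Q, Arrow b i) → Paths Q))
    (fun x => coord (t := fun _ : Unit => i) () x.2.path) φ ⟨b, e⟩ q).trans (coord_act _ _ _ _)

lemma surjective_vertexMap (i j : Paths Q) : Function.Surjective (ev (vertexMap k i) j) := by
  intro ψ
  obtain ⟨f, -, hf⟩ := exists_path_function 0 fun b e (q : j ⟶ b) =>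
    coord (t := (Sigma.fst : (Σ b : Paths Q, Arrow b i) → Paths Q)) ⟨b, e⟩ q ψ
  obtain ⟨φ, hφ⟩ := exists_coord (t := fun _ : Unit => i) fun _ => f
  refine ⟨φ, coord_ext ?_⟩
  rintro ⟨b, e⟩ q
  rw [coord_vertexMap, hφ, hf]

/-- The value of an element of the simple representation at a vertex on the trivial path. -/
noncomputable def vertexForm (i : Paths Q) : (vertexSimple k i).obj i →ₗ[k] k :=
  coord (t := fun _ : Unit => i) () (𝟙 i) ∘ₗ ev (vertexι k i) i

lemma coord_vertexSimple (s : (vertexSimple k i).obj j) (e : Arrow b i) (q : j ⟶ b) :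
    coord (t := fun _ : Unit => i) () (q ≫ e.path) (ev (vertexι k i) j s) = 0 := by
  have : ev (vertexMap k i) j (ev (vertexι k i) j s) = 0 := s.2
  rw [← coord_vertexMap, this, map_zero]

lemma injective_ev_vertexι (i j : Paths Q) : Function.Injective (ev (vertexι k i) j) :=
  Subtype.val_injective

lemma vertexSimple_eq_zero (h : j ≠ i) (s : (vertexSimple k i).obj j) : s = 0 := by
  apply injective_ev_vertexι
  rw [map_zero]
  refine coord_ext fun _ q => ?_
  rw [map_zero]
  obtain ⟨h', -⟩ | ⟨b, e, p, rfl⟩ := eq_eqToHom_or_comp q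
  · exact (h h').elim
  · exact coord_vertexSimple s e p

lemma injective_vertexForm (i : Paths Q) : Function.Injective (vertexForm (k := k) i) := by
  rw [injective_iff_map_eq_zero]
  intro s hs
  apply injective_ev_vertexι
  rw [map_zero]
  refine coord_ext fun _ q => ?_
  rw [map_zero]
  obtain ⟨h', rfl⟩ | ⟨b, e, p, rfl⟩ := eq_eqToHom_or_comp q
  · exact hs
  · exact coord_vertexSimple s e p

lemma exists_vertexForm_eq_one (i : Paths Q) : ∃ s, vertexForm (k := k) i s = 1 := by
  obtain ⟨f, hf, hf'⟩ := exists_path_function (i := i) (j := i) (1 : k) fun _ _ _ => 0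
  obtain ⟨φ, hφ⟩ := exists_coord (t := fun _ : Unit => i) fun _ => f
  have h : ev (vertexMap k i) i φ = 0 := by
    refine coord_ext ?_
    rintro ⟨b, e⟩ q
    rw [coord_vertexMap, hφ, hf', map_zero]
  exact ⟨⟨φ, h⟩, (hφ () (𝟙 i)).trans (hf rfl)⟩

lemma vertexSimple_hom_ext {f g : vertexSimple k i ⟶ V} {s : (vertexSimple k i).obj i}
    (hs : vertexForm i s = 1) (h : ev f i s = ev g i s) : f = g := by
  refine hom_ext fun j v => ?_
  obtain rfl | hj := eq_or_ne j i
  · have hv : v = vertexForm j v • s := injective_vertexForm j (by simp [hs])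
    rw [hv, map_smul, map_smul, h]
  · rw [vertexSimple_eq_zero hj v, map_zero, map_zero]

lemma not_isZero_vertexSimple (i : Paths Q) : ¬ IsZero (vertexSimple k i) := by
  intro h
  obtain ⟨s, hs⟩ := exists_vertexForm_eq_one (k := k) i
  have h1 : ev (𝟙 (vertexSimple k i)) i s = ev (0 : vertexSimple k i ⟶ vertexSimple k i) i s := by
    rw [h.eq_of_src (𝟙 _) 0]
  rw [ev_id, ev_zero] at h1
  rw [h1, map_zero] at hs
  exact zero_ne_one hs

lemma vertexSimple_eq_zero_or_isIso (f : vertexSimple k i ⟶ vertexSimple k i) :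
    f = 0 ∨ IsIso f := by
  obtain ⟨s, hs⟩ := exists_vertexForm_eq_one (k := k) i
  obtain ⟨c, rfl⟩ : ∃ c : k, f = c • 𝟙 _ := ⟨vertexForm i (ev f i s), vertexSimple_hom_ext hs
    (injective_vertexForm i (by rw [ev_smul, ev_id, map_smul, hs, smul_eq_mul, mul_one]))⟩
  obtain rfl | hc := eq_or_ne c 0
  · exact .inl (zero_smul _ _)
  · exact .inr ⟨c⁻¹ • 𝟙 _, by simp [smul_smul, hc], by simp [smul_smul, hc]⟩

lemma vertexSimple_hom_eq_zero (h : i ≠ j) (f : vertexSimple k i ⟶ vertexSimple k j) :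
    f = 0 := by
  obtain ⟨s, hs⟩ := exists_vertexForm_eq_one (k := k) i
  exact vertexSimple_hom_ext hs ((vertexSimple_eq_zero h _).trans (ev_zero _).symm)

/-- `f` is given by linear forms on the simple at the sources `b` of the arrows into `j`, and the
simple lives only at `i`. This provides the rank condition. -/
lemma exists_arrow_of_hom_ne_zero {f : vertexSimple k i ⟶ vertexCokernel k j}
    (hf : f ≠ 0) : Nonempty (Arrow i j) := by
  by_contra h
  refine hf (coind_hom_ext ?_)
  rintro ⟨b, e⟩ s
  have hb : b ≠ i := by
    rintro rfl
    exact h ⟨e⟩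
  rw [vertexSimple_eq_zero hb s, map_zero, map_zero, ev_zero, map_zero]

/-- The sum of the dimensions at the vertices. -/
noncomputable def totalDim [Fintype (Paths Q)] (V : QuiverRep k Q) : ℕ := ∑ j, Module.finrank k (V.obj j)

/-- At a vertex `i` of minimal rank in the support of `V` no arrow arrives from the support, so
every linear form on `V.obj i` defines a morphism to the simple at `i`. Its kernel has smaller
dimension, which gives finite length. -/
lemma exists_surjective_vertexSimple (hQ : QuiverIsAcyclic Q) (hV : ¬ IsZero V) :
    ∃ (i : Paths Q) (f : V ⟶ vertexSimple k i), (∀ j, Function.Surjective (ev f j)) ∧ ev f i ≠ 0 := by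
  obtain ⟨i, hi, hmin⟩ : ∃ i : Paths Q, Nontrivial (V.obj i) ∧
      ∀ b : Paths Q, Nontrivial (V.obj b) → ¬ vertexRank (Q := Q) b < vertexRank (Q := Q) i := by
    refine (InvImage.wf (vertexRank (Q := Q)) wellFounded_lt).has_min
      {i : Paths Q | Nontrivial (V.obj i)} ?_
    by_contra! h
    exact hV (isZero_of_subsingleton fun j => not_nontrivial_iff_subsingleton.1
      (Set.eq_empty_iff_forall_notMem.1 h j))
  obtain ⟨v, hv⟩ := exists_ne (0 : V.obj i)
  obtain ⟨l, hl⟩ : ∃ l : V.obj i →ₗ[k] k, l v ≠ 0 := by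
    by_contra! h
    exact hv ((Module.forall_dual_apply_eq_zero_iff k v).1 h)
  -- The components of this composite are linear forms on the spaces `V.obj b` for arrows `b → i`,
  -- and these spaces are zero by the choice of `i`.
  have h0 : coindLift (fun _ : Unit => i) (fun _ => l) ≫ vertexMap k i = 0 := by
    refine coind_hom_ext ?_
    rintro ⟨b, e⟩ w
    have : Subsingleton (V.obj b) := not_nontrivial_iff_subsingleton.1 fun h =>
      hmin b h (vertexRank_lt hQ e)
    rw [Subsingleton.elim w 0, map_zero, map_zero, ev_zero, map_zero]
  obtain ⟨f, hf⟩ : ∃ f : V ⟶ vertexSimple k i, vertexForm i (ev f i v) = l v := by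
    refine ⟨kerLift _ _ h0, ?_⟩
    refine (coord_coindLift (t := fun _ : Unit => i) (fun _ => l) v () (𝟙 i)).trans ?_
    rw [act_id]
  refine ⟨i, f, fun j s => ?_, fun h => hl ?_⟩
  · obtain rfl | hj := eq_or_ne j i
    · refine ⟨(vertexForm j s / l v) • v, injective_vertexForm j ?_⟩
      rw [map_smul, map_smul, hf, smul_eq_mul, div_mul_cancel₀ _ hl]
    · exact ⟨0, (map_zero _).trans (vertexSimple_eq_zero hj s).symm⟩
  · rw [← hf, h, LinearMap.zero_apply, map_zero]

lemma totalDim_kerRep_lt [Fintype (Paths Q)] {f : V ⟶ W} (h : ev f i ≠ 0) :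
    totalDim (kerRep f) < totalDim V := by
  refine Finset.sum_lt_sum (fun j _ => Submodule.finrank_le (LinearMap.ker (ev f j)))
    ⟨i, Finset.mem_univ _, Submodule.finrank_lt fun h' => h (LinearMap.ker_eq_top.1 h')⟩

end QuiverRep

variable [∀ i j : Paths Q, Finite (i ⟶ j)] [∀ a b : Q, Finite (a ⟶ b)] [Finite Q]
  [HasDerivedCategory.{w} (QuiverRep k Q)]

open QuiverRep

lemma filt_boundedSingle (hQ : QuiverIsAcyclic Q) (V : QuiverRep k Q) :
    Filt (fun X => ∃ i : Paths Q, Nonempty (X ≅ (boundedSingle _).obj (vertexSimple k i)))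
      ((boundedSingle _).obj V) := by
  have := Fintype.ofFinite (Paths Q)
  induction hn : totalDim V using Nat.strong_induction_on generalizing V with
  | _ n ih =>
    by_cases hV : IsZero V
    · exact .zero ((boundedSingle _).map_isZero hV)
    · obtain ⟨i, f, hf, hi⟩ := exists_surjective_vertexSimple hQ hV
      exact .ext (isExt_boundedSingle (shortExact_kerι f hf))
        (ih _ (hn ▸ totalDim_kerRep_lt hi) _ rfl) (.base ⟨i, ⟨Iso.refl _⟩⟩)

variable (k) in
lemma hereditarySimples_standardHeart (hQ : QuiverIsAcyclic Q) :
    HereditarySimples (standardHeart k Q)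
      fun i : Paths Q => (boundedSingle _).obj (vertexSimple k i) where
  mem i := mem_heart_onBounded_iff.2 ⟨_, ⟨Iso.refl _⟩⟩
  not_isZero i h := not_isZero_vertexSimple (k := k) i
    ((IsZero.iff_id_eq_zero _).2 ((boundedSingle _).map_injective (h.eq_of_src _ _)))
  brick i f := by
    obtain ⟨f, rfl⟩ := (boundedSingle _).map_surjective f
    obtain rfl | h := vertexSimple_eq_zero_or_isIso f
    · exact .inl (Functor.map_zero _ _ _)
    · exact .inr inferInstance
  hom_ne i j h := HomVanish.zero_iff.2 fun f => by
    obtain ⟨f, rfl⟩ := (boundedSingle _).map_surjective f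
    rw [vertexSimple_hom_eq_zero h f, Functor.map_zero]
  filt E hE := by
    obtain ⟨V, ⟨e⟩⟩ := mem_heart_onBounded_iff.1 hE
    exact (filt_boundedSingle hQ V).of_iso e.symm
  exists_resolution := by
    refine ⟨fun i => (boundedSingle _).obj (vertexInjective k i),
      fun i => (boundedSingle _).obj (vertexCokernel k i), fun i => vertexRank (Q := Q) i,
      fun i => isExt_boundedSingle (shortExact_kerι (vertexMap k i) (surjective_vertexMap i)),
      fun i => mem_heart_onBounded_iff.2 ⟨_, ⟨Iso.refl _⟩⟩, fun i E m hE hm => ?_,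
      fun i j h => ?_⟩
    · obtain ⟨V, ⟨e⟩⟩ := mem_heart_onBounded_iff.1 hE
      exact ⟨(homVanish_boundedSingle_of_injective V hm).of_iso_left e.symm,
        (homVanish_boundedSingle_of_injective V hm).of_iso_left e.symm⟩
    · rw [HomVanish.zero_iff] at h
      push Not at h
      obtain ⟨f, hf⟩ := h
      obtain ⟨f, rfl⟩ := (boundedSingle _).map_surjective f
      obtain ⟨e⟩ := exists_arrow_of_hom_ne_zero (f := f) fun h => hf (by rw [h, Functor.map_zero])
      exact Nat.cast_lt.2 (vertexRank_lt hQ e)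

variable (k) in
lemma finite_hom_DQ (hQ : QuiverIsAcyclic Q) (X Y : DQ k Q) : Module.Finite k (X ⟶ Y) := by
  refine (hereditarySimples_standardHeart k hQ).homFinite (fun X Y hX hY => ?_) X Y
  obtain ⟨V, ⟨e⟩⟩ := mem_heart_onBounded_iff.1 hX
  obtain ⟨W, ⟨e'⟩⟩ := mem_heart_onBounded_iff.1 hY
  have := finite_hom V W
  have : Module.Finite k ((boundedSingle _).obj V ⟶ (boundedSingle _).obj W) :=
    Module.Finite.of_surjective ((boundedSingle _).mapLinearMap k) (boundedSingle _).map_surjective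
  exact (Module.Finite.equiv_iff (Linear.homCongr k e e')).2 this

end VertexSimples

theorem mainTheorem10 (k : Type u') [Field k] [IsAlgClosed k]
    (Q : Type u) [Quiver.{v} Q] [Finite Q] [∀ a b : Q, Finite (a ⟶ b)]
    (hQ : QuiverIsAcyclic Q) [HasDerivedCategory.{w} (QuiverRep k Q)]
    (N : ℕ) (hN : 2 ≤ N) :
    -- the lines `l(H, S)` are well defined for all `H` in `EG°(Q)` and all simples `S` of `H`
    (∀ H ∈ (EGQ k Q).verts, ∀ S : DQ k Q, H.IsSimple S →
      ∃! l : ℤ → BddHeart (DQ k Q), IsIteratedTilt H S l) ∧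
    -- `EG°_N(Q, H_Q)` is a convex subgraph in `EG°(Q)`
    ((EGNQ k Q N).IsSubgraphOf (EGQ k Q) ∧ IsConvex (EGNQ k Q N)) ∧
    -- every basic cycle in its cyclic completion is an `(N-1)`-cycle
    (∀ a : AddedEdge (EGNQ k Q N), (basicCycle a).IsCycle (N - 1)) ∧
    -- `H_Q[1]` is the unique source and `H_Q[N-1]` is the unique sink
    (∀ H : BddHeart (DQ k Q),
      (EGNQ k Q N).IsSource H ↔ H = (standardHeart k Q).shift 1) ∧
    (∀ H : BddHeart (DQ k Q),
      (EGNQ k Q N).IsSink H ↔ H = (standardHeart k Q).shift ((N : ℤ) - 1)) := by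
  have : ∀ i j : Paths Q, Finite (i ⟶ j) := fun i j => finite_path hQ i j
  have h := hereditarySimples_standardHeart k hQ
  have hfin := finite_hom_DQ k hQ
  exact ⟨fun H hH S hS => (isExceptionalHeart_of_mem hfin h.hereditary h.isExceptionalHeart
      hH).existsUnique_isIteratedTilt hfin h.hereditary hS,
    ⟨EGbasePrincipal_isSubgraphOf h.hereditary h.isExceptionalHeart,
      isConvex_EGbasePrincipal h.hereditary hN⟩,
    isCycle_basicCycle h.hereditary,
    fun _ => isSource_EGbasePrincipal_iff hfin h.hereditary h.isExceptionalHeart hN,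
    fun _ => isSink_EGbasePrincipal_iff hfin h.hereditary h.isExceptionalHeart hN⟩
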